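/- For a $k$-uniform hypergraph $G$ let $\delta_{k-1}(G)$ be the minimum, over all sets $S$ of $k-1$ vertices of $G$, of the number of vertices $v$ such that $S\cup\{v\}$ is an edge. For a $k$-uniform hypergraph $F$ let $\mathrm{ex}_{k-1}(n,F)$ be the largest value of $\delta_{k-1}(G)$ over all $k$-uniform hypergraphs $G$ on $n$ vertices that contain no copy of $F$, and let $\gamma(F)=\lim_{n\to\infty}\mathrm{ex}_{k-1}(n,F)/n$ be the codegree Turán density of $F$. For $k<\ell$ the tight cycle $C^k_\ell$ is the $k$-uniform hypergraph with vertex set $\mathbb Z/\ell\mathbb Z$ and edges $\{i,i+1,\dots,i+k-1\}$, $i\in\mathbb Z/\ell\mathbb Z$. Let $3\le k<\ell$ be integers with $k\nmid\ell$ and $\ell\ge 20k^2$, and let $p$ be the smallest prime factor of $k/\gcd(k,\ell)$. Then the limit $\gamma(C^k_\ell)$ exists and $\gamma(C^k_\ell)\ge \frac1p$. The tightness of this lower bound is as follows. 1. If $p=2$, then $\gamma(C^k_\ell)=\frac12$. 2. If $p=3$, then $\gamma(C^k_\ell)=\frac13$. 3. For every prime $p>3$ there are infinitely many pairs $(k,\ell)$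 with $3\le k<\ell$, $k\nmid\ell$, $\ell\ge 20k^2$ such that the smallest prime factor of $k/\gcd(k,\ell)$ is $p$ and $\gamma(C^k_\ell)>\frac1p$; there are also infinitely many such pairs with $\gcd(k,\ell)\ne 1$. Moreover, if $k$ and $\ell$ are as above and $i\in\{1,2,3\}$ satisfies $k\equiv i\pmod{6i}$ and $\gcd(k,\ell)=i$, then $p>3$ and $\gamma(C^k_\ell)>\frac1p$. -/

import Mathlib

open Filter Topology

namespace CodegreeTuran

/-- A hypergraph is `k`-uniform if every edge has exactly `k` vertices. -/
def IsUniform {α : Type*} (k : ℕ) (H : Hypergraph α) : Prop :=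
  ∀ e ∈ H.edgeSet, e.encard = k

/-- The codegree of a vertex set `S`: the number of vertices `v` such that `S ∪ {v}` is an edge.
It is used for `(k - 1)`-sets `S` in `k`-uniform hypergraphs, where such a `v` lies outside `S`. -/
noncomputable def codegree {α : Type*} (H : Hypergraph α) (S : Set α) : ℕ :=
  {v | insert v S ∈ H.edgeSet}.ncard

/-- The minimum codegree `δ_{k-1}(H)` of a `k`-uniform hypergraph: the minimum of the codegrees of
all sets of `k - 1` vertices of `H`. (It is `0` if `H` has fewer than `k - 1` vertices.) -/
noncomputable def minCodegree {α : Type*} (k : ℕ) (H : Hypergraph α) : ℕ :=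
  sInf {d | ∃ S : Set α, S ⊆ H.vertexSet ∧ S.encard + 1 = k ∧ codegree H S = d}

/-- `G` contains a (not necessarily induced) copy of `F`: some map that is injective on the
vertices of `F` sends vertices to vertices and edges to edges. -/
def ContainsCopy {α β : Type*} (F : Hypergraph α) (G : Hypergraph β) : Prop :=
  ∃ f : α → β, Set.InjOn f F.vertexSet ∧ Set.MapsTo f F.vertexSet G.vertexSet ∧
    ∀ e ∈ F.edgeSet, f '' e ∈ G.edgeSet

/-- The codegree Turán number `ex_{k-1}(n, F)`: the largest minimum codegree of an `F`-free
`k`-uniform hypergraph on `n` vertices. -/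
noncomputable def codegreeTuranNumber {α : Type*} (k n : ℕ) (F : Hypergraph α) : ℕ :=
  sSup {d | ∃ G : Hypergraph (Fin n), G.vertexSet = Set.univ ∧ IsUniform k G ∧
    ¬ ContainsCopy F G ∧ minCodegree k G = d}

/-- The codegree Turán density `γ(F) = lim ex_{k-1}(n, F) / n`. -/
noncomputable def codegreeTuranDensity {α : Type*} (k : ℕ) (F : Hypergraph α) : ℝ :=
  limUnder atTop (fun n : ℕ => (codegreeTuranNumber k n F : ℝ) / n)

/-- The `k`-uniform tight cycle `C^k_ℓ` (for `k < ℓ`): the vertices are the residues modulo `ℓ`,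
the edges are the `ℓ` cyclic intervals `{i, i + 1, …, i + k - 1}`. -/
def tightCycle (k ℓ : ℕ) : Hypergraph (ZMod ℓ) where
  vertexSet := Set.univ
  edgeSet := {e | ∃ i : ZMod ℓ, e = (fun j : ℕ => i + (j : ZMod ℓ)) '' {j | j < k}}
  subset_vertexSet_of_mem_edgeSet' := fun _ _ => Set.subset_univ _

theorem tightCycle_isUniform {k ℓ : ℕ} (h : k ≤ ℓ) : IsUniform k (tightCycle k ℓ) := by
  rintro e ⟨i, rfl⟩
  rw [Set.InjOn.encard_image]
  · have : {j : ℕ | j < k} = ((Finset.range k : Finset ℕ) : Set ℕ) := by ext; simp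
    rw [this, Set.encard_coe_eq_coe_finsetCard, Finset.card_range]
  · intro a ha b hb hab
    have hab' : (a : ZMod ℓ) = (b : ZMod ℓ) := add_left_cancel hab
    rw [ZMod.natCast_eq_natCast_iff'] at hab'
    rwa [Nat.mod_eq_of_lt (lt_of_lt_of_le ha h), Nat.mod_eq_of_lt (lt_of_lt_of_le hb h)] at hab'

/-- The supremum in the codegree Turán number is that of a bounded set. -/
theorem minCodegree_le_card {n k : ℕ} (G : Hypergraph (Fin n)) : minCodegree k G ≤ n := by
  rcases Set.eq_empty_or_nonempty
    {d | ∃ S : Set (Fin n), S ⊆ G.vertexSet ∧ S.encard + 1 = k ∧ codegree G S = d} with h | h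
  · simp [minCodegree, h]
  · obtain ⟨S, -, -, hS⟩ := Nat.sInf_mem h
    calc minCodegree k G = codegree G S := hS.symm
      _ ≤ (Set.univ : Set (Fin n)).ncard := Set.ncard_le_ncard (Set.subset_univ _)
      _ = n := by simp [Set.ncard_univ]

end CodegreeTuran

/-! Convergence and the upper bounds rest on sampling. A large random tuple of vertices inherits the
codegree density up to `ε` (`card_goodTuples_ge`), so the ratios are almost decreasing and converge.
If codegree density above `θ` forces a closed tight walk of length `ℓ`, then a positive proportion
of `m`-tuples carry the same walk. The box theorem `exists_box` gives a blow-up of this walk, and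
Hall's theorem selects an injective copy of the cycle from it. Hence `γ ≤ θ`
(`codegreeTuranDensity_le`).

To build walks, read a tight walk in blocks of `k`: each block is an ordered edge, and consecutive
blocks differ in at most one coordinate. A walk of length `ℓ` closes if replacements lead from an
ordered edge to its rotation by `ℓ mod k`. Two vertices `a`, `b` of an edge `e` can be swapped in
three replacements if `e - a` and `e - b` have a common neighbour. Above density `1/2` this holds
for all pairs, so every rotation is available.

Above density `1/3`, among any three vertices of an edge some two can be swapped. Either some edge
has all its swaps cheap, or every edge splits into two classes of mutually exchangeable vertices. In
the second case, whether `u`, `v` lie in different classes of `e` depends only on `e - u - v`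
(`mark_eq`). The resulting marking of `(k-2)`-sets is rigid: `k` is even, and a set is marked
exactly when it meets a fixed set `A` in an even number of vertices (`PairColoring.exists_parity`).
If `m = k / gcd(k, ℓ)` is odd, some edge then has a class of size exactly `m`. Placing this class on
the multiples of `gcd(k, ℓ)` makes the class pattern invariant under the required rotation, which is
therefore reachable.

For lower bounds, colour the vertices evenly with `q` colours and let the edges be the `k`-sets
whose colour pattern lies in a chosen family. Every `(k-1)`-pattern must extend within the family.
Each pattern carries a colour as label, and along a tight walk that label and its multiplicity must
not change. Then the positions of the labelled colour are `k`-periodic, hence `gcd(k, ℓ)`-periodic,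
so `k / gcd(k, ℓ)` divides the multiplicity. Excluding this divisibility excludes the cycle
(`one_div_le_of_labelled`).

With `q = p`, fixing a weighted sum of the colours modulo `p` gives `1/p`. With `q = 3` and `gcd(k,
ℓ) ≤ 3`, local modifications of such a family give `1/3` provided `3` does not divide `k / gcd(k,
ℓ)` and the pattern is large enough. This beats `1/p` for `p > 3`. -/

namespace CodegreeTuran

/-! ### Closed tight walks from replacements in ordered edges. -/

section Walks

set_option linter.unusedSectionVars false

variable {V : Type*} [DecidableEq V]

/-- A closed tight walk of length `ℓ` in a family `H` of `k`-sets: a homomorphic image of the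
tight cycle. -/
def IsClosedTightWalk (H : Set (Finset V)) (k ℓ : ℕ) (φ : ZMod ℓ → V) : Prop :=
  ∀ i : ZMod ℓ, (Finset.range k).image (fun j : ℕ => φ (i + (j : ZMod ℓ))) ∈ H

variable {ι : Type*} [Fintype ι] [DecidableEq ι]

/-- One vertex of an ordered edge is replaced so that the result is again an ordered edge. -/
def Step (H : Set (Finset V)) (v w : ι → V) : Prop :=
  ∃ i x, w = Function.update v i x ∧ Finset.univ.image w ∈ H

/-- `Reach H N v w`: the ordered edge `w` arises from `v` by `N` replacements. -/
def Reach (H : Set (Finset V)) : ℕ → (ι → V) → (ι → V) → Prop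
  | 0, v, w => v = w
  | N + 1, v, w => ∃ u, Reach H N v u ∧ Step H u w

theorem Reach.trans {H : Set (Finset V)} {M N : ℕ} {u v w : ι → V} (h : Reach H M u v)
    (h' : Reach H N v w) : Reach H (M + N) u w := by
  induction N generalizing w with
  | zero => cases h'; exact h
  | succ N ih =>
    obtain ⟨x, hx, hs⟩ := h'
    exact ⟨x, ih hx, hs⟩

theorem Step.reach {H : Set (Finset V)} {v w : ι → V} (h : Step H v w) : Reach H 1 v w :=
  ⟨v, rfl, h⟩

theorem Step.refl [Nonempty ι] {H : Set (Finset V)} {v : ι → V} (h : Finset.univ.image v ∈ H) :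
    Step H v v :=
  ⟨Classical.arbitrary ι, v (Classical.arbitrary ι), by simp, h⟩

/-- A replacement may write back the old vertex, so chains can be padded. Lengths therefore act only
as upper bounds on costs. -/
theorem Reach.mono [Nonempty ι] {H : Set (Finset V)} {M N : ℕ} {v w : ι → V}
    (h : Reach H M v w) (hw : Finset.univ.image w ∈ H) (hMN : M ≤ N) : Reach H N v w := by
  induction hMN with
  | refl => exact h
  | step _ ih => exact ⟨w, ih, Step.refl hw⟩

theorem Reach.exists_seq [Nonempty ι] {H : Set (Finset V)} {N : ℕ} {v w : ι → V}
    (h : Reach H N v w) (hw : Finset.univ.image w ∈ H) :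
    ∃ c : ℕ → ι → V, c 0 = v ∧ (∀ q, N ≤ q → c q = w) ∧ ∀ q, Step H (c q) (c (q + 1)) := by
  induction N generalizing w with
  | zero =>
    cases h
    exact ⟨fun _ => v, rfl, fun _ _ => rfl, fun _ => Step.refl hw⟩
  | succ N ih =>
    obtain ⟨u, hu, hs⟩ := h
    by_cases hN : N = 0
    · subst hN
      cases hu
      refine ⟨fun q => if q = 0 then v else w, by simp, fun q hq => by simp; omega, fun q => ?_⟩
      by_cases hq : q = 0
      · simpa [hq] using hs
      · simpa [hq] using Step.refl hw
    · obtain ⟨N, rfl⟩ := Nat.exists_eq_succ_of_ne_zero hN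
      obtain ⟨t, ht, hst⟩ := hu
      have huH : Finset.univ.image u ∈ H := by
        obtain ⟨_, _, _, h⟩ := hst
        exact h
      obtain ⟨c, h0, hc, hcs⟩ := ih ⟨t, ht, hst⟩ huH
      refine ⟨fun q => if q ≤ N + 1 then c q else w, by simpa using h0, fun q hq => ?_,
        fun q => ?_⟩
      · have : ¬ q ≤ N + 1 := by omega
        simp [this]
      · rcases lt_trichotomy q (N + 1) with hq | hq | hq
        · have h1 : q ≤ N + 1 := hq.le
          have h2 : q + 1 ≤ N + 1 := hq
          simp only [h1, h2, if_true]
          exact hcs q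
        · subst hq
          simp only [le_refl, if_true]
          rw [if_neg (by omega), hc _ le_rfl]
          exact hs
        · have h1 : ¬ q ≤ N + 1 := by omega
          have h2 : ¬ q + 1 ≤ N + 1 := by omega
          simp only [h1, h2, if_false]
          exact Step.refl hw

/-- The vertices `a` and `b` of the edge `e` can be exchanged in every ordering of `e` by `c`
replacements. -/
def SwapWithin (ι : Type*) [Fintype ι] [DecidableEq ι] (H : Set (Finset V)) (c : ℕ)
    (e : Finset V) (a b : V) : Prop :=
  ∀ v : ι → V, Finset.univ.image v = e → ∀ i j, v i = a → v j = b →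
    Reach H c v (v ∘ Equiv.swap i j)

theorem image_comp_equiv (v : ι → V) (π : Equiv.Perm ι) :
    Finset.univ.image (v ∘ π) = Finset.univ.image v := by
  ext x
  simp only [Finset.mem_image, Finset.mem_univ, true_and, Function.comp]
  exact ⟨fun ⟨a, h⟩ => ⟨π a, h⟩, fun ⟨a, h⟩ => ⟨π.symm a, by simpa using h⟩⟩

theorem SwapWithin.symm {H : Set (Finset V)} {c : ℕ} {e : Finset V} {a b : V}
    (h : SwapWithin ι H c e a b) : SwapWithin ι H c e b a := fun v hv i j hi hj => by
  rw [Equiv.swap_comm]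
  exact h v hv j i hj hi

theorem SwapWithin.mono [Nonempty ι] {H : Set (Finset V)} {c c' : ℕ} {e : Finset V} {a b : V}
    (h : SwapWithin ι H c e a b) (he : e ∈ H) (hc : c ≤ c') : SwapWithin ι H c' e a b :=
  fun v hv i j hi hj => (h v hv i j hi hj).mono (by rw [image_comp_equiv, hv]; exact he) hc

theorem SwapWithin.refl [Nonempty ι] {H : Set (Finset V)} {c : ℕ} {e : Finset V} (a : V)
    (he : e ∈ H) (hcard : e.card = Fintype.card ι) : SwapWithin ι H c e a a := by
  intro v hv i j hi hj
  have hinj : Function.Injective v := by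
    rw [← Finset.card_univ, ← hv] at hcard
    exact Set.injOn_univ.1 (by simpa using Finset.card_image_iff.1 hcard)
  have : i = j := hinj (hi.trans hj.symm)
  subst this
  have h0 : Reach H 0 v v := rfl
  simpa using h0.mono (hv ▸ he) (Nat.zero_le c)

theorem injective_of_image_eq {v : ι → V} {e : Finset V} (hv : Finset.univ.image v = e)
    (hcard : e.card = Fintype.card ι) : Function.Injective v := by
  rw [← Finset.card_univ, ← hv] at hcard
  exact Set.injOn_univ.1 (by simpa using Finset.card_image_iff.1 hcard)

/-- Conjugation of transpositions, `(a c) = (a b)(b c)(a b)`. The cheaper swap should be the one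
used twice. -/
theorem SwapWithin.conj [Nonempty ι] {H : Set (Finset V)} {c₁ c₂ : ℕ} {e : Finset V} {a b c : V}
    (he : e ∈ H) (hcard : e.card = Fintype.card ι) (hb : b ∈ e) (hab : SwapWithin ι H c₁ e a b)
    (hbc : SwapWithin ι H c₂ e b c) : SwapWithin ι H (c₁ + c₂ + c₁) e a c := by
  by_cases h1 : a = b
  · subst h1
    exact hbc.mono he (by omega)
  by_cases h2 : b = c
  · subst h2
    exact hab.mono he (by omega)
  by_cases h3 : a = c
  · subst h3
    exact SwapWithin.refl a he hcard
  intro v hv i l hi hl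
  have hinj := injective_of_image_eq hv hcard
  obtain ⟨j, -, hj⟩ : ∃ j ∈ Finset.univ, v j = b := by
    rw [← hv] at hb
    simpa using hb
  have hij : i ≠ j := fun h => h1 (by rw [← hi, ← hj, h])
  have hjl : j ≠ l := fun h => h2 (by rw [← hj, ← hl, h])
  have hil : i ≠ l := fun h => h3 (by rw [← hi, ← hl, h])
  have r1 := hab v hv i j hi hj
  have r2 := hbc (v ∘ Equiv.swap i j) (by rw [image_comp_equiv, hv]) i l (by simp [hj])
    (by simp [Equiv.swap_apply_of_ne_of_ne hil.symm hjl.symm, hl])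
  have r3 := hab ((v ∘ Equiv.swap i j) ∘ Equiv.swap i l)
    (by rw [image_comp_equiv, image_comp_equiv, hv]) j l
    (by simp [Equiv.swap_apply_of_ne_of_ne hij.symm hjl, hi]) (by simp [hj])
  have := (r1.trans r2).trans r3
  convert this using 1
  funext x
  simp only [Function.comp]
  congr 1
  by_cases hxi : x = i
  · subst hxi
    simp [Equiv.swap_apply_of_ne_of_ne hij hil, Equiv.swap_apply_of_ne_of_ne hil.symm hjl.symm]
  by_cases hxj : x = j
  · subst hxj
    simp [Equiv.swap_apply_of_ne_of_ne hij.symm hjl]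
  by_cases hxl : x = l
  · subst hxl
    simp [Equiv.swap_apply_of_ne_of_ne hij.symm hjl]
  simp [Equiv.swap_apply_of_ne_of_ne, hxi, hxj, hxl]

/-- The edges obtained from `e` by deleting `a`, respectively `b`, and adding a common vertex. -/
def Exchangeable (H : Set (Finset V)) (e : Finset V) (a b : V) : Prop :=
  ∃ c, insert c (e.erase a) ∈ H ∧ insert c (e.erase b) ∈ H

theorem Exchangeable.symm {H : Set (Finset V)} {e : Finset V} {a b : V}
    (h : Exchangeable H e a b) : Exchangeable H e b a :=
  let ⟨c, h1, h2⟩ := h; ⟨c, h2, h1⟩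

theorem image_update {v : ι → V} (hinj : Function.Injective v) (i : ι) (x : V) :
    Finset.univ.image (Function.update v i x) = insert x ((Finset.univ.image v).erase (v i)) := by
  ext y
  simp only [Finset.mem_image, Finset.mem_univ, true_and, Finset.mem_insert, Finset.mem_erase]
  constructor
  · rintro ⟨j, rfl⟩
    by_cases hj : j = i
    · subst hj; simp
    · right
      rw [Function.update_of_ne hj]
      exact ⟨fun h => hj (hinj h), j, rfl⟩
  · rintro (rfl | ⟨h, j, rfl⟩)
    · exact ⟨i, by simp⟩
    · refine ⟨j, ?_⟩
      rw [Function.update_of_ne]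
      rintro rfl
      exact h rfl

/-- The common vertex `c` serves as temporary storage: write `c` over `a`, then `a` over `b`, then
`b` over `c`. -/
theorem Exchangeable.swapWithin {H : Set (Finset V)} {e : Finset V} {a b : V}
    (hU : ∀ e ∈ H, e.card = Fintype.card ι) (he : e ∈ H) (hab : a ≠ b)
    (h : Exchangeable H e a b) : SwapWithin ι H 3 e a b := by
  obtain ⟨c, h1, h2⟩ := h
  intro v hv i j hi hj
  have hinj := injective_of_image_eq hv (hU e he)
  have hij : i ≠ j := fun h => hab (by rw [← hi, ← hj, h])
  have e1 : Finset.univ.image (Function.update v i c) = insert c (e.erase a) := by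
    rw [image_update hinj, hv, hi]
  have hinj1 := injective_of_image_eq e1 (hU _ h1)
  have ha : a ∈ e := by rw [← hv, ← hi]; simp
  have hb : b ∈ e := by rw [← hv, ← hj]; simp
  have hca : c ≠ a := by
    rintro rfl
    have := hU _ h2
    rw [Finset.insert_eq_of_mem (Finset.mem_erase.2 ⟨hab, ha⟩), Finset.card_erase_of_mem hb,
      hU e he] at this
    have : 0 < Fintype.card ι := Fintype.card_pos_iff.2 ⟨i⟩
    omega
  have hcb : c ≠ b := by
    rintro rfl
    have := hU _ h1
    rw [Finset.insert_eq_of_mem (Finset.mem_erase.2 ⟨hab.symm, hb⟩), Finset.card_erase_of_mem ha,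
      hU e he] at this
    have : 0 < Fintype.card ι := Fintype.card_pos_iff.2 ⟨i⟩
    omega
  have e2 : Finset.univ.image (Function.update (Function.update v i c) j a)
      = insert c (e.erase b) := by
    rw [image_update hinj1, e1, Function.update_of_ne hij.symm, hj]
    ext y
    simp only [Finset.mem_insert, Finset.mem_erase]
    by_cases hya : y = a
    · subst hya; simp [hab, ha]
    · by_cases hyc : y = c
      · subst hyc; simp [hcb]
      · simp [hya, hyc]
  have e3 : Function.update (Function.update (Function.update v i c) j a) i b
      = v ∘ Equiv.swap i j := by
    funext x
    by_cases hxi : x = i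
    · subst hxi; simp [hj]
    · by_cases hxj : x = j
      · subst hxj; simp [hi, hxi]
      · simp [hxi, hxj, Equiv.swap_apply_of_ne_of_ne]
  refine ⟨Function.update (Function.update v i c) j a, ⟨Function.update v i c, ⟨v, rfl, i, c, rfl,
    by rw [e1]; exact h1⟩, j, a, rfl, by rw [e2]; exact h2⟩, i, b, e3.symm, ?_⟩
  rw [image_comp_equiv, hv]
  exact he

/-- Replace `x` by `x'`, swap `r` with `x'`, and replace `x'` by `x` in its new position. The two
outer moves account for the `+ 2`. -/
theorem SwapWithin.transport {H : Set (Finset V)} {c : ℕ} {S : Finset V} {x x' r : V}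
    (hU : ∀ e ∈ H, e.card = Fintype.card ι) (hx : x ∉ S) (hr : r ∈ S)
    (he : insert x S ∈ H) (he' : insert x' S ∈ H)
    (h : SwapWithin ι H c (insert x' S) r x') : SwapWithin ι H (c + 2) (insert x S) r x := by
  intro v hv i j hi hj
  have hinj := injective_of_image_eq hv (hU _ he)
  have hij : i ≠ j := fun h => hx (by rw [← hj, ← h, hi]; exact hr)
  have e1 : Finset.univ.image (Function.update v j x') = insert x' S := by
    rw [image_update hinj, hv, hj, Finset.erase_insert hx]
  have r2 := h _ e1 i j (by rw [Function.update_of_ne hij, hi]) (by simp)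
  have r1 : Reach H 1 v (Function.update v j x') := Step.reach ⟨j, x', rfl, by rw [e1]; exact he'⟩
  have r3 : Step H (Function.update v j x' ∘ Equiv.swap i j) (v ∘ Equiv.swap i j) := by
    refine ⟨i, x, ?_, by rw [image_comp_equiv, hv]; exact he⟩
    funext y
    by_cases hyi : y = i
    · subst hyi; simp [hj]
    · by_cases hyj : y = j
      · subst hyj; simp [hyi, hij]
      · simp [hyi, hyj, Equiv.swap_apply_of_ne_of_ne]
  have := (r1.trans r2).trans r3.reach
  rwa [show 1 + c + 1 = c + 2 by ring] at this

/-- A label-preserving permutation is a product of label-preserving transpositions. Splitting off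
`swap j (π j)` for a moved `j` shrinks the support, so at most as many swaps as indices are needed.
-/
theorem reach_comp_perm {H : Set (Finset V)} [Nonempty ι] {c : ℕ} {e : Finset V} (he : e ∈ H)
    {α : Type*} (χ : V → α)
    (hsw : ∀ a ∈ e, ∀ b ∈ e, χ a = χ b → SwapWithin ι H c e a b) (π : Equiv.Perm ι) (v : ι → V)
    (hv : Finset.univ.image v = e) (hπ : ∀ j, χ (v (π j)) = χ (v j)) :
    Reach H (c * Fintype.card ι) v (v ∘ π) := by
  have hmem : ∀ (v : ι → V), Finset.univ.image v = e → ∀ j, v j ∈ e := by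
    intro v hv j; rw [← hv]; simp
  suffices h : ∀ n, ∀ (π : Equiv.Perm ι) (v : ι → V), π.support.card = n →
      Finset.univ.image v = e → (∀ j, χ (v (π j)) = χ (v j)) → Reach H (c * n) v (v ∘ π) by
    refine (h _ π v rfl hv hπ).mono (by rw [image_comp_equiv, hv]; exact he) ?_
    exact Nat.mul_le_mul_left _ (Finset.card_le_univ _)
  intro n
  induction n using Nat.strong_induction_on with
  | _ n ih =>
    intro π v hn hv hπ
    by_cases h1 : ∀ j, π j = j
    · have : π = 1 := Equiv.ext h1
      subst this
      simp at hn
      subst hn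
      rfl
    · push Not at h1
      obtain ⟨j, hj⟩ := h1
      have hlt := Equiv.Perm.card_support_swap_mul hj
      set π' := Equiv.swap j (π j) * π with hπ'
      have hdecomp : π = Equiv.swap j (π j) * π' := by
        rw [hπ', ← mul_assoc, Equiv.swap_mul_self, one_mul]
      have r1 := hsw _ (hmem v hv j) _ (hmem v hv (π j)) (hπ j).symm v hv j (π j) rfl rfl
      have hsame : ∀ i, χ (v (Equiv.swap j (π j) i)) = χ (v i) := by
        intro i
        by_cases hi : i = j
        · subst hi; simpa using hπ i
        · by_cases hi' : i = π j
          · subst hi'; simpa using (hπ j).symm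
          · rw [Equiv.swap_apply_of_ne_of_ne hi hi']
      have r2 := ih _ (hn ▸ hlt) π' (v ∘ Equiv.swap j (π j)) rfl (by rw [image_comp_equiv, hv])
        (by
          intro i
          have : Equiv.swap j (π j) (π' i) = π i := by
            conv_rhs => rw [hdecomp]
            rfl
          simp only [Function.comp]
          rw [this, hsame, hπ])
      have r := r1.trans r2
      have hcomp : (v ∘ Equiv.swap j (π j)) ∘ π' = v ∘ π := by
        conv_rhs => rw [hdecomp]
        rfl
      rw [hcomp] at r
      refine r.mono (by rw [image_comp_equiv, hv]; exact he) ?_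
      calc c + c * π'.support.card = c * (π'.support.card + 1) := by ring
        _ ≤ c * n := Nat.mul_le_mul_left _ (by omega)

/-- A chain of `N` replacements from `v` to a rotation of `v` by `s` gives a closed tight walk of
length `N * k + s`. -/
theorem exists_closedTightWalk {H : Set (Finset V)} {k N s : ℕ} [NeZero k] {v w : ZMod k → V}
    (hv : Finset.univ.image v ∈ H)
    (h : Reach H N v w) (hw : ∀ j : ZMod k, w (j + s) = v j) (hk : k ≤ N * k + s) :
    ∃ φ : ZMod (N * k + s) → V, IsClosedTightWalk H k (N * k + s) φ := by
  have hk0 : 0 < k := Nat.pos_of_ne_zero (NeZero.ne k)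
  set ℓ := N * k + s with hℓ
  have : NeZero ℓ := ⟨by omega⟩
  have hwH : Finset.univ.image w ∈ H := by
    have : v = w ∘ Equiv.addRight (s : ZMod k) := by
      funext j; simp [hw]
    rwa [this, image_comp_equiv] at hv
  obtain ⟨c, h0, hN, hc⟩ := h.exists_seq hwH
  let W : ℕ → V := fun t => c (t / k) (t : ZMod k)
  have hwin : ∀ τ, (Finset.range k).image (fun j => W (τ + j)) ∈ H := by
    intro τ
    obtain ⟨q, r, hr, rfl⟩ : ∃ q r, r < k ∧ τ = k * q + r :=
      ⟨τ / k, τ % k, Nat.mod_lt _ hk0, (Nat.div_add_mod τ k).symm⟩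
    -- Indexed by residues modulo `k`, the window starting at `k * q + r` has already passed to
    -- block `q + 1` in the first `r` coordinates.
    let u : ZMod k → V := fun a => if a.val < r then c (q + 1) a else c q a
    have hu : (Finset.range k).image (fun j => W (k * q + r + j)) = Finset.univ.image u := by
      have key : ∀ j, j < k → W (k * q + r + j) = u ((k * q + r + j : ℕ) : ZMod k) := by
        intro j hj
        simp only [W, u, ZMod.val_natCast]
        by_cases hrj : r + j < k
        · have h1 : (k * q + r + j) / k = q := by
            rw [add_assoc, Nat.mul_add_div hk0, Nat.div_eq_of_lt hrj, add_zero]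
          have h2 : (k * q + r + j) % k = r + j := by
            rw [add_assoc, Nat.mul_add_mod, Nat.mod_eq_of_lt hrj]
          rw [h1, h2, if_neg (by omega)]
        · have h0 : k * q + r + j = k * (q + 1) + (r + j - k) := by
            rw [mul_add, mul_one]; omega
          have h1 : (k * q + r + j) / k = q + 1 := by
            rw [h0, Nat.mul_add_div hk0, Nat.div_eq_of_lt (by omega), add_zero]
          have h2 : (k * q + r + j) % k = r + j - k := by
            rw [h0, Nat.mul_add_mod, Nat.mod_eq_of_lt (by omega)]
          rw [h1, h2, if_pos (by omega)]
      ext y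
      simp only [Finset.mem_image, Finset.mem_range, Finset.mem_univ, true_and]
      constructor
      · rintro ⟨j, hj, rfl⟩
        exact ⟨_, (key j hj).symm⟩
      · rintro ⟨a, rfl⟩
        have ha : a.val < k := ZMod.val_lt a
        by_cases har : a.val < r
        · refine ⟨a.val + k - r, by omega, ?_⟩
          rw [key _ (by omega)]
          congr 1
          have : k * q + r + (a.val + k - r) = k * (q + 1) + a.val := by
            rw [mul_add, mul_one]; omega
          rw [this]
          simp
        · refine ⟨a.val - r, by omega, ?_⟩
          rw [key _ (by omega)]
          congr 1
          have : k * q + r + (a.val - r) = k * q + a.val := by omega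
          rw [this]
          simp
    rw [hu]
    have hcH : ∀ q, Finset.univ.image (c q) ∈ H := by
      intro q
      cases q with
      | zero => rw [h0]; exact hv
      | succ q => obtain ⟨_, _, _, h⟩ := hc q; exact h
    -- Blocks `q` and `q + 1` differ at most in coordinate `i`, so the mixture `u` is one of the two
    -- blocks.
    obtain ⟨i, x, hix, -⟩ := hc q
    by_cases hi : i.val < r
    · have : u = c (q + 1) := by
        funext a
        simp only [u]
        split_ifs with ha
        · rfl
        · rw [hix, Function.update_of_ne]
          rintro rfl
          exact ha hi
      rw [this]; exact hcH _
    · have : u = c q := by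
        funext a
        simp only [u]
        split_ifs with ha
        · rw [hix, Function.update_of_ne]
          rintro rfl
          exact hi ha
        · rfl
      rw [this]; exact hcH _
  -- The chain rests at `w` from block `N` on. Since `ℓ ≡ s` modulo `k`, the rotation undone by `hw`
  -- makes the sequence close up.
  have hper : ∀ j, j < k → W (ℓ + j) = W j := by
    intro j hj
    simp only [W]
    rw [hN _ (by rw [Nat.le_div_iff_mul_le hk0]; omega), Nat.div_eq_of_lt hj, h0, ← hw]
    congr 1
    rw [hℓ]
    push_cast
    simp [add_comm]
  refine ⟨fun z => W z.val, fun i => ?_⟩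
  have : (Finset.range k).image (fun j : ℕ => W (i + (j : ZMod ℓ)).val)
      = (Finset.range k).image (fun j => W (i.val + j)) := by
    refine Finset.image_congr fun j hj => ?_
    have hj : j < k := by simpa using hj
    have hi : i.val < ℓ := ZMod.val_lt i
    have hval : (i + (j : ZMod ℓ)).val = (i.val + j) % ℓ := by
      rw [ZMod.val_add, ZMod.val_natCast, Nat.add_mod_mod]
    show W (i + (j : ZMod ℓ)).val = W (i.val + j)
    rw [hval]
    by_cases hlt : i.val + j < ℓ
    · rw [Nat.mod_eq_of_lt hlt]
    · obtain ⟨t, ht⟩ : ∃ t, i.val + j = ℓ + t := ⟨i.val + j - ℓ, by omega⟩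
      rw [ht, Nat.add_mod_left, Nat.mod_eq_of_lt (by omega), hper t (by omega)]
  rw [this]
  exact hwin _

/-- If any two vertices of `e` with the same label can be exchanged within `c ≤ ℓ / k`
replacements each, and one label set, or its complement, has the right size, then there is a closed
tight walk. -/
theorem exists_closedTightWalk_of_swapWithin {H : Set (Finset V)} {k ℓ c : ℕ} [NeZero k]
    {e : Finset V} (he : e ∈ H) (hcard : e.card = k) (χ : V → Prop) [DecidablePred χ]
    (hsw : ∀ a ∈ e, ∀ b ∈ e, (χ a ↔ χ b) → SwapWithin (ZMod k) H c e a b)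
    (hχ : (e.filter χ).card = k / Nat.gcd k ℓ ∨ ∀ a ∈ e, χ a)
    (hℓ : c * k * k ≤ ℓ) (hc : 0 < c) :
    ∃ φ : ZMod ℓ → V, IsClosedTightWalk H k ℓ φ := by
  have hk0 : 0 < k := Nat.pos_of_ne_zero (NeZero.ne k)
  set d := Nat.gcd k ℓ with hd
  have hdk : d ∣ k := Nat.gcd_dvd_left _ _
  have hdℓ : d ∣ ℓ := Nat.gcd_dvd_right _ _
  have hd0 : 0 < d := Nat.gcd_pos_of_pos_left _ hk0
  obtain ⟨m, hm⟩ := hdk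
  have hkd : k / d = m := by rw [hm, Nat.mul_div_cancel_left _ hd0]
  obtain ⟨v, hv, hvχ⟩ : ∃ v : ZMod k → V, Finset.univ.image v = e ∧
      ∀ j, (χ (v (j + ((ℓ % k : ℕ) : ZMod k))) ↔ χ (v j)) := by
    have hcardZ : Fintype.card (ZMod k) = k := ZMod.card k
    rcases hχ with hχ | hχ
    -- Put the label class on the multiples of `d`: there are `k / d` of them, and this pattern is
    -- invariant under rotation by `ℓ` because `d` divides `k` and `ℓ`.
    · let P : ZMod k → Prop := fun j => j.val % d = 0
      have hlt : ∀ t, t < m → d * t < k := fun t ht =>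
        hm ▸ Nat.mul_lt_mul_of_pos_left ht hd0
      have hP : (Finset.univ.filter P).card = m := by
        have : (Finset.univ.filter P) = (Finset.range m).image (fun t => ((d * t : ℕ) : ZMod k)) := by
          ext j
          simp only [Finset.mem_filter, Finset.mem_univ, true_and, Finset.mem_image,
            Finset.mem_range, P]
          constructor
          · intro hj
            obtain ⟨t, ht⟩ := Nat.dvd_of_mod_eq_zero hj
            refine ⟨t, ?_, by rw [← ht]; simp⟩
            have := ZMod.val_lt j
            rw [ht, hm] at this
            exact Nat.lt_of_mul_lt_mul_left this
          · rintro ⟨t, ht, rfl⟩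
            rw [ZMod.val_natCast, Nat.mod_eq_of_lt (hlt t ht), Nat.mul_mod_right]
        rw [this, Finset.card_image_of_injOn, Finset.card_range]
        intro a ha b hb hab
        have ha : a < m := by simpa using ha
        have hb : b < m := by simpa using hb
        have h := (ZMod.natCast_eq_natCast_iff' _ _ _).1 hab
        rw [Nat.mod_eq_of_lt (hlt a ha), Nat.mod_eq_of_lt (hlt b hb)] at h
        exact Nat.eq_of_mul_eq_mul_left hd0 h
      have h1 : Fintype.card {j // P j} = Fintype.card {a : e // χ a} := by
        rw [Fintype.card_subtype, hP, Fintype.card_subtype, ← hkd, ← hχ, ← Finset.card_map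
          (Function.Embedding.subtype (· ∈ e))]
        congr 1
        ext a
        simp
        tauto
      have h2 : Fintype.card {j // ¬ P j} = Fintype.card {a : e // ¬ χ a} := by
        rw [Fintype.card_subtype_compl, Fintype.card_subtype_compl, h1, hcardZ, Fintype.card_coe,
          hcard]
      obtain ⟨E, hE⟩ : ∃ E : ZMod k ≃ e, ∀ j, P j ↔ χ (E j) := by
        refine ⟨((Equiv.sumCompl P).symm.trans
          ((Fintype.equivOfCardEq h1).sumCongr (Fintype.equivOfCardEq h2))).trans
          (Equiv.sumCompl fun a : e => χ a), fun j => ?_⟩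
        by_cases hj : P j
        · simp only [Equiv.trans_apply, Equiv.sumCompl_symm_apply_of_pos hj, hj, true_iff]
          exact (Fintype.equivOfCardEq h1 ⟨j, hj⟩).2
        · simp only [Equiv.trans_apply, Equiv.sumCompl_symm_apply_of_neg hj, hj, false_iff]
          exact (Fintype.equivOfCardEq h2 ⟨j, hj⟩).2
      refine ⟨fun j => E j, ?_, fun j => ?_⟩
      · ext a
        simp only [Finset.mem_image, Finset.mem_univ, true_and]
        constructor
        · rintro ⟨j, rfl⟩; exact (E j).2
        · intro ha; exact ⟨E.symm ⟨a, ha⟩, by simp⟩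
      · rw [← hE, ← hE]
        simp only [P, ZMod.val_add, ZMod.val_natCast]
        have hds : d ∣ ℓ % k % k := by
          rw [Nat.mod_mod]
          exact (Nat.dvd_mod_iff (hm ▸ Nat.dvd_mul_right d m)).2 hdℓ
        rw [Nat.mod_mod_of_dvd _ (hm ▸ Nat.dvd_mul_right d m), Nat.add_mod,
          Nat.mod_eq_zero_of_dvd hds, add_zero, Nat.mod_mod]
    · have h1 : Fintype.card (ZMod k) = Fintype.card e := by rw [hcardZ, Fintype.card_coe, hcard]
      let E := Fintype.equivOfCardEq h1
      refine ⟨fun j => E j, ?_, fun j => ?_⟩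
      · ext a
        simp only [Finset.mem_image, Finset.mem_univ, true_and]
        constructor
        · rintro ⟨j, rfl⟩; exact (E j).2
        · intro ha; exact ⟨E.symm ⟨a, ha⟩, by simp⟩
      · simp [hχ _ (E _).2]
  have hr := reach_comp_perm he χ (fun a ha b hb hab => hsw a ha b hb (by rw [hab]))
    (Equiv.addRight (-((ℓ % k : ℕ) : ZMod k))) v hv (fun j => by
      have := hvχ (j + -((ℓ % k : ℕ) : ZMod k))
      rw [neg_add_cancel_right] at this
      exact propext this.symm)
  rw [ZMod.card] at hr
  have hr' := hr.mono (N := ℓ / k) (by rw [image_comp_equiv, hv]; exact he)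
    ((Nat.le_div_iff_mul_le hk0).2 hℓ)
  have hk : ℓ / k * k + ℓ % k = ℓ := by rw [mul_comm]; exact Nat.div_add_mod ℓ k
  have := exists_closedTightWalk (s := ℓ % k) (hv ▸ he) hr' (fun j => by simp)
    (by rw [hk]; nlinarith [Nat.mul_le_mul hc hk0, Nat.mul_le_mul_right k (Nat.mul_le_mul hc hk0)])
  rwa [hk] at this

end Walks

/-! ### Rigidity of markings of `(k-2)`-sets: parity along a fixed vertex set. -/

section PairColoring

set_option linter.unusedSectionVars false

variable {V : Type*} [Fintype V] [DecidableEq V]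

open Classical in
/-- The vertices that extend `S` to an edge. -/
noncomputable def nbr (H : Set (Finset V)) (S : Finset V) : Finset V :=
  Finset.univ.filter fun v => insert v S ∈ H

theorem mem_nbr {H : Set (Finset V)} {S : Finset V} {v : V} : v ∈ nbr H S ↔ insert v S ∈ H := by
  simp [nbr]

theorem notMem_of_mem_nbr {H : Set (Finset V)} {k : ℕ} (hU : ∀ e ∈ H, e.card = k)
    {S : Finset V} (hS : S.card + 1 = k) {v : V} (hv : v ∈ nbr H S) : v ∉ S := by
  intro h
  have := hU _ (mem_nbr.1 hv)
  rw [Finset.insert_eq_of_mem h] at this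
  omega

theorem not_three_large_disjoint {X Y Z : Finset V} (hX : Fintype.card V < 3 * X.card)
    (hY : Fintype.card V < 3 * Y.card) (hZ : Fintype.card V < 3 * Z.card)
    (hXY : ∀ a, a ∈ X → a ∉ Y) (hXZ : ∀ a, a ∈ X → a ∉ Z) (hYZ : ∀ a, a ∈ Y → a ∉ Z) : False := by
  have h1 : Disjoint X Y := Finset.disjoint_left.2 fun a => hXY a
  have h2 : Disjoint (X ∪ Y) Z := Finset.disjoint_left.2 fun a ha => by
    rcases Finset.mem_union.1 ha with h | h
    exacts [hXZ a h, hYZ a h]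
  have := Finset.card_le_univ (X ∪ Y ∪ Z)
  rw [Finset.card_union_of_disjoint h2, Finset.card_union_of_disjoint h1] at this
  omega

/-- A `k`-graph with codegrees above one third of the order, in which every edge `e` splits into
two classes, the sets `e \ {u, v}` being marked by `f` exactly when `u`, `v` lie in different
classes. -/
structure PairColoring (H : Set (Finset V)) (k : ℕ) (f : Finset V → Bool) : Prop where
  three_le : 3 ≤ k
  card_eq : ∀ e ∈ H, e.card = k
  large : 6 * k ≤ Fintype.card V
  deg : ∀ S : Finset V, S.card + 1 = k → Fintype.card V < 3 * (nbr H S).card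
  split : ∀ e ∈ H, ∃ χ : V → Bool, (∀ u ∈ e, ∀ v ∈ e, u ≠ v →
    f ((e.erase u).erase v) = xor (χ u) (χ v)) ∧ ∃ u ∈ e, ∃ v ∈ e, χ u ≠ χ v

namespace PairColoring

variable {H : Set (Finset V)} {k : ℕ} {f : Finset V → Bool}

/-- In the edge `T + x + z` the marks of the three pairs among `r`, `x`, `z` add up to zero modulo
2. So for marked `T`, passing from `x` to a neighbour `z` flips the whole vector `r ↦ f (insert x
(T.erase r))`. -/
theorem shift (h : PairColoring H k f) {T : Finset V} (hT : T.card + 2 = k) {x z : V} (hx : x ∉ T)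
    (hz : z ∈ nbr H (insert x T)) :
    z ∉ T ∧ z ≠ x ∧ ∀ r ∈ T, f (insert z (T.erase r)) = xor (f (insert x (T.erase r))) (f T) := by
  have hc : (insert x T).card + 1 = k := by rw [Finset.card_insert_of_notMem hx]; omega
  have hz' := notMem_of_mem_nbr h.card_eq hc hz
  simp only [Finset.mem_insert, not_or] at hz'
  refine ⟨hz'.2, hz'.1, fun r hr => ?_⟩
  obtain ⟨χ, hχ, -⟩ := h.split _ (mem_nbr.1 hz)
  have hrx : r ≠ x := fun e => hx (e ▸ hr)
  have hrz : r ≠ z := fun e => hz'.2 (e ▸ hr)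
  have h1 := hχ r (by simp [hr]) z (by simp) hrz
  have h2 := hχ r (by simp [hr]) x (by simp) hrx
  have h3 := hχ x (by simp) z (by simp) (Ne.symm hz'.1)
  have e1 : ((insert z (insert x T)).erase r).erase z = insert x (T.erase r) := by
    ext a; simp only [Finset.mem_erase, Finset.mem_insert]; grind
  have e2 : ((insert z (insert x T)).erase r).erase x = insert z (T.erase r) := by
    ext a; simp only [Finset.mem_erase, Finset.mem_insert]; grind
  have e3 : ((insert z (insert x T)).erase x).erase z = T := by
    ext a; simp only [Finset.mem_erase, Finset.mem_insert]; grind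
  rw [e1] at h1
  rw [e2] at h2
  rw [e3] at h3
  rw [h1, h2, h3]
  cases χ r <;> cases χ x <;> cases χ z <;> rfl

theorem deg_insert (h : PairColoring H k f) {T : Finset V} (hT : T.card + 2 = k) {x : V}
    (hx : x ∉ T) : Fintype.card V < 3 * (nbr H (insert x T)).card :=
  h.deg _ (by rw [Finset.card_insert_of_notMem hx]; omega)

theorem exists_nbr (h : PairColoring H k f) {T : Finset V} (hT : T.card + 2 = k) {x : V}
    (hx : x ∉ T) : ∃ z, z ∈ nbr H (insert x T) := by
  have := h.deg_insert hT hx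
  exact Finset.card_pos.1 (by omega)

/-- Let `z` extend `T + x` to an edge. By `shift`, neighbours of `T + x`, `T + z` and `T + y` have
the vector of `x` flipped, the vector of `x`, and the vector of `y` flipped. If the vectors of `x`
and `y` are neither equal nor complementary, these three neighbourhoods are disjoint, each larger
than a third of the vertices. -/
theorem of_marked (h : PairColoring H k f) {T : Finset V} (hT : T.card + 2 = k)
    (hf : f T = true) {x y : V} (hx : x ∉ T) (hy : y ∉ T) :
    (∀ r ∈ T, f (insert x (T.erase r)) = f (insert y (T.erase r))) ∨
    (∀ r ∈ T, f (insert x (T.erase r)) = !f (insert y (T.erase r))) := by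
  by_contra hcon
  push Not at hcon
  obtain ⟨⟨r₁, hr₁, h1⟩, r₂, hr₂, h2⟩ := hcon
  obtain ⟨z, hz⟩ := h.exists_nbr hT hx
  obtain ⟨hzT, -, hzs⟩ := h.shift hT hx hz
  refine not_three_large_disjoint (h.deg_insert hT hx) (h.deg_insert hT hzT)
    (h.deg_insert hT hy) ?_ ?_ ?_
  · intro a ha hb
    have e1 := (h.shift hT hx ha).2.2 r₁ hr₁
    have e2 := (h.shift hT hzT hb).2.2 r₁ hr₁
    have e3 := hzs r₁ hr₁
    simp [hf] at e1 e2 e3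
    simp [e1, e3] at e2
  · intro a ha hb
    have e1 := (h.shift hT hx ha).2.2 r₁ hr₁
    have e2 := (h.shift hT hy hb).2.2 r₁ hr₁
    simp [hf] at e1 e2
    simp [e1] at e2
    exact h1 e2
  · intro a ha hb
    have e1 := (h.shift hT hzT ha).2.2 r₂ hr₂
    have e2 := (h.shift hT hy hb).2.2 r₂ hr₂
    have e3 := hzs r₂ hr₂
    simp [hf] at e1 e2 e3
    simp [e1, e3] at e2
    exact h2 e2

/-- Extend `S` to an edge by `z`. As both classes of that edge are nonempty, some `r ∈ S` lies in
the class opposite to `z`. -/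
theorem exists_marked (h : PairColoring H k f) {S : Finset V} (hS : S.card + 1 = k) :
    ∃ r ∈ S, f (S.erase r) = true := by
  have hd := h.deg S hS
  obtain ⟨z, hz⟩ : (nbr H S).Nonempty := Finset.card_pos.1 (by omega)
  have hzS := notMem_of_mem_nbr h.card_eq hS hz
  obtain ⟨χ, hχ, u, hu, v, hv, huv⟩ := h.split _ (mem_nbr.1 hz)
  obtain ⟨r, hr, hrz⟩ : ∃ r ∈ S, χ r ≠ χ z := by
    by_contra hcon
    push Not at hcon
    have hall : ∀ a ∈ insert z S, χ a = χ z := by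
      intro a ha
      rcases Finset.mem_insert.1 ha with rfl | ha
      exacts [rfl, hcon a ha]
    exact huv ((hall u hu).trans (hall v hv).symm)
  refine ⟨r, hr, ?_⟩
  have hne : r ≠ z := fun e => hzS (e ▸ hr)
  have := hχ r (by simp [hr]) z (by simp) hne
  have e1 : ((insert z S).erase r).erase z = S.erase r := by
    ext a; simp only [Finset.mem_erase, Finset.mem_insert]; grind
  rw [e1] at this
  rw [this]
  revert hrz
  cases χ r <;> cases χ z <;> simp

/-- Exchanging one element of `T` keeps the mark exactly if the two elements lie on the same side
of `A`. -/
def Respects (f : Finset V → Bool) (A T : Finset V) : Prop :=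
  f T = true ∧ ∀ r ∈ T, ∀ x ∉ T, f (insert x (T.erase r)) = decide (r ∈ A ↔ x ∈ A)

/-- Fix a marked `T` and `u ∉ T`. By `of_marked` every outside vertex has the vector of `u` or its
complement; `A` collects the former, together with the elements of `T` at which the vector of `u` is
marked. Neighbours of `T + u` lie outside `A`, and neighbours of `T + v`, for `v` a neighbour of `T
+ u`, lie inside. So both sides exceed a third of the at least `6 * k` vertices. -/
theorem exists_respects (h : PairColoring H k f) : ∃ A T : Finset V, T.card + 2 = k ∧
    Respects f A T ∧ 2 * k ≤ A.card ∧ 2 * k ≤ Aᶜ.card := by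
  have h3 := h.three_le
  have hl := h.large
  obtain ⟨S, -, hS⟩ := Finset.exists_subset_card_eq
    (show k - 1 ≤ (Finset.univ : Finset V).card by rw [Finset.card_univ]; omega)
  obtain ⟨u, hu, hf⟩ := h.exists_marked (S := S) (by omega)
  set T := S.erase u with hTdef
  have hT : T.card + 2 = k := by rw [Finset.card_erase_of_mem hu]; omega
  have huT : u ∉ T := Finset.notMem_erase u S
  obtain ⟨t, ht⟩ : T.Nonempty := Finset.card_pos.1 (by omega)
  obtain ⟨v, hv⟩ := h.exists_nbr hT huT
  obtain ⟨hvT, -, hvs⟩ := h.shift hT huT hv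
  let A : Finset V := Finset.univ.filter fun x => if x ∈ T then f (insert u (T.erase x)) = true
    else ∀ r ∈ T, f (insert x (T.erase r)) = f (insert u (T.erase r))
  have hAT : ∀ x, x ∈ T → (x ∈ A ↔ f (insert u (T.erase x)) = true) := by
    intro x hx; simp [A, hx]
  have hAn : ∀ x, x ∉ T → (x ∈ A ↔ ∀ r ∈ T, f (insert x (T.erase r)) = f (insert u (T.erase r))) := by
    intro x hx; simp [A, hx]
  refine ⟨A, T, hT, ⟨hf, fun r hr x hx => ?_⟩, ?_, ?_⟩
  · by_cases hxA : x ∈ A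
    · rw [(hAn x hx).1 hxA r hr]
      simp only [hxA, iff_true, hAT r hr]
      simp
    · have := (h.of_marked hT hf hx huT).resolve_left fun h' => hxA ((hAn x hx).2 h')
      rw [this r hr]
      simp only [hxA, iff_false, hAT r hr]
      simp
  · have hsub : nbr H (insert v T) ⊆ A := by
      intro z hz
      obtain ⟨hzT, -, hzs⟩ := h.shift hT hvT hz
      rw [hAn z hzT]
      intro r hr
      rw [hzs r hr, hvs r hr, hf]
      simp
    have := Finset.card_le_card hsub
    have := h.deg_insert hT hvT
    omega
  · have hsub : nbr H (insert u T) ⊆ Aᶜ := by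
      intro z hz
      obtain ⟨hzT, -, hzs⟩ := h.shift hT huT hz
      rw [Finset.mem_compl, hAn z hzT]
      intro hcon
      have := hcon t ht
      rw [hzs t ht, hf] at this
      simp at this
    have := Finset.card_le_card hsub
    have := h.deg_insert hT huT
    omega

/-- The essential case exchanges `s ∈ T - r` for a new `y`. If `y` is on the side of `r`, apply
`of_marked` at `T - r + y` to `x` and `r`: their vectors agree at `y`, hence everywhere. Otherwise
apply it at `T - r + x` to `y` and `r`: their vectors differ at `x`, hence everywhere. -/
theorem Respects.exchange (h : PairColoring H k f) {A T : Finset V} (hT : T.card + 2 = k)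
    (hg : Respects f A T) {r x : V} (hr : r ∈ T) (hx : x ∉ T) (hrx : r ∈ A ↔ x ∈ A) :
    Respects f A (insert x (T.erase r)) := by
  obtain ⟨hfT, hg⟩ := hg
  have hxr : x ≠ r := fun e => hx (e ▸ hr)
  have hxR : x ∉ T.erase r := fun h => hx (Finset.mem_of_mem_erase h)
  have hcard : ∀ y, y ∉ T.erase r → (insert y (T.erase r)).card + 2 = k := by
    intro y hy
    rw [Finset.card_insert_of_notMem hy, Finset.card_erase_of_mem hr]
    have := Finset.card_pos.2 ⟨r, hr⟩
    omega
  have hT' : f (insert x (T.erase r)) = true := by rw [hg r hr x hx]; simp [hrx]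
  refine ⟨hT', fun s hs y hy => ?_⟩
  simp only [Finset.mem_insert, Finset.mem_erase, not_or, not_and] at hy
  by_cases hsx : s = x
  · subst hsx
    rw [Finset.erase_insert hxR]
    by_cases hyr : y = r
    · subst hyr
      rw [Finset.insert_erase hr, hfT]
      simp [hrx]
    · rw [hg r hr y (hy.2 hyr)]
      simp [hrx]
  · have hsR : s ∈ T.erase r := (Finset.mem_insert.1 hs).resolve_left hsx
    have hsT : s ∈ T := Finset.mem_of_mem_erase hsR
    have hsr : s ≠ r := Finset.ne_of_mem_erase hsR
    by_cases hyr : y = r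
    · subst hyr
      have : insert y ((insert x (T.erase y)).erase s) = insert x (T.erase s) := by
        ext a; simp only [Finset.mem_erase, Finset.mem_insert]; grind
      rw [this, hg s hsT x hx]
      simp [hrx]
    · have hyT := hy.2 hyr
      have hyR : y ∉ T.erase r := fun h => hyT (Finset.mem_of_mem_erase h)
      by_cases hside : r ∈ A ↔ y ∈ A
      · have hQ : f (insert y (T.erase r)) = true := by rw [hg r hr y hyT]; simp [hside]
        have hm := h.of_marked (hcard y hyR) hQ (x := x) (y := r)
          (by simp [hxR, Ne.symm hy.1]) (by simp [Ne.symm hyr])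
        have e1 : f (insert x ((insert y (T.erase r)).erase s))
            = f (insert r ((insert y (T.erase r)).erase s)) := by
          refine (hm.resolve_right fun hcon => ?_) s (Finset.mem_insert_of_mem hsR)
          have := hcon y (Finset.mem_insert_self _ _)
          rw [Finset.erase_insert hyR, hT', Finset.insert_erase hr, hfT] at this
          simp at this
        have e2 : insert x ((insert y (T.erase r)).erase s)
            = insert y ((insert x (T.erase r)).erase s) := by
          ext a; simp only [Finset.mem_erase, Finset.mem_insert]; grind
        have e3 : insert r ((insert y (T.erase r)).erase s) = insert y (T.erase s) := by
          ext a; simp only [Finset.mem_erase, Finset.mem_insert]; grind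
        rw [← e2, e1, e3, hg s hsT y hyT]
      · have hm := h.of_marked (hcard x hxR) hT' (x := y) (y := r)
          (by simp [hyR, hy.1]) (by simp [Ne.symm hxr])
        have e1 : f (insert y ((insert x (T.erase r)).erase s))
            = !f (insert r ((insert x (T.erase r)).erase s)) := by
          refine (hm.resolve_left fun hcon => ?_) s (Finset.mem_insert_of_mem hsR)
          have := hcon x (Finset.mem_insert_self _ _)
          rw [Finset.erase_insert hxR, hg r hr y hyT, Finset.insert_erase hr, hfT] at this
          simp [hside] at this
        have e3 : insert r ((insert x (T.erase r)).erase s) = insert x (T.erase s) := by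
          ext a; simp only [Finset.mem_erase, Finset.mem_insert]; grind
        rw [e1, e3, hg s hsT x hx]
        by_cases hsA : s ∈ A <;> by_cases hrA : r ∈ A <;> by_cases hyA : y ∈ A <;>
          simp_all

theorem exists_exchange {X Y : Finset V} (hXY : X.card = Y.card) {r : V} (hr : r ∈ X)
    (hr' : r ∉ Y) : ∃ x ∈ Y, x ∉ X := by
  by_contra hcon
  push Not at hcon
  have : Y = X := Finset.eq_of_subset_of_card_le hcon hXY.le
  exact hr' (this ▸ hr)

/-- The number of elements of `T` in `A`. -/
def level (A T : Finset V) : ℕ := (T ∩ A).card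

theorem level_insert_of_mem {A T : Finset V} {x : V} (hx : x ∉ T) (hA : x ∈ A) :
    level A (insert x T) = level A T + 1 := by
  rw [level, Finset.insert_inter_of_mem hA, Finset.card_insert_of_notMem (by simp [hx]), level]

theorem level_insert_of_notMem {A T : Finset V} {x : V} (hA : x ∉ A) :
    level A (insert x T) = level A T := by
  rw [level, Finset.insert_inter_of_notMem hA, level]

theorem level_erase_of_mem {A T : Finset V} {x : V} (hx : x ∈ T) (hA : x ∈ A) :
    level A (T.erase x) + 1 = level A T := by
  rw [level, Finset.erase_inter, Finset.card_erase_add_one (by simp [hx, hA]), level]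

theorem level_erase_of_notMem {A T : Finset V} {x : V} (hA : x ∉ A) :
    level A (T.erase x) = level A T := by
  rw [level, Finset.erase_inter, Finset.erase_eq_of_notMem (by simp [hA]), level]

theorem level_add_level_compl (A T : Finset V) : level A T + level Aᶜ T = T.card := by
  have : T ∩ Aᶜ = T \ A := by ext; simp
  rw [level, level, this, Finset.card_inter_add_card_sdiff]

/-- Sets of equal size and equal level are connected by exchanges within a side of `A`; the
induction is on the number of elements still to be exchanged. -/
theorem Respects.of_level_eq (h : PairColoring H k f) {A T : Finset V} (hT : T.card + 2 = k) :
    ∀ (n : ℕ) {T₀ : Finset V}, (T₀ \ T).card = n → T₀.card + 2 = k → Respects f A T₀ →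
      level A T₀ = level A T → Respects f A T := by
  intro n
  induction n with
  | zero =>
    intro T₀ hn hT₀ hg _
    have : T₀ ⊆ T := by simpa using hn
    rwa [← Finset.eq_of_subset_of_card_le this (by omega)]
  | succ n ih =>
    intro T₀ hn hT₀ hg hlev
    obtain ⟨r, hr⟩ := Finset.card_pos.1 (show 0 < (T₀ \ T).card by omega)
    obtain ⟨hr0, hrT⟩ := Finset.mem_sdiff.1 hr
    obtain ⟨x, hxT, hx0, hrx⟩ : ∃ x, x ∈ T ∧ x ∉ T₀ ∧ (r ∈ A ↔ x ∈ A) := by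
      by_cases hrA : r ∈ A
      · obtain ⟨x, hx, hx'⟩ := exists_exchange (X := T₀ ∩ A) (Y := T ∩ A) (r := r) hlev
          (by simp [hr0, hrA]) (by simp [hrT])
        simp only [Finset.mem_inter] at hx hx'
        exact ⟨x, hx.1, by tauto, by tauto⟩
      · have hlev' : level Aᶜ T₀ = level Aᶜ T := by
          have := level_add_level_compl A T₀
          have := level_add_level_compl A T
          omega
        obtain ⟨x, hx, hx'⟩ := exists_exchange (X := T₀ ∩ Aᶜ) (Y := T ∩ Aᶜ) (r := r) hlev'
          (by simp [hr0, hrA]) (by simp [hrT])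
        simp only [Finset.mem_inter, Finset.mem_compl] at hx hx'
        exact ⟨x, hx.1, by tauto, by tauto⟩
    have hxR : x ∉ T₀.erase r := fun h => hx0 (Finset.mem_of_mem_erase h)
    refine ih (T₀ := insert x (T₀.erase r)) ?_ ?_ (hg.exchange h hT₀ hr0 hx0 hrx) ?_
    · rw [Finset.insert_sdiff_of_mem _ hxT, Finset.erase_sdiff_comm, Finset.card_erase_of_mem hr]
      omega
    · rw [Finset.card_insert_of_notMem hxR, Finset.card_erase_of_mem hr0]
      have := Finset.card_pos.2 ⟨r, hr0⟩
      omega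
    · rw [← hlev]
      by_cases hrA : r ∈ A
      · rw [level_insert_of_mem hxR (hrx.1 hrA), level_erase_of_mem hr0 hrA]
      · rw [level_insert_of_notMem (fun h => hrA (hrx.2 h)), level_erase_of_notMem hrA]

/-- All `(k - 2)`-sets with `t` elements in `A` have mark `b`. -/
def LevelMark (k : ℕ) (f : Finset V → Bool) (A : Finset V) (t : ℕ) (b : Bool) : Prop :=
  ∀ T : Finset V, T.card + 2 = k → level A T = t → f T = b

theorem card_swap {T : Finset V} {x r : V} (hr : r ∈ T) (hx : x ∉ T) :
    (insert x (T.erase r)).card = T.card := by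
  rw [Finset.card_insert_of_notMem fun h => hx (Finset.mem_of_mem_erase h),
    Finset.card_erase_of_mem hr]
  have := Finset.card_pos.2 ⟨r, hr⟩
  omega

theorem insert_erase_swap {T : Finset V} {x r : V} (hr : r ∈ T) (hx : x ∉ T) :
    insert r ((insert x (T.erase r)).erase x) = T := by
  rw [Finset.erase_insert fun h => hx (Finset.mem_of_mem_erase h), Finset.insert_erase hr]

theorem exists_notMem {A : Finset V} {T : Finset V} (hA : T.card < A.card) : ∃ x ∈ A, x ∉ T := by
  by_contra hcon
  push Not at hcon
  exact absurd (Finset.card_le_card (show A ⊆ T from hcon)) (by omega)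

/-- A set one level higher arises from a set at the level of `T₀` by an exchange across `A`, which
removes the mark. -/
theorem levelMark_base (h : PairColoring H k f) {A T₀ : Finset V} (hT₀ : T₀.card + 2 = k)
    (hg : Respects f A T₀) (hA : 2 * k ≤ Aᶜ.card) :
    LevelMark k f A (level A T₀) true ∧ LevelMark k f A (level A T₀ + 1) false := by
  refine ⟨fun T hT hl => (hg.of_level_eq h hT _ rfl hT₀ hl.symm).1, fun T hT hl => ?_⟩
  obtain ⟨x, hx⟩ : (T ∩ A).Nonempty := Finset.card_pos.1 (by rw [level] at hl; omega)
  obtain ⟨hxT, hxA⟩ := Finset.mem_inter.1 hx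
  obtain ⟨r, hrA, hrT⟩ := exists_notMem (A := Aᶜ) (T := T) (by omega)
  rw [Finset.mem_compl] at hrA
  have hg' := hg.of_level_eq h (T := insert r (T.erase x)) (by rw [card_swap hxT hrT, hT]) _ rfl hT₀
    (by rw [level_insert_of_notMem hrA]; have := level_erase_of_mem hxT hxA; omega)
  have hne : x ≠ r := fun e => hrT (e ▸ hxT)
  have := hg'.2 r (by simp) x (by simp [hne])
  rw [insert_erase_swap hxT hrT] at this
  rw [this]
  simp [hxA, hrA]

/-- Suppose `T` at level `t + 1` is unmarked. For each `x` outside `A` and `T`, the set `T + x`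
contains a marked set, which must omit some `r ∈ T \ A`, since omitting an element of `A` gives
level `t`. By pigeonhole two such vertices `x`, `x'` share the same `r`. At `T - r + x` the vectors
of `x'` and `r` differ at `x`, so they are complementary; but at any `u ∈ T ∩ A` both give level `t`
and are unmarked. -/
theorem levelMark_true (h : PairColoring H k f) {A : Finset V} (hA : 2 * k ≤ Aᶜ.card) {t : ℕ}
    (ht : LevelMark k f A t false) : LevelMark k f A (t + 1) true := by
  intro T hT hl
  by_contra hf
  simp only [Bool.not_eq_true] at hf
  have hex : ∀ x ∈ Aᶜ \ T, ∃ r ∈ T \ A, f (insert x (T.erase r)) = true := by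
    intro x hx
    simp only [Finset.mem_sdiff, Finset.mem_compl] at hx
    obtain ⟨r, hr, hfr⟩ := h.exists_marked (S := insert x T)
      (by rw [Finset.card_insert_of_notMem hx.2]; omega)
    have hrx : r ≠ x := by
      rintro rfl
      rw [Finset.erase_insert hx.2, hf] at hfr
      simp at hfr
    have hrT : r ∈ T := (Finset.mem_insert.1 hr).resolve_left hrx
    rw [Finset.erase_insert_of_ne hrx.symm] at hfr
    refine ⟨r, ?_, hfr⟩
    rw [Finset.mem_sdiff]
    refine ⟨hrT, fun hrA => ?_⟩
    have := ht (insert x (T.erase r)) (by rw [card_swap hrT hx.2, hT])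
      (by rw [level_insert_of_notMem hx.1]; have := level_erase_of_mem hrT hrA; omega)
    rw [hfr] at this
    simp at this
  choose! g hg1 hg2 using hex
  have hcard : (T \ A).card < (Aᶜ \ T).card := by
    have h1 := Finset.card_le_card (Finset.sdiff_subset (s := T) (t := A))
    have h2 := Finset.le_card_sdiff T Aᶜ
    have := h.three_le
    omega
  obtain ⟨x, hx, x', hx', hne, hgg⟩ := Finset.exists_ne_map_eq_of_card_lt_of_maps_to hcard
    (fun x hx => hg1 x hx)
  have hr := hg1 x hx
  have f1 := hg2 x hx
  have f2 := hg2 x' hx'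
  rw [← hgg] at f2
  set r := g x
  simp only [Finset.mem_sdiff, Finset.mem_compl] at hx hx' hr
  have hxr : x ≠ r := fun e => hx.2 (e ▸ hr.1)
  have hxr' : x' ≠ r := fun e => hx'.2 (e ▸ hr.1)
  have hxR : x ∉ T.erase r := fun h => hx.2 (Finset.mem_of_mem_erase h)
  have hm := h.of_marked (by rw [card_swap hr.1 hx.2, hT]) f1 (x := x') (y := r)
    (by simp [hne.symm, hx'.2]) (by simp [hxr.symm])
  have hm := hm.resolve_left fun hcon => by
    have := hcon x (by simp)
    rw [insert_erase_swap hr.1 hx.2, Finset.erase_insert hxR, f2, hf] at this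
    simp at this
  obtain ⟨u, hu⟩ : (T ∩ A).Nonempty := Finset.card_pos.1 (by rw [level] at hl; omega)
  obtain ⟨huT, huA⟩ := Finset.mem_inter.1 hu
  have hur : u ≠ r := fun e => hr.2 (e ▸ huA)
  have huT1 : u ∈ insert x (T.erase r) := by simp [hur, huT]
  have hl1 : level A ((insert x (T.erase r)).erase u) = t := by
    have h1 := level_erase_of_mem huT1 huA
    rw [level_insert_of_notMem hx.1, level_erase_of_notMem hr.2] at h1
    omega
  have hv : ∀ y, y ∉ insert x (T.erase r) → y ∉ A →
      f (insert y ((insert x (T.erase r)).erase u)) = false := by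
    intro y hy hyA
    exact ht _ (by rw [card_swap huT1 hy, card_swap hr.1 hx.2, hT])
      (by rw [level_insert_of_notMem hyA, hl1])
  have := hm u huT1
  rw [hv x' (by simp [hne.symm, hx'.2]) hx'.1, hv r (by simp [hxr.symm]) hr.2] at this
  simp at this

/-- Write `T` as `T' - z + x` with `T'` at the marked level `t + 1`, `z ∉ A` and `x ∈ A`, and
compare `x` with some `y ∉ A` at `T'`. At an element of `T' ∩ A` they give levels `t + 1` and `t`,
so their vectors are complementary. At `z` they give `T` and a marked set. -/
theorem levelMark_false (h : PairColoring H k f) {A : Finset V} (hA : 2 * k ≤ Aᶜ.card) {t : ℕ}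
    (ht : LevelMark k f A t false) (ht' : LevelMark k f A (t + 1) true) :
    LevelMark k f A (t + 2) false := by
  intro T hT hl
  obtain ⟨x, hx⟩ : (T ∩ A).Nonempty := Finset.card_pos.1 (by rw [level] at hl; omega)
  obtain ⟨hxT, hxA⟩ := Finset.mem_inter.1 hx
  obtain ⟨z, hzA, hzT⟩ := exists_notMem (A := Aᶜ) (T := T) (by omega)
  rw [Finset.mem_compl] at hzA
  have hzx : z ≠ x := fun e => hzA (e ▸ hxA)
  have hcT : (insert z (T.erase x)).card + 2 = k := by rw [card_swap hxT hzT, hT]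
  have hlT : level A (insert z (T.erase x)) = t + 1 := by
    rw [level_insert_of_notMem hzA]
    have := level_erase_of_mem hxT hxA
    omega
  obtain ⟨y, hyA, hyT⟩ := exists_notMem (A := Aᶜ) (T := insert z (T.erase x)) (by omega)
  rw [Finset.mem_compl] at hyA
  have hzR : z ∉ T.erase x := fun h => hzT (Finset.mem_of_mem_erase h)
  have hxT' : x ∉ insert z (T.erase x) := by simp [hzx.symm]
  have hm := h.of_marked hcT (ht' _ hcT hlT) hxT' hyT
  obtain ⟨u, hu⟩ : (insert z (T.erase x) ∩ A).Nonempty :=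
    Finset.card_pos.1 (by rw [level] at hlT; omega)
  obtain ⟨huT, huA⟩ := Finset.mem_inter.1 hu
  have hle := level_erase_of_mem huT huA
  have hm := hm.resolve_left fun hcon => by
    have := hcon u huT
    rw [ht' _ (by rw [card_swap huT hxT', hcT])
      (by rw [level_insert_of_mem (fun h => hxT' (Finset.mem_of_mem_erase h)) hxA]; omega),
      ht _ (by rw [card_swap huT hyT, hcT]) (by rw [level_insert_of_notMem hyA]; omega)] at this
    simp at this
  have := hm z (by simp)
  rw [insert_erase_swap hxT hzT, ht' (insert y _) (by rw [card_swap (by simp) hyT, hcT])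
    (by rw [level_insert_of_notMem hyA, level_erase_of_notMem hzA, hlT])] at this
  simpa using this

theorem levelMark_up (h : PairColoring H k f) {A : Finset V} (hA : 2 * k ≤ Aᶜ.card) {t : ℕ}
    (ht : LevelMark k f A t true) (ht' : LevelMark k f A (t + 1) false) (j : ℕ) :
    LevelMark k f A (t + 2 * j) true ∧ LevelMark k f A (t + 2 * j + 1) false := by
  induction j with
  | zero => exact ⟨ht, ht'⟩
  | succ j ih =>
    have h1 := h.levelMark_true hA ih.2
    exact ⟨h1, h.levelMark_false hA ih.2 h1⟩

theorem not_levelMark_top (h : PairColoring H k f) {A : Finset V} (hA : 2 * k ≤ A.card)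
    (ht : LevelMark k f A (k - 2) false) : False := by
  have h3 := h.three_le
  obtain ⟨S, hSA, hS⟩ := Finset.exists_subset_card_eq (show k - 1 ≤ A.card by omega)
  obtain ⟨r, hr, hf⟩ := h.exists_marked (S := S) (by omega)
  have hc : (S.erase r).card = k - 2 := by rw [Finset.card_erase_of_mem hr]; omega
  rw [ht (S.erase r) (by omega)] at hf
  · simp at hf
  · rw [level, Finset.inter_eq_left.2 ((Finset.erase_subset _ _).trans hSA), hc]

/-- Marks alternate upwards from `t₀`. The top level `k - 2` cannot be unmarked, since a
`(k-1)`-subset of `A` contains a marked set; this fixes the parity of `k - 2 - t₀`. -/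
theorem levelMark_ge (h : PairColoring H k f) {A : Finset V} (hA : 2 * k ≤ A.card)
    (hA' : 2 * k ≤ Aᶜ.card) {t₀ : ℕ} (ht₀ : t₀ + 2 ≤ k)
    (ht : LevelMark k f A t₀ true) (ht' : LevelMark k f A (t₀ + 1) false) :
    Even (k - 2 - t₀) ∧ ∀ t, t₀ ≤ t → LevelMark k f A t (decide (Even (t - t₀))) := by
  have key : ∀ t, t₀ ≤ t → LevelMark k f A t (decide (Even (t - t₀))) := by
    intro t htt
    rcases Nat.even_or_odd' (t - t₀) with ⟨j, hj | hj⟩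
    · have h1 := (h.levelMark_up hA' ht ht' j).1
      rw [← hj, show t₀ + (t - t₀) = t by omega] at h1
      have : Even (t - t₀) := ⟨j, by omega⟩
      simpa [this] using h1
    · have h1 := (h.levelMark_up hA' ht ht' j).2
      rw [show t₀ + 2 * j + 1 = t by omega] at h1
      have : ¬ Even (t - t₀) := by rw [Nat.not_even_iff_odd]; exact ⟨j, hj⟩
      simpa [this] using h1
  refine ⟨?_, key⟩
  by_contra hcon
  have := key (k - 2) (by omega)
  rw [show decide (Even (k - 2 - t₀)) = false by simpa using hcon] at this
  exact h.not_levelMark_top hA this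

theorem Respects.compl {A T : Finset V} (hg : Respects f A T) : Respects f Aᶜ T := by
  refine ⟨hg.1, fun r hr x hx => ?_⟩
  rw [hg.2 r hr x hx]
  simp [not_iff_not]

/-- The marks are given by the parity of the intersection with a fixed set, and the uniformity is
even. -/
theorem exists_parity (h : PairColoring H k f) : ∃ A : Finset V, 2 * k ≤ A.card ∧
    2 * k ≤ Aᶜ.card ∧ Even k ∧
    ∀ T : Finset V, T.card + 2 = k → f T = decide (Even (level A T)) := by
  obtain ⟨A, T, hT, hg, hA, hA'⟩ := h.exists_respects
  have hAcc : 2 * k ≤ Aᶜᶜ.card := by rwa [compl_compl]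
  obtain ⟨h1, h2⟩ := h.levelMark_base hT hg hA'
  -- The same argument with `A` replaced by its complement covers the levels below that of `T`, and
  -- shows that the level of `T` is even.
  obtain ⟨h3, h4⟩ := h.levelMark_base hT hg.compl hAcc
  have hl := level_add_level_compl A T
  obtain ⟨e1, up⟩ := h.levelMark_ge hA hA' (by omega) h1 h2
  obtain ⟨e2, down⟩ := h.levelMark_ge hA' hAcc (by omega) h3 h4
  have e2' : Even (level A T) := by rwa [show k - 2 - level Aᶜ T = level A T by omega] at e2
  refine ⟨A, hA, hA', ?_, fun X hX => ?_⟩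
  · have := h.three_le
    have : k = (k - 2 - level A T) + level A T + 2 := by omega
    rw [this]
    exact (e1.add e2').add even_two
  · by_cases hle : level A T ≤ level A X
    · rw [up _ hle X hX rfl, decide_eq_decide, Nat.even_sub hle]
      simp [e2']
    · have hlX := level_add_level_compl A X
      rw [down _ (by omega) X hX rfl, show level Aᶜ X - level Aᶜ T = level A T - level A X by omega,
        decide_eq_decide, Nat.even_sub (by omega)]
      simp [e2']

end PairColoring

end PairColoring

/-! ### Codegree conditions that force closed tight walks. -/

section HomThreshold

variable {V : Type*} [Fintype V] [DecidableEq V]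

theorem exists_mem_of_card_lt {k : ℕ} {H : Set (Finset V)} {c : ℕ} (hk : 0 < k)
    (hV : k ≤ Fintype.card V)
    (hdeg : ∀ S : Finset V, S.card + 1 = k → Fintype.card V < c * (nbr H S).card) :
    ∃ e, e ∈ H := by
  obtain ⟨S, -, hS⟩ := Finset.exists_subset_card_eq
    (show k - 1 ≤ (Finset.univ : Finset V).card by rw [Finset.card_univ]; omega)
  have := hdeg S (by omega)
  obtain ⟨z, hz⟩ : (nbr H S).Nonempty := Finset.card_pos.1 (by
    by_contra hcon
    rw [Nat.eq_zero_of_not_pos hcon] at this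
    omega)
  exact ⟨_, mem_nbr.1 hz⟩

theorem exchangeable_iff {H : Set (Finset V)} {e : Finset V} {a b : V} :
    Exchangeable H e a b ↔ ∃ c, c ∈ nbr H (e.erase a) ∧ c ∈ nbr H (e.erase b) := by
  simp only [mem_nbr]; rfl

/-- Codegrees above one half of the order force closed tight walks. -/
theorem exists_closedTightWalk_of_half {k ℓ : ℕ} {H : Set (Finset V)} (hk : 0 < k)
    (hU : ∀ e ∈ H, e.card = k) (hV : k ≤ Fintype.card V)
    (hdeg : ∀ S : Finset V, S.card + 1 = k → Fintype.card V < 2 * (nbr H S).card)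
    (hℓ : 17 * k * k ≤ ℓ) : ∃ φ : ZMod ℓ → V, IsClosedTightWalk H k ℓ φ := by
  have : NeZero k := ⟨hk.ne'⟩
  obtain ⟨e, he⟩ := exists_mem_of_card_lt hk hV hdeg
  have hU' : ∀ e ∈ H, e.card = Fintype.card (ZMod k) := by simpa [ZMod.card] using hU
  refine exists_closedTightWalk_of_swapWithin (c := 17) he (hU e he) (fun _ => True)
    (fun a ha b hb _ => ?_) (Or.inr fun _ _ => trivial) hℓ (by norm_num)
  by_cases hab : a = b
  · subst hab
    exact SwapWithin.refl a he (hU' e he)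
  · refine (Exchangeable.swapWithin hU' he hab ?_).mono he (by norm_num)
    rw [exchangeable_iff]
    by_contra hcon
    push Not at hcon
    have h1 := hdeg (e.erase a) (by
      rw [Finset.card_erase_of_mem ha, hU e he]; omega)
    have h2 := hdeg (e.erase b) (by
      rw [Finset.card_erase_of_mem hb, hU e he]; omega)
    have hd : Disjoint (nbr H (e.erase a)) (nbr H (e.erase b)) :=
      Finset.disjoint_left.2 hcon
    have := Finset.card_le_univ (nbr H (e.erase a) ∪ nbr H (e.erase b))
    rw [Finset.card_union_of_disjoint hd] at this
    omega

/-- Three neighbourhoods, each larger than a third of the vertices, cannot be pairwise disjoint. -/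
theorem exchangeable_of_three {k : ℕ} {H : Set (Finset V)} (hU : ∀ e ∈ H, e.card = k)
    (hdeg : ∀ S : Finset V, S.card + 1 = k → Fintype.card V < 3 * (nbr H S).card)
    {e : Finset V} (he : e ∈ H) {a b c : V} (ha : a ∈ e) (hb : b ∈ e) (hc : c ∈ e) :
    Exchangeable H e a b ∨ Exchangeable H e a c ∨ Exchangeable H e b c := by
  by_contra hcon
  simp only [exchangeable_iff] at hcon
  push Not at hcon
  obtain ⟨h1, h2, h3⟩ := hcon
  have hd : ∀ a ∈ e, Fintype.card V < 3 * (nbr H (e.erase a)).card := fun a ha =>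
    hdeg _ (by
      have := Finset.card_pos.2 ⟨a, ha⟩
      rw [Finset.card_erase_of_mem ha]; have := hU e he; omega)
  exact not_three_large_disjoint (hd a ha) (hd b hb) (hd c hc) h1 h2 h3

/-- Either all pairs of vertices of `e` can be exchanged quickly, or `e` splits into two classes
within which the vertices are exchangeable. -/
theorem swapWithin_or_split {k : ℕ} [NeZero k] {H : Set (Finset V)} (hU : ∀ e ∈ H, e.card = k)
    (hdeg : ∀ S : Finset V, S.card + 1 = k → Fintype.card V < 3 * (nbr H S).card)
    {e : Finset V} (he : e ∈ H) (hno : ¬ ∀ a ∈ e, ∀ b ∈ e, SwapWithin (ZMod k) H 17 e a b) :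
    ∃ χ : V → Bool, (∀ a ∈ e, ∀ b ∈ e, a ≠ b → (Exchangeable H e a b ↔ χ a = χ b)) ∧
      ∃ a ∈ e, ∃ b ∈ e, χ a ≠ χ b := by
  classical
  have hU' : ∀ e ∈ H, e.card = Fintype.card (ZMod k) := by simpa [ZMod.card] using hU
  push Not at hno
  obtain ⟨u, hu, v, hv, huv⟩ := hno
  have hne : u ≠ v := by
    rintro rfl
    exact huv (SwapWithin.refl u he (hU' e he))
  have hsw : ∀ {a b}, a ≠ b → Exchangeable H e a b → SwapWithin (ZMod k) H 3 e a b :=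
    fun hab h => h.swapWithin hU' he hab
  have hD : ¬ Exchangeable H e u v := fun h => huv ((hsw hne h).mono he (by norm_num))
  -- Since `u`, `v` cannot be swapped cheaply, no short path of exchangeable pairs joins them: a
  -- path of length two would cost 9, one of length three 15.
  have h2 : ∀ w ∈ e, w ≠ u → w ≠ v → Exchangeable H e u w → ¬ Exchangeable H e w v := by
    intro w hw hwu hwv h1 h2
    exact huv (((hsw hwu.symm h1).conj he (hU' e he) hw (hsw hwv h2)).mono he (by norm_num))
  have h3 : ∀ a ∈ e, ∀ b ∈ e, a ≠ u → b ≠ v → a ≠ b → Exchangeable H e u a →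
      Exchangeable H e a b → ¬ Exchangeable H e b v := by
    intro a ha b hb hau hbv hab h1 h2 h3
    have s1 := (hsw hau.symm h1).conj he (hU' e he) ha (hsw hab h2)
    have s2 := (hsw hbv h3).symm.conj he (hU' e he) hb s1.symm
    exact huv (s2.symm.mono he (by norm_num))
  have t3 := fun {a b c : V} => exchangeable_of_three hU hdeg he (a := a) (b := b) (c := c)
  -- One class is `u` with its exchange partners. A vertex outside it is `v` or, by the triple with
  -- `u` and `v`, a partner of `v`, so an exchange across classes would complete a short path from
  -- `u` to `v`. Inside a class, the triple with `v`, respectively `u`, leaves only the desired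
  -- pair.
  let P : V → Prop := fun x => x = u ∨ Exchangeable H e u x
  have hcross : ∀ a ∈ e, ∀ b ∈ e, P a → ¬ P b → ¬ Exchangeable H e a b := by
    intro a ha b hb hPa hPb hab
    have hbu : b ≠ u := fun h => hPb (Or.inl h)
    have hub : ¬ Exchangeable H e u b := fun h => hPb (Or.inr h)
    rcases hPa with rfl | hua
    · exact hub hab
    · by_cases hau : a = u
      · subst hau; exact hub hab
      · by_cases hbv : b = v
        · subst hbv
          by_cases hav : a = b
          · subst hav; exact hub hua
          · exact h2 a ha hau hav hua hab
        · have hab' : a ≠ b := by rintro rfl; exact hub hua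
          refine h3 a ha b hb hau hbv hab' hua hab ?_
          rcases t3 hu hb hv with h | h | h
          · exact absurd h hub
          · exact absurd h hD
          · exact h
  refine ⟨fun x => decide (P x), fun a ha b hb hab => ?_, u, hu, v, hv, ?_⟩
  · rw [decide_eq_decide]
    constructor
    · intro h
      by_cases hPa : P a <;> by_cases hPb : P b
      · simp [hPa, hPb]
      · exact absurd h (hcross a ha b hb hPa hPb)
      · exact absurd h.symm (hcross b hb a ha hPb hPa)
      · simp [hPa, hPb]
    · intro h
      by_cases hPa : P a
      · have hPb := h.1 hPa
        by_cases hau : a = u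
        · subst hau
          exact hPb.resolve_left (Ne.symm hab)
        by_cases hbu : b = u
        · subst hbu
          exact (hPa.resolve_left hab).symm
        have ha' := hPa.resolve_left hau
        have hb' := hPb.resolve_left hbu
        have hvn : ∀ w ∈ e, w ≠ u → Exchangeable H e u w → ¬ Exchangeable H e w v := by
          intro w hw hwu h1 h2'
          by_cases hwv : w = v
          · subst hwv; exact hD h1
          · exact h2 w hw hwu hwv h1 h2'
        rcases t3 ha hb hv with h | h | h
        · exact h
        · exact absurd h (hvn a ha hau ha')
        · exact absurd h (hvn b hb hbu hb')
      · have hPb : ¬ P b := fun h' => hPa (h.2 h')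
        rcases t3 ha hb hu with h | h | h
        · exact h
        · exact absurd (Or.inr h.symm) hPa
        · exact absurd (Or.inr h.symm) hPb
  · have h1 : P u := Or.inl rfl
    have h2 : ¬ P v := fun h => h.elim (fun h => hne h.symm) hD
    simp [h1, h2]

/-- If no edge has all its pairs quickly exchangeable, then exchangeability in an edge `S ∪ {x}` of
`r ∈ S` and `x` does not depend on `x`. -/
theorem exchangeable_transport {k : ℕ} [NeZero k] {H : Set (Finset V)}
    (hU : ∀ e ∈ H, e.card = k)
    (hdeg : ∀ S : Finset V, S.card + 1 = k → Fintype.card V < 3 * (nbr H S).card)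
    (hno : ∀ e ∈ H, ¬ ∀ a ∈ e, ∀ b ∈ e, SwapWithin (ZMod k) H 17 e a b)
    {S : Finset V} {x x' r : V} (hx : x ∉ S) (hx' : x' ∉ S) (hr : r ∈ S)
    (he : insert x S ∈ H) (he' : insert x' S ∈ H)
    (h : Exchangeable H (insert x' S) r x') : Exchangeable H (insert x S) r x := by
  have hU' : ∀ e ∈ H, e.card = Fintype.card (ZMod k) := by simpa [ZMod.card] using hU
  obtain ⟨χ, hχ, -⟩ := swapWithin_or_split hU hdeg he (hno _ he)
  have hrx : r ≠ x := fun e => hx (e ▸ hr)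
  have hrx' : r ≠ x' := fun e => hx' (e ▸ hr)
  have hre : r ∈ insert x S := Finset.mem_insert_of_mem hr
  have hxe : x ∈ insert x S := Finset.mem_insert_self _ _
  by_contra hcon
  have s5 : SwapWithin (ZMod k) H 5 (insert x S) r x :=
    (h.swapWithin hU' he' hrx').transport hU' hx hr he he'
  have hsame : ∀ a ∈ insert x S, ∀ b ∈ insert x S, χ a = χ b →
      SwapWithin (ZMod k) H 3 (insert x S) a b := by
    intro a ha b hb hab
    by_cases hne : a = b
    · subst hne
      exact SwapWithin.refl a he (hU' _ he)
    · exact ((hχ a ha b hb hne).2 hab).swapWithin hU' he hne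
  -- Origin of the constant 17: the transported swap of `r` and `x` costs `3 + 2 = 5`. Conjugating
  -- with a swap of cost 3 gives 11, and conjugating once more gives 17.
  have hcross : ∀ a ∈ insert x S, ∀ b ∈ insert x S, χ a = χ r → χ b = χ x →
      SwapWithin (ZMod k) H 17 (insert x S) a b := by
    intro a ha b hb har hbx
    have s1 := (hsame a ha r hre har).conj he (hU' _ he) hre s5
    exact (((hsame b hb x hxe hbx).conj he (hU' _ he) hxe s1.symm).symm).mono he (by norm_num)
  have hrx2 : χ r ≠ χ x := fun h => hcon ((hχ r hre x hxe hrx).2 h)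
  refine hno _ he fun a ha b hb => ?_
  by_cases hab : χ a = χ b
  · exact (hsame a ha b hb hab).mono he (by norm_num)
  · by_cases har : χ a = χ r
    · refine hcross a ha b hb har ?_
      revert hab har hrx2
      cases χ a <;> cases χ b <;> cases χ r <;> cases χ x <;> simp
    · refine (hcross b hb a ha ?_ ?_).symm <;>
      · revert hab har hrx2
        cases χ a <;> cases χ b <;> cases χ r <;> cases χ x <;> simp

open Classical in
/-- The sets `T` for which some edge `T ∪ {u, v}` has `u`, `v` not exchangeable. -/
noncomputable def mark (H : Set (Finset V)) (T : Finset V) : Bool :=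
  decide (∃ u v, u ≠ v ∧ u ∉ T ∧ v ∉ T ∧ insert u (insert v T) ∈ H ∧
    ¬ Exchangeable H (insert u (insert v T)) u v)

/-- This makes the marking well defined. Given an exchangeable pair `u`, `v` and a non-exchangeable
pair `a`, `b` over the same `T`, the neighbourhoods of `T + v`, `T + b` and `T + a` turn out to be
pairwise disjoint. A vertex `w` in the first and in one of the others would carry the
exchangeability of the first pair to the second by transport through `T + w`. -/
theorem mark_eq {k : ℕ} [NeZero k] {H : Set (Finset V)} (hk : 3 ≤ k)
    (hU : ∀ e ∈ H, e.card = k)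
    (hdeg : ∀ S : Finset V, S.card + 1 = k → Fintype.card V < 3 * (nbr H S).card)
    (hno : ∀ e ∈ H, ¬ ∀ a ∈ e, ∀ b ∈ e, SwapWithin (ZMod k) H 17 e a b)
    {T : Finset V} {u v : V} (huv : u ≠ v) (hu : u ∉ T) (hv : v ∉ T)
    (he : insert u (insert v T) ∈ H) :
    mark H T = true ↔ ¬ Exchangeable H (insert u (insert v T)) u v := by
  simp only [mark, decide_eq_true_eq]
  refine ⟨?_, fun h => ⟨u, v, huv, hu, hv, he, h⟩⟩
  rintro ⟨a, b, hab, ha, hb, he2, hD2⟩ hD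
  have hT : T.card + 2 = k := by
    have := hU _ he
    rw [Finset.card_insert_of_notMem (by simp [huv, hu]), Finset.card_insert_of_notMem hv] at this
    omega
  have hS : ∀ x, x ∉ T → (insert x T).card + 1 = k := fun x hx => by
    rw [Finset.card_insert_of_notMem hx]; omega
  have hN : ∀ {x y}, x ∉ T → y ∈ nbr H (insert x T) →
      y ≠ x ∧ y ∉ T ∧ insert y (insert x T) ∈ H := by
    intro x y hx hy
    have := notMem_of_mem_nbr hU (hS x hx) hy
    simp only [Finset.mem_insert, not_or] at this
    exact ⟨this.1, this.2, mem_nbr.1 hy⟩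
  have comm : ∀ x y : V, insert x (insert y T) = insert y (insert x T) :=
    fun x y => Finset.insert_comm x y T
  have tr : ∀ {s y z r : V}, s ∉ T → y ∉ insert s T → z ∉ insert s T → r ∈ insert s T →
      insert y (insert s T) ∈ H → insert z (insert s T) ∈ H →
      (Exchangeable H (insert y (insert s T)) r y ↔ Exchangeable H (insert z (insert s T)) r z) :=
    fun _ hy hz hr hyH hzH => ⟨exchangeable_transport hU hdeg hno hz hy hr hzH hyH,
      exchangeable_transport hU hdeg hno hy hz hr hyH hzH⟩
  -- a vertex cannot extend `T` both to a marked and to an unmarked pair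
  have hmix : ∀ {p q x y}, p ≠ q → p ∉ T → q ∉ T → insert p (insert q T) ∈ H →
      Exchangeable H (insert p (insert q T)) p q → x ≠ y → x ∉ T → y ∉ T →
      insert x (insert y T) ∈ H → ¬ Exchangeable H (insert x (insert y T)) x y →
      ∀ w, w ∈ nbr H (insert q T) → w ∉ nbr H (insert y T) := by
    intro p q x y hpq hp hq hpqH hpqD hxy hx hy hxyH hxyD w hw hw'
    obtain ⟨hwq, hwT, hwqH⟩ := hN hq hw
    obtain ⟨hwy, -, hwyH⟩ := hN hy hw'
    have h1 : Exchangeable H (insert w (insert q T)) q w :=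
      (tr (s := q) (y := p) (z := w) (r := q) hq (by simp [hpq, hp]) (by simp [hwq, hwT]) (by simp)
        hpqH hwqH).1 hpqD.symm
    have h2 : ¬ Exchangeable H (insert w (insert y T)) y w := fun h =>
      hxyD ((tr (s := y) (y := x) (z := w) (r := y) hy (by simp [hxy, hx]) (by simp [hwy, hwT])
        (by simp) hxyH hwyH).2 h).symm
    rw [comm] at h1 h2 hwqH hwyH
    exact h2 ((tr (s := w) (y := q) (z := y) (r := w) hwT (by simp [hwq.symm, hq])
      (by simp [hwy.symm, hy]) (by simp) hwqH hwyH).1 h1.symm).symm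
  have he2' : insert b (insert a T) ∈ H := by rwa [comm]
  have hD2' : ¬ Exchangeable H (insert b (insert a T)) b a := by
    rw [comm]; exact fun h => hD2 h.symm
  refine not_three_large_disjoint (hdeg _ (hS v hv)) (hdeg _ (hS b hb)) (hdeg _ (hS a ha))
    (hmix huv hu hv he hD hab ha hb he2 hD2)
    (hmix huv hu hv he hD hab.symm hb ha he2' hD2') ?_
  intro y hyb hya
  obtain ⟨hyb', hyT, hybH⟩ := hN hb hyb
  obtain ⟨hya', -, hyaH⟩ := hN ha hya
  obtain ⟨t, ht⟩ : T.Nonempty := Finset.card_pos.1 (by omega)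
  have hne : ∀ {x}, x ∉ T → t ≠ x := fun hx e => hx (e ▸ ht)
  -- in an edge with `p`, `q` in different classes, `t` is exchangeable with exactly one of them
  have hone : ∀ {p q : V}, p ≠ q → p ∉ T → q ∉ T → insert p (insert q T) ∈ H →
      ¬ Exchangeable H (insert p (insert q T)) p q →
      (Exchangeable H (insert p (insert q T)) t p ↔
        ¬ Exchangeable H (insert p (insert q T)) t q) := by
    intro p q hpq hp hq hH hpqD
    obtain ⟨χ, hχ, -⟩ := swapWithin_or_split hU hdeg hH (hno _ hH)
    rw [hχ p (by simp) q (by simp) hpq] at hpqD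
    rw [hχ t (by simp [ht]) p (by simp) (hne hp), hχ t (by simp [ht]) q (by simp) (hne hq)]
    revert hpqD
    cases χ t <;> cases χ p <;> cases χ q <;> simp
  have hDyb : ¬ Exchangeable H (insert y (insert b T)) y b := fun h =>
    hD2 ((tr (s := b) (y := a) (z := y) (r := b) hb (by simp [hab, ha]) (by simp [hyb', hyT])
        (by simp) he2 hybH).2 h.symm).symm
  have hDya : ¬ Exchangeable H (insert y (insert a T)) y a := fun h =>
    hD2' ((tr (s := a) (y := b) (z := y) (r := a) ha (by simp [hab.symm, hb]) (by simp [hya', hyT])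
        (by simp) he2' hyaH).2 h.symm).symm
  -- In the edges `T + a + b`, `T + y + b` and `T + y + a`, the transports `t1`, `t2`, `t3` reduce
  -- the six questions about `t` to three truth values, and `o1`, `o2`, `o3` require these to be
  -- pairwise different.
  have o1 := hone hab ha hb he2 hD2
  have o2 := hone hyb' hyT hb hybH hDyb
  have o3 := hone hya' hyT ha hyaH hDya
  have t1 := tr (s := b) (y := a) (z := y) (r := t) hb (by simp [hab, ha]) (by simp [hyb', hyT])
    (by simp [ht]) he2 hybH
  have t2 := tr (s := a) (y := b) (z := y) (r := t) ha (by simp [hab.symm, hb])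
    (by simp [hya', hyT]) (by simp [ht]) he2' hyaH
  have t3 := tr (s := y) (y := a) (z := b) (r := t) hyT (by simp [Ne.symm hya', ha])
    (by simp [Ne.symm hyb', hb]) (by simp [ht]) (by rwa [comm]) (by rwa [comm])
  rw [comm b a] at t2
  rw [comm a y, comm b y] at t3
  tauto

/-- Codegrees above one third of the order force closed tight walks of length `ℓ` if
`k / gcd (k, ℓ)` is odd. -/
theorem exists_closedTightWalk_of_third {k ℓ : ℕ} {H : Set (Finset V)} (hk : 3 ≤ k)
    (hU : ∀ e ∈ H, e.card = k) (hV : 6 * k ≤ Fintype.card V)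
    (hdeg : ∀ S : Finset V, S.card + 1 = k → Fintype.card V < 3 * (nbr H S).card)
    (hℓ : 17 * k * k ≤ ℓ) (hodd : Odd (k / Nat.gcd k ℓ)) :
    ∃ φ : ZMod ℓ → V, IsClosedTightWalk H k ℓ φ := by
  classical
  have : NeZero k := ⟨by omega⟩
  have hU' : ∀ e ∈ H, e.card = Fintype.card (ZMod k) := by simpa [ZMod.card] using hU
  by_contra hwalk
  have hno : ∀ e ∈ H, ¬ ∀ a ∈ e, ∀ b ∈ e, SwapWithin (ZMod k) H 17 e a b := fun e he h =>
    hwalk (exists_closedTightWalk_of_swapWithin (c := 17) he (hU e he) (fun _ => True)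
      (fun a ha b hb _ => h a ha b hb) (Or.inr fun _ _ => trivial) hℓ (by norm_num))
  have hmark : ∀ e ∈ H, ∀ u ∈ e, ∀ v ∈ e, u ≠ v →
      (mark H ((e.erase u).erase v) = true ↔ ¬ Exchangeable H e u v) := by
    intro e he u hu v hv huv
    have e1 : insert u (insert v ((e.erase u).erase v)) = e := by
      rw [Finset.insert_erase (Finset.mem_erase.2 ⟨huv.symm, hv⟩), Finset.insert_erase hu]
    have := mark_eq hk hU hdeg hno (T := (e.erase u).erase v) huv (by simp) (by simp)
      (by rw [e1]; exact he)
    rwa [e1] at this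
  have hP : PairColoring H k (mark H) := by
    refine ⟨hk, hU, hV, hdeg, fun e he => ?_⟩
    obtain ⟨χ, hχ, hn⟩ := swapWithin_or_split hU hdeg he (hno e he)
    refine ⟨χ, fun u hu v hv huv => ?_, hn⟩
    rw [Bool.eq_iff_iff, hmark e he u hu v hv huv, hχ u hu v hv huv]
    cases χ u <;> cases χ v <;> simp
  obtain ⟨A, hA, hA', hkeven, hpar⟩ := hP.exists_parity
  set m := k / Nat.gcd k ℓ with hm
  have hmk : m < k := by
    refine lt_of_le_of_ne (Nat.div_le_self _ _) fun h => ?_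
    rw [h, ← Nat.not_even_iff_odd] at hodd
    exact hodd hkeven
  -- With `m` odd, omitting a vertex of `X` leaves the even level `m - 1`, and omitting one of `Y`
  -- leaves the odd level `m`. So, wherever `z` lies, exactly the `m` vertices of `X` are in the
  -- class opposite to `z`.
  obtain ⟨X, hXA, hX⟩ := Finset.exists_subset_card_eq (show m ≤ A.card by omega)
  obtain ⟨Y, hYA, hY⟩ := Finset.exists_subset_card_eq (show k - 1 - m ≤ Aᶜ.card by omega)
  have hYA' : ∀ y ∈ Y, y ∉ A := fun y hy => Finset.mem_compl.1 (hYA hy)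
  have hdis : Disjoint X Y := Finset.disjoint_left.2 fun a ha hb => hYA' a hb (hXA ha)
  have hS : (X ∪ Y).card + 1 = k := by rw [Finset.card_union_of_disjoint hdis]; omega
  have hlS : PairColoring.level A (X ∪ Y) = m := by
    have : (X ∪ Y) ∩ A = X := by
      ext a
      simp only [Finset.mem_inter, Finset.mem_union]
      exact ⟨fun h => h.1.resolve_right fun hY => hYA' a hY h.2, fun h => ⟨Or.inl h, hXA h⟩⟩
    rw [PairColoring.level, this, hX]
  have hd := hdeg _ hS
  obtain ⟨z, hz⟩ : (nbr H (X ∪ Y)).Nonempty := Finset.card_pos.1 (by omega)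
  have hzS := notMem_of_mem_nbr hU hS hz
  have he := mem_nbr.1 hz
  obtain ⟨χ, hχ, -⟩ := swapWithin_or_split hU hdeg he (hno _ he)
  have hzu : ∀ u ∈ X ∪ Y, (Even (PairColoring.level A ((X ∪ Y).erase u)) ↔ χ u ≠ χ z) := by
    intro u hu
    have hne : u ≠ z := fun e => hzS (e ▸ hu)
    have h1 := hmark _ he u (by simp [Finset.mem_union.1 hu]) z (by simp) hne
    have e1 : ((insert z (X ∪ Y)).erase u).erase z = (X ∪ Y).erase u := by
      rw [Finset.erase_insert_of_ne hne.symm, Finset.erase_insert]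
      exact fun h => hzS (Finset.mem_of_mem_erase h)
    rw [e1, hpar _ (by rw [Finset.card_erase_of_mem hu]; omega), decide_eq_true_eq,
      hχ u (Finset.mem_insert_of_mem hu) z (by simp) hne] at h1
    exact h1
  have hXz : ∀ u ∈ X, χ u ≠ χ z := by
    intro u hu
    have huS : u ∈ X ∪ Y := Finset.mem_union_left _ hu
    refine (hzu u huS).1 ?_
    have := PairColoring.level_erase_of_mem huS (hXA hu)
    rw [hlS] at this
    have hodd' := hodd
    rw [← this] at hodd'
    rw [← Nat.not_odd_iff_even]
    intro ho
    rw [Nat.odd_add_one] at hodd'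
    exact hodd' ho
  have hYz : ∀ u ∈ Y, χ u = χ z := by
    intro u hu
    have huS : u ∈ X ∪ Y := Finset.mem_union_right _ hu
    by_contra hcon
    have := (hzu u huS).2 hcon
    rw [PairColoring.level_erase_of_notMem (hYA' u hu), hlS] at this
    exact (Nat.not_even_iff_odd.2 hodd) this
  have hzX : z ∉ X := fun h => hzS (Finset.mem_union_left _ h)
  have hclass : ∀ a ∈ insert z (X ∪ Y), (a ∈ X ↔ χ a ≠ χ z) := by
    intro a ha
    rcases Finset.mem_insert.1 ha with rfl | ha
    · simp [hzX]
    · refine ⟨hXz a, fun h => ?_⟩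
      exact (Finset.mem_union.1 ha).resolve_right fun hY => h (hYz a hY)
  refine hwalk (exists_closedTightWalk_of_swapWithin (c := 17) he (hU _ he) (fun x => x ∈ X)
    (fun a ha b hb hab => ?_) (Or.inl ?_) hℓ (by norm_num))
  · rw [hclass a ha, hclass b hb] at hab
    by_cases hne : a = b
    · subst hne
      exact SwapWithin.refl a he (hU' _ he)
    · refine (((hχ a ha b hb hne).2 ?_).swapWithin hU' he hne).mono he (by norm_num)
      revert hab
      cases χ a <;> cases χ b <;> cases χ z <;> simp
  · rw [← hm, ← hX]
    congr 1
    ext a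
    simp only [Finset.mem_filter, Finset.mem_insert, Finset.mem_union]
    tauto

end HomThreshold

/-! ### Boxes in dense families of tuples. -/

section Box

/-- Union bound over pairs of indices. If two entries agree, overwriting the first by an arbitrary
vertex loses nothing, since the second still records it. -/
theorem card_not_injective_le {V : Type*} [Fintype V] [DecidableEq V] (t : ℕ) :
    Fintype.card V * (Finset.univ.filter fun w : Fin t → V => ¬ Function.Injective w).card
      ≤ t ^ 2 * Fintype.card V ^ t := by
  have hpair : ∀ p : Fin t × Fin t, p.1 ≠ p.2 →
      Fintype.card V * (Finset.univ.filter fun w : Fin t → V => w p.1 = w p.2).card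
        ≤ Fintype.card V ^ t := by
    intro p hp
    have h : ((Finset.univ : Finset V) ×ˢ
        (Finset.univ.filter fun w : Fin t → V => w p.1 = w p.2)).card
        ≤ (Finset.univ : Finset (Fin t → V)).card := by
      refine Finset.card_le_card_of_injOn (fun q => Function.update q.2 p.1 q.1)
        (fun _ _ => Finset.mem_univ _) ?_
      rintro ⟨a, w⟩ hw ⟨b, w'⟩ hw' heq
      simp only [Finset.coe_product, Set.mem_prod, Finset.mem_coe, Finset.mem_filter,
        Finset.mem_univ, true_and] at hw hw'
      have hab : a = b := by simpa using congrFun heq p.1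
      have hoff : ∀ i, i ≠ p.1 → w i = w' i := fun i hi => by
        simpa [Function.update_of_ne hi] using congrFun heq i
      have hww : w = w' := by
        funext i
        by_cases hi : i = p.1
        · rw [hi, hw, hw', hoff _ hp.symm]
        · exact hoff i hi
      rw [hab, hww]
    rwa [Finset.card_product, Finset.card_univ, Finset.card_univ, Fintype.card_pi_const] at h
  have hsub : (Finset.univ.filter fun w : Fin t → V => ¬ Function.Injective w) ⊆
      (Finset.univ.filter fun p : Fin t × Fin t => p.1 ≠ p.2).biUnion fun p =>
        Finset.univ.filter fun w : Fin t → V => w p.1 = w p.2 := by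
    intro w hw
    have hw := (Finset.mem_filter.1 hw).2
    simp only [Function.Injective] at hw
    push Not at hw
    obtain ⟨i, j, hij, hne⟩ := hw
    simp only [Finset.mem_biUnion, Finset.mem_filter, Finset.mem_univ, true_and]
    exact ⟨(i, j), hne, hij⟩
  calc _ ≤ Fintype.card V * ∑ p ∈ Finset.univ.filter fun p : Fin t × Fin t => p.1 ≠ p.2,
        (Finset.univ.filter fun w : Fin t → V => w p.1 = w p.2).card :=
        Nat.mul_le_mul_left _ ((Finset.card_le_card hsub).trans Finset.card_biUnion_le)
    _ ≤ ∑ p ∈ Finset.univ.filter fun p : Fin t × Fin t => p.1 ≠ p.2, Fintype.card V ^ t := by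
        rw [Finset.mul_sum]
        exact Finset.sum_le_sum fun p hp => hpair p (Finset.mem_filter.1 hp).2
    _ ≤ _ := by
        rw [Finset.sum_const, smul_eq_mul]
        refine Nat.mul_le_mul_right _ ((Finset.card_le_univ _).trans ?_)
        simp [sq]

/-- A dense set of `m`-tuples contains a box whose sides are sets of `t + 1` elements. -/
theorem exists_box (t m : ℕ) : ∀ c : ℝ, 0 < c → ∃ n₀ : ℕ, ∀ (V : Type) [Fintype V],
    n₀ ≤ Fintype.card V → ∀ A : Finset (Fin m → V),
    c * (Fintype.card V : ℝ) ^ m ≤ A.card →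
    ∃ b : Fin m → Fin (t + 1) → V, (∀ i, Function.Injective (b i)) ∧
      ∀ y : Fin m → Fin (t + 1), (fun i => b i (y i)) ∈ A := by
  classical
  induction m with
  | zero =>
    intro c hc
    refine ⟨0, fun V _ _ A hA => ⟨fun i => i.elim0, fun i => i.elim0, fun y => ?_⟩⟩
    have : 0 < A.card := by
      have : (0 : ℝ) < A.card := lt_of_lt_of_le (by simpa using hc) hA
      exact_mod_cast this
    obtain ⟨a, ha⟩ := Finset.card_pos.1 this
    rwa [Subsingleton.elim (fun i => _) a]
  | succ m ih =>
    intro c hc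
    obtain ⟨n₁, hn₁⟩ := ih (c ^ (t + 1) / 2) (by positivity)
    obtain ⟨n₂, hn₂⟩ := exists_nat_gt (2 * (t + 1 : ℝ) ^ 2 / c ^ (t + 1))
    refine ⟨max n₁ (max n₂ 1), fun V _ hV A hA => ?_⟩
    have hV1 : n₁ ≤ Fintype.card V := le_trans (le_max_left _ _) hV
    have hV2 : n₂ ≤ Fintype.card V := le_trans ((le_max_left _ _).trans (le_max_right _ _)) hV
    have hV3 : 1 ≤ Fintype.card V := le_trans ((le_max_right _ _).trans (le_max_right _ _)) hV
    set n : ℝ := (Fintype.card V : ℝ) with hn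
    have hn0 : 0 < n := by rw [hn]; exact_mod_cast hV3
    let D : (Fin m → V) → Finset V := fun y => Finset.univ.filter fun v => Fin.cons v y ∈ A
    let B : (Fin (t + 1) → V) → Finset (Fin m → V) := fun w =>
      Finset.univ.filter fun y => ∀ i, Fin.cons (w i) y ∈ A
    have hcA : (A.card : ℝ) ≤ ∑ y, ((D y).card : ℝ) := by
      have : A.card ≤ ∑ y, (D y).card := by
        rw [Finset.card_eq_sum_card_fiberwise (f := fun x => Fin.tail x) (t := Finset.univ)
          (fun _ _ => Finset.mem_univ _)]
        refine Finset.sum_le_sum fun y _ => ?_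
        refine Finset.card_le_card_of_injOn (fun x => x 0) ?_ ?_
        · intro x hx
          simp only [Finset.coe_filter, Set.mem_ofPred_eq] at hx
          simp only [D, Finset.coe_filter, Set.mem_ofPred_eq, Finset.mem_univ, true_and]
          rw [← hx.2, Fin.cons_self_tail]
          exact hx.1
        · intro x hx x' hx' h0
          simp only [Finset.coe_filter, Set.mem_ofPred_eq] at hx hx'
          rw [← Fin.cons_self_tail x, ← Fin.cons_self_tail x', hx.2, hx'.2]
          simp only [] at h0
          rw [h0]
      exact_mod_cast this
    have hcount : ∑ w, ((B w).card : ℝ) = ∑ y, ((D y).card : ℝ) ^ (t + 1) := by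
      have h := Finset.sum_card_bipartiteAbove_eq_sum_card_bipartiteBelow
        (s := (Finset.univ : Finset (Fin (t + 1) → V))) (t := (Finset.univ : Finset (Fin m → V)))
        (fun w y => ∀ i, Fin.cons (w i) y ∈ A)
      have h2 : ∀ y : Fin m → V, (Finset.bipartiteBelow (fun (w : Fin (t + 1) → V) y =>
          ∀ i, Fin.cons (w i) y ∈ A) Finset.univ y).card = (D y).card ^ (t + 1) := by
        intro y
        rw [← Fintype.card_piFinset_const]
        congr 1
        ext w
        simp [Finset.bipartiteBelow, D, Fintype.mem_piFinset]
      simp only [h2] at h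
      have h3 : ∑ w, (B w).card = ∑ y, (D y).card ^ (t + 1) := h
      exact_mod_cast h3
    -- Power mean inequality for the degrees of the tails `y`.
    have hjensen : c ^ (t + 1) * n ^ (m + (t + 1)) ≤ ∑ w, ((B w).card : ℝ) := by
      have hp := pow_sum_div_card_le_sum_pow (s := (Finset.univ : Finset (Fin m → V)))
        (f := fun y => ((D y).card : ℝ)) (fun _ _ => Nat.cast_nonneg _) t
      rw [hcount]
      refine le_trans ?_ hp
      have hcu : ((Finset.univ : Finset (Fin m → V)).card : ℝ) = n ^ m := by
        rw [Finset.card_univ, Fintype.card_pi_const, Nat.cast_pow]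
      rw [hcu, le_div_iff₀ (by positivity)]
      calc c ^ (t + 1) * n ^ (m + (t + 1)) * (n ^ m) ^ t = (c * n ^ (m + 1)) ^ (t + 1) := by
            rw [mul_pow, ← pow_mul, ← pow_mul]
            ring
        _ ≤ _ := pow_le_pow_left₀ (by positivity) (hA.trans hcA) _
    -- Non-injective `w` have density of order `1 / n`, so for large `n` they cannot account for
    -- half of the sum; the density drops to `c ^ (t + 1) / 2` for the induction.
    obtain ⟨w, hw, hBw⟩ : ∃ w : Fin (t + 1) → V, Function.Injective w ∧
        c ^ (t + 1) / 2 * n ^ m ≤ (B w).card := by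
      by_contra hcon
      push Not at hcon
      have hle : ∑ w, ((B w).card : ℝ) ≤
          ∑ w : Fin (t + 1) → V, (c ^ (t + 1) / 2 * n ^ m +
            if Function.Injective w then 0 else n ^ m) := by
        refine Finset.sum_le_sum fun w _ => ?_
        by_cases hw : Function.Injective w
        · simpa [hw] using (hcon w hw).le
        · have : ((B w).card : ℝ) ≤ n ^ m := by
            have := Finset.card_le_univ (B w)
            rw [Fintype.card_pi_const] at this
            rw [hn]
            exact_mod_cast this
          simp only [hw, if_false]
          have : 0 < c ^ (t + 1) / 2 * n ^ m := by positivity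
          linarith
      rw [Finset.sum_add_distrib, Finset.sum_const, Finset.card_univ, Fintype.card_pi_const,
        nsmul_eq_mul] at hle
      have e1 : ∑ w : Fin (t + 1) → V, (if Function.Injective w then (0 : ℝ) else n ^ m)
          = (Finset.univ.filter (fun w : Fin (t + 1) → V => ¬ Function.Injective w)).card * n ^ m := by
        rw [Finset.sum_ite, Finset.sum_const_zero, zero_add, Finset.sum_const, nsmul_eq_mul]
      rw [e1, Nat.cast_pow, ← hn] at hle
      have hni : n * (Finset.univ.filter
          (fun w : Fin (t + 1) → V => ¬ Function.Injective w)).card ≤ (t + 1 : ℝ) ^ 2 * n ^ (t + 1) := by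
        have := card_not_injective_le (V := V) (t + 1)
        rw [hn]
        exact_mod_cast this
      set K : ℝ := ((Finset.univ.filter
          (fun w : Fin (t + 1) → V => ¬ Function.Injective w)).card : ℝ)
      have h1 : c ^ (t + 1) * n ^ (m + (t + 1)) ≤
          n ^ (t + 1) * (c ^ (t + 1) / 2 * n ^ m) + K * n ^ m := hjensen.trans hle
      have h2 : c ^ (t + 1) / 2 * n ^ (t + 1) ≤ K := by
        have : c ^ (t + 1) / 2 * n ^ (t + 1) * n ^ m ≤ K * n ^ m := by
          rw [pow_add n m (t + 1)] at h1
          nlinarith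
        exact le_of_mul_le_mul_right this (by positivity)
      have h3 : c ^ (t + 1) / 2 * n * n ^ (t + 1) ≤ (t + 1 : ℝ) ^ 2 * n ^ (t + 1) := by
        refine le_trans ?_ hni
        nlinarith
      have h4 := le_of_mul_le_mul_right h3 (by positivity)
      have h5 : (n₂ : ℝ) ≤ n := by rw [hn]; exact_mod_cast hV2
      rw [div_lt_iff₀ (by positivity)] at hn₂
      have : (n₂ : ℝ) * c ^ (t + 1) ≤ n * c ^ (t + 1) :=
        mul_le_mul_of_nonneg_right h5 (by positivity)
      linarith
    obtain ⟨b, hb, hbB⟩ := hn₁ V hV1 (B w) hBw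
    refine ⟨Fin.cons w b, fun i => ?_, fun y => ?_⟩
    · refine Fin.cases ?_ (fun i => ?_) i
      · simpa using hw
      · simpa using hb i
    · have h := (Finset.mem_filter.1 (hbB (Fin.tail y))).2 (y 0)
      convert h using 1
      funext i
      refine Fin.cases ?_ (fun i => ?_) i
      · simp
      · simp [Fin.tail]

end Box

/-! ### Random tuples inherit codegree densities. -/

section Sampling

/-- The `k`-graph on the indices of a tuple `x` of vertices induced by `H`. -/
def pull {V : Type*} [DecidableEq V] (H : Set (Finset V)) (k : ℕ) {m : ℕ} (x : Fin m → V) :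
    Set (Finset (Fin m)) :=
  {e | e.card = k ∧ e.image x ∈ H}

open Classical in
/-- The tuples that agree with `y` on `S` and meet `N` in few indices outside `S` are rare. -/
theorem card_few_hits_le {V : Type*} [Fintype V] [DecidableEq V] {m : ℕ} (N : Finset V) (S : Finset (Fin m))
    (y : Fin m → V) {s q : ℝ} (hs : 0 ≤ s) :
    ((Finset.univ.filter fun x : Fin m → V => (∀ i ∈ S, x i = y i) ∧
        ((Finset.univ.filter fun i => i ∉ S ∧ x i ∈ N).card : ℝ) ≤ q).card : ℝ)
      ≤ Real.exp (s * q) *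
        ((Fintype.card V : ℝ) - (1 - Real.exp (-s)) * N.card) ^ (m - S.card) := by
  -- Exponential moment method: the product of the weights is `exp (-s * hits)` on tuples that agree
  -- with `y` on `S`, and its sum over all tuples factorises over the coordinates.
  let g : Fin m → V → ℝ := fun i v =>
    if i ∈ S then (if v = y i then 1 else 0) else (if v ∈ N then Real.exp (-s) else 1)
  have hg : ∀ i v, 0 ≤ g i v := by
    intro i v
    simp only [g]
    split_ifs <;> positivity
  have hsum : ∑ x : Fin m → V, ∏ i, g i (x i)
      = ((Fintype.card V : ℝ) - (1 - Real.exp (-s)) * N.card) ^ (m - S.card) := by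
    have h := Finset.prod_univ_sum (fun _ : Fin m => (Finset.univ : Finset V)) g
    rw [Fintype.piFinset_univ] at h
    rw [← h]
    have h1 : ∀ i ∈ S, ∑ v, g i v = 1 := by
      intro i hi
      simp [g, hi]
    have h2 : ∀ i, i ∉ S → ∑ v, g i v = (Fintype.card V : ℝ) - (1 - Real.exp (-s)) * N.card := by
      intro i hi
      simp only [g, hi, if_false]
      have : ∀ v : V, (if v ∈ N then Real.exp (-s) else 1)
          = 1 - (1 - Real.exp (-s)) * (if v ∈ N then 1 else 0) := by
        intro v; split_ifs <;> ring
      simp only [this]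
      rw [Finset.sum_sub_distrib, ← Finset.mul_sum]
      simp
    rw [← Finset.prod_compl_mul_prod S, Finset.prod_congr rfl h1, Finset.prod_const_one, mul_one,
      Finset.prod_congr rfl (fun i hi => h2 i (Finset.mem_compl.1 hi)), Finset.prod_const,
      Finset.card_compl, Fintype.card_fin]
  rw [← hsum, Finset.mul_sum, Finset.cast_card]
  set F := Finset.univ.filter fun x : Fin m → V => (∀ i ∈ S, x i = y i) ∧
        ((Finset.univ.filter fun i => i ∉ S ∧ x i ∈ N).card : ℝ) ≤ q
  have hsub : ∑ x ∈ F, Real.exp (s * q) * ∏ i, g i (x i)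
      ≤ ∑ x : Fin m → V, Real.exp (s * q) * ∏ i, g i (x i) :=
    Finset.sum_le_sum_of_subset_of_nonneg (Finset.subset_univ F)
      fun (x : Fin m → V) _ _ =>
        mul_nonneg (Real.exp_pos _).le (Finset.prod_nonneg fun i _ => hg i (x i))
  refine le_trans ?_ hsub
  refine Finset.sum_le_sum fun x hx => ?_
  obtain ⟨hxy, hxq⟩ := (Finset.mem_filter.1 hx).2
  have hprod : ∏ i, g i (x i)
      = Real.exp (-s * (Finset.univ.filter fun i => i ∉ S ∧ x i ∈ N).card) := by
    have : ∀ i, g i (x i) = if i ∉ S ∧ x i ∈ N then Real.exp (-s) else 1 := by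
      intro i
      simp only [g]
      by_cases hi : i ∈ S
      · simp [hi, hxy i hi]
      · simp [hi]
    simp only [this]
    rw [Finset.prod_ite, Finset.prod_const, Finset.prod_const_one, mul_one, ← Real.exp_nat_mul]
    congr 1
    ring
  rw [hprod, ← Real.exp_add]
  refine Real.one_le_exp ?_
  nlinarith

/-- The parameter `s = ε / 2`, with `exp (-s) ≤ 1 / (1 + s)`, gives a negative exponent independent
of `β`. -/
theorem exp_exponent_le {ε β : ℝ} (hε : 0 < ε) (hβ : β ≤ 1) (hβ0 : 0 ≤ β) :
    ε / 2 * β - (1 - Real.exp (-(ε / 2))) * (β + ε) ≤ -((ε / 2) ^ 2 / (1 + ε / 2)) := by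
  set s := ε / 2 with hs
  have hs0 : 0 < s := by positivity
  have h1 : Real.exp (-s) ≤ 1 / (1 + s) := by
    rw [Real.exp_neg, ← one_div]
    exact one_div_le_one_div_of_le (by positivity) (by linarith [Real.add_one_le_exp s])
  have h2 : s / (1 + s) ≤ 1 - Real.exp (-s) := by
    have : s / (1 + s) = 1 - 1 / (1 + s) := by field_simp; ring
    linarith
  have h3 : s / (1 + s) * (β + ε) ≤ (1 - Real.exp (-s)) * (β + ε) :=
    mul_le_mul_of_nonneg_right h2 (by positivity)
  have h4 : s * β - s / (1 + s) * (β + ε) ≤ -(s ^ 2 / (1 + s)) := by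
    have : s * β - s / (1 + s) * (β + ε) = (s * (β * s - ε)) / (1 + s) := by field_simp; ring
    rw [this, ← neg_div]
    refine div_le_div_of_nonneg_right ?_ (by positivity)
    have : ε = 2 * s := by rw [hs]; ring
    nlinarith
  linarith

/-- Only `m - j` coordinates are random; the factor `exp (2 * j)` compensates for the `j` fixed
ones, as each contributes at most `β + ε ≤ 2` to the exponent. -/
theorem exp_mul_pow_le {ε β n N : ℝ} {m j : ℕ} (hε : 0 < ε) (hε1 : ε ≤ 1) (hβ : β ≤ 1)
    (hβ0 : 0 ≤ β) (hn : 0 < n) (hN0 : 0 ≤ N) (hN : (β + ε) * n ≤ N) (hNn : N ≤ n) (hmj : j ≤ m) :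
    Real.exp (ε / 2 * (β * m)) * (n - (1 - Real.exp (-(ε / 2))) * N) ^ (m - j)
      ≤ Real.exp (2 * j) * Real.exp (-((ε / 2) ^ 2 / (1 + ε / 2))) ^ m * n ^ (m - j) := by
  have hexp := exp_exponent_le hε hβ hβ0
  have hE0 : 0 ≤ 1 - Real.exp (-(ε / 2)) := by
    have : Real.exp (-(ε / 2)) ≤ 1 := Real.exp_le_one_iff.2 (by linarith)
    linarith
  have hE1 : 1 - Real.exp (-(ε / 2)) ≤ 1 := by linarith [Real.exp_pos (-(ε / 2))]
  generalize 1 - Real.exp (-(ε / 2)) = E at *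
  generalize (ε / 2) ^ 2 / (1 + ε / 2) = a at *
  have hbase : n - E * N ≤ n * Real.exp (-(E * (β + ε))) := by
    have h1 : E * ((β + ε) * n) ≤ E * N := mul_le_mul_of_nonneg_left hN hE0
    have h2 : n * (1 - E * (β + ε)) ≤ n * Real.exp (-(E * (β + ε))) :=
      mul_le_mul_of_nonneg_left (by linarith [Real.add_one_le_exp (-(E * (β + ε)))]) hn.le
    linarith
  have hbase0 : 0 ≤ n - E * N := by
    have : E * N ≤ 1 * n := mul_le_mul hE1 hNn hN0 zero_le_one
    linarith
  calc _ ≤ Real.exp (ε / 2 * (β * m)) * (n * Real.exp (-(E * (β + ε)))) ^ (m - j) :=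
        mul_le_mul_of_nonneg_left (pow_le_pow_left₀ hbase0 hbase _) (Real.exp_pos _).le
    _ = n ^ (m - j) * Real.exp (ε / 2 * (β * m) + (m - j : ℕ) * (-(E * (β + ε)))) := by
        rw [mul_pow, ← Real.exp_nat_mul, Real.exp_add]; ring
    _ ≤ n ^ (m - j) * Real.exp (2 * j + m * (-a)) := by
        refine mul_le_mul_of_nonneg_left (Real.exp_le_exp.2 ?_) (by positivity)
        rw [Nat.cast_sub hmj]
        have h2 : (m : ℝ) * (ε / 2 * β - E * (β + ε)) ≤ m * (-a) :=
          mul_le_mul_of_nonneg_left hexp (Nat.cast_nonneg _)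
        have h3 : E * (β + ε) ≤ 1 * 2 := mul_le_mul hE1 (by linarith) (by linarith) zero_le_one
        have h4 : (j : ℝ) * (E * (β + ε)) ≤ j * (1 * 2) :=
          mul_le_mul_of_nonneg_left h3 (Nat.cast_nonneg _)
        linarith
    _ = _ := by rw [Real.exp_add, Real.exp_nat_mul]; ring

open Classical in
/-- The tuples that agree with `y` on a fixed `j`-set of indices and induce a low codegree there are
rare. -/
theorem card_low_codegree_le {V : Type*} [Fintype V] [DecidableEq V] {H : Set (Finset V)} {j m : ℕ}
    {ε β : ℝ} (hε : 0 < ε) (hε1 : ε ≤ 1) (hβ : β ≤ 1) (hβ0 : 0 ≤ β) (hV : 0 < Fintype.card V)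
    (hmj : j ≤ m)
    (hdeg : ∀ S : Finset V, S.card + 1 = j + 1 → (β + ε) * Fintype.card V ≤ (nbr H S).card)
    {S : Finset (Fin m)} (hS : S.card = j) (y : Fin m → V) :
    ((Finset.univ.filter fun x : Fin m → V => Function.Injective x ∧ (∀ i ∈ S, x i = y i) ∧
      ((nbr (pull H (j + 1) x) S).card : ℝ) < β * m).card : ℝ) ≤
      Real.exp (2 * j) * Real.exp (-((ε / 2) ^ 2 / (1 + ε / 2))) ^ m *
        (Fintype.card V : ℝ) ^ (m - j) := by
  by_cases hy : Set.InjOn y S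
  · have hcard : (S.image y).card + 1 = j + 1 := by rw [Finset.card_image_of_injOn hy, hS]
    have hsub : (Finset.univ.filter fun x : Fin m → V =>
        Function.Injective x ∧ (∀ i ∈ S, x i = y i) ∧
        ((nbr (pull H (j + 1) x) S).card : ℝ) < β * m) ⊆
        Finset.univ.filter fun x : Fin m → V => (∀ i ∈ S, x i = y i) ∧
        ((Finset.univ.filter fun i => i ∉ S ∧ x i ∈ nbr H (S.image y)).card : ℝ) ≤ β * m := by
      intro x hx
      obtain ⟨-, hxi, hxy, hlt⟩ := Finset.mem_filter.1 hx
      refine Finset.mem_filter.2 ⟨Finset.mem_univ _, hxy, le_trans ?_ hlt.le⟩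
      refine Nat.cast_le.2 (Finset.card_le_card fun i hi => ?_)
      obtain ⟨-, hiS, hiN⟩ := Finset.mem_filter.1 hi
      rw [mem_nbr]
      refine ⟨by rw [Finset.card_insert_of_notMem hiS, hS], ?_⟩
      rw [Finset.image_insert, Finset.image_congr (fun a ha => hxy a ha)]
      exact mem_nbr.1 hiN
    have h1 := card_few_hits_le (nbr H (S.image y)) S y (s := ε / 2) (q := β * m) (by positivity)
    rw [hS] at h1
    exact ((Nat.cast_le.2 (Finset.card_le_card hsub)).trans h1).trans
      (exp_mul_pow_le hε hε1 hβ hβ0 (Nat.cast_pos.2 hV) (Nat.cast_nonneg _) (hdeg _ hcard)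
        (Nat.cast_le.2 (Finset.card_le_univ _)) hmj)
  · rw [Finset.filter_eq_empty_iff.2, Finset.card_empty, Nat.cast_zero]
    · positivity
    · intro x _ hx
      exact hy fun a ha b hb hab => hx.1 (by rw [hx.2.1 a ha, hx.2.1 b hb, hab])

open Classical in
/-- The injective tuples for which all codegrees of the induced `k`-graph on the indices are at
least `q`. -/
noncomputable def goodTuples {V : Type*} [Fintype V] [DecidableEq V] (H : Set (Finset V)) (k m : ℕ)
    (q : ℝ) : Finset (Fin m → V) :=
  Finset.univ.filter fun x => Function.Injective x ∧
    ∀ S : Finset (Fin m), S.card + 1 = k → q ≤ (nbr (pull H k x) S).card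

/-- Most `m`-tuples of vertices inherit the codegree density up to `ε`. -/
theorem card_goodTuples_ge (j : ℕ) {ε : ℝ} (hε : 0 < ε) (hε1 : ε ≤ 1) :
    ∃ m₀ : ℕ, ∀ m, m₀ ≤ m → ∃ n₀ : ℕ, ∀ (V : Type) [Fintype V] [DecidableEq V],
      n₀ ≤ Fintype.card V → ∀ H : Set (Finset V), (∀ e ∈ H, e.card = j + 1) →
      ∀ β : ℝ, 0 ≤ β → β ≤ 1 →
      (∀ S : Finset V, S.card + 1 = j + 1 → (β + ε) * Fintype.card V ≤ (nbr H S).card) →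
      (Fintype.card V : ℝ) ^ m / 2 ≤ (goodTuples H (j + 1) m (β * m)).card := by
  classical
  set s := ε / 2 with hs
  have hs0 : 0 < s := by positivity
  set r := Real.exp (-(s ^ 2 / (1 + s))) with hr
  have hr1 : |r| < 1 := by
    rw [abs_of_pos (Real.exp_pos _), Real.exp_lt_one_iff, neg_lt_zero]
    positivity
  have hlim := (tendsto_pow_const_mul_const_pow_of_abs_lt_one j hr1).const_mul (Real.exp (2 * j))
  rw [mul_zero] at hlim
  obtain ⟨m₁, hm₁⟩ := eventually_atTop.1 (hlim.eventually (gt_mem_nhds (show (0 : ℝ) < 1 / 4 by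
    norm_num)))
  refine ⟨max m₁ j, fun m hm => ⟨4 * m ^ 2 + 1, fun V _ _ hV H hU β hβ0 hβ1 hdeg => ?_⟩⟩
  have hmm := hm₁ m (le_trans (le_max_left _ _) hm)
  have hmj : j ≤ m := le_trans (le_max_right _ _) hm
  set n : ℝ := (Fintype.card V : ℝ) with hn
  have hn0 : 0 < n := by rw [hn]; exact_mod_cast (by omega : 0 < Fintype.card V)
  obtain ⟨v₀⟩ : Nonempty V := Fintype.card_pos_iff.1 (by omega)
  let B : Finset (Fin m) → (Fin m → V) → Finset (Fin m → V) := fun S y =>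
    Finset.univ.filter fun x => Function.Injective x ∧ (∀ i ∈ S, x i = y i) ∧
      ((nbr (pull H (j + 1) x) S).card : ℝ) < β * m
  set C : ℝ := Real.exp (2 * j) * r ^ m * n ^ (m - j) with hC
  have hB : ∀ S y, S.card = j → ((B S y).card : ℝ) ≤ C := by
    intro S y hS
    exact card_low_codegree_le hε hε1 hβ1 hβ0 (by omega) hmj hdeg hS y
  -- Only the values of `y` on `S` matter, so `y` is set to `v₀` elsewhere and the union runs over
  -- `n ^ j` patterns per `S`. The total, at most `exp (2 * j) * m ^ j * r ^ m * n ^ m`, is below `n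
  -- ^ m / 4` for large `m`.
  set U := (Finset.powersetCard j (Finset.univ : Finset (Fin m))).biUnion fun S =>
    (Fintype.piFinset fun i => if i ∈ S then (Finset.univ : Finset V) else {v₀}).biUnion fun y =>
      B S y with hUdef
  have hUcard : (U.card : ℝ) ≤ n ^ m / 4 := by
    have h1 : (U.card : ℝ) ≤ ∑ S ∈ Finset.powersetCard j (Finset.univ : Finset (Fin m)),
        ∑ y ∈ (Fintype.piFinset fun i => if i ∈ S then (Finset.univ : Finset V) else {v₀}),
          ((B S y).card : ℝ) := by
      have : U.card ≤ ∑ S ∈ Finset.powersetCard j (Finset.univ : Finset (Fin m)),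
        ∑ y ∈ (Fintype.piFinset fun i => if i ∈ S then (Finset.univ : Finset V) else {v₀}),
          (B S y).card :=
        Finset.card_biUnion_le.trans (Finset.sum_le_sum fun S _ => Finset.card_biUnion_le)
      exact_mod_cast this
    have h2 : ∀ S ∈ Finset.powersetCard j (Finset.univ : Finset (Fin m)),
        ∑ y ∈ (Fintype.piFinset fun i => if i ∈ S then (Finset.univ : Finset V) else {v₀}),
          ((B S y).card : ℝ) ≤ n ^ j * C := by
      intro S hS
      have hS := (Finset.mem_powersetCard.1 hS).2
      refine le_trans (Finset.sum_le_sum fun y _ => hB S y hS) ?_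
      rw [Finset.sum_const, nsmul_eq_mul, Fintype.card_piFinset]
      refine mul_le_mul_of_nonneg_right (le_of_eq ?_) (by positivity)
      have : ∀ i, (if i ∈ S then (Finset.univ : Finset V) else {v₀}).card
          = if i ∈ S then Fintype.card V else 1 := by
        intro i; split_ifs <;> simp
      simp only [this]
      rw [Finset.prod_ite_mem, Finset.univ_inter, Finset.prod_const, hS, Nat.cast_pow]
    have h3 := h1.trans (Finset.sum_le_sum h2)
    rw [Finset.sum_const, nsmul_eq_mul, Finset.card_powersetCard, Finset.card_univ,
      Fintype.card_fin] at h3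
    have h4 : ((m.choose j : ℕ) : ℝ) ≤ (m : ℝ) ^ j := by
      exact_mod_cast Nat.choose_le_pow m j
    calc (U.card : ℝ) ≤ (m : ℝ) ^ j * (n ^ j * C) :=
          h3.trans (mul_le_mul_of_nonneg_right h4 (by positivity))
      _ = (Real.exp (2 * j) * ((m : ℝ) ^ j * r ^ m)) * n ^ m := by
          rw [hC]
          have : n ^ m = n ^ j * n ^ (m - j) := by rw [← pow_add]; congr 1; omega
          rw [this]; ring
      _ ≤ 1 / 4 * n ^ m := mul_le_mul_of_nonneg_right hmm.le (by positivity)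
      _ = n ^ m / 4 := by ring
  set K := Finset.univ.filter fun x : Fin m → V => ¬ Function.Injective x with hK
  have hKcard : (K.card : ℝ) ≤ n ^ m / 4 := by
    have h1 : n * K.card ≤ (m : ℝ) ^ 2 * n ^ m := by
      have := card_not_injective_le (V := V) m
      rw [hn]
      exact_mod_cast this
    have h2 : 4 * (m : ℝ) ^ 2 ≤ n := by
      rw [hn]
      exact_mod_cast (by omega : 4 * m ^ 2 ≤ Fintype.card V)
    have h3 : n * K.card ≤ n * (n ^ m / 4) := by
      have : 0 ≤ n ^ m := by positivity
      nlinarith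
    exact le_of_mul_le_mul_left h3 hn0
  have hcover : (Finset.univ : Finset (Fin m → V)) ⊆ goodTuples H (j + 1) m (β * m) ∪ (U ∪ K) := by
    intro x _
    by_cases hx : Function.Injective x
    · by_cases hg : x ∈ goodTuples H (j + 1) m (β * m)
      · exact Finset.mem_union_left _ hg
      · refine Finset.mem_union_right _ (Finset.mem_union_left _ ?_)
        simp only [goodTuples, Finset.mem_filter, Finset.mem_univ, true_and, hx] at hg
        push Not at hg
        obtain ⟨S, hS, hlt⟩ := hg
        rw [hUdef]
        simp only [Finset.mem_biUnion]
        refine ⟨S, Finset.mem_powersetCard.2 ⟨Finset.subset_univ _, by omega⟩,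
          fun i => if i ∈ S then x i else v₀, ?_, ?_⟩
        · rw [Fintype.mem_piFinset]
          intro i
          by_cases hi : i ∈ S <;> simp [hi]
        · refine Finset.mem_filter.2 ⟨Finset.mem_univ _, hx, fun i hi => by simp [hi], hlt⟩
    · exact Finset.mem_union_right _ (Finset.mem_union_right _ (by simp [hK, hx]))
  have htot : n ^ m ≤ (goodTuples H (j + 1) m (β * m)).card + ((U.card : ℝ) + K.card) := by
    have := (Finset.card_le_card hcover).trans
      ((Finset.card_union_le _ _).trans (Nat.add_le_add_left (Finset.card_union_le _ _) _))
    rw [Finset.card_univ, Fintype.card_pi_const] at this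
    rw [hn]
    exact_mod_cast this
  linarith

end Sampling

/-! ### Passage between hypergraphs and families of finite sets. -/

section Transfer

variable {n k ℓ : ℕ}

/-- The edges of a hypergraph on a finite vertex type, as finite sets. -/
def edgeFinsets (G : Hypergraph (Fin n)) : Set (Finset (Fin n)) :=
  {e | (e : Set (Fin n)) ∈ G.edgeSet}

/-- The hypergraph with all vertices and a given family of edges. -/
def ofFinsets (H : Set (Finset (Fin n))) : Hypergraph (Fin n) where
  vertexSet := Set.univ
  edgeSet := {e | ∃ e' ∈ H, (e' : Set (Fin n)) = e}
  subset_vertexSet_of_mem_edgeSet' := fun _ _ => Set.subset_univ _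

theorem edgeFinsets_ofFinsets (H : Set (Finset (Fin n))) : edgeFinsets (ofFinsets H) = H := by
  ext e
  constructor
  · rintro ⟨e', he', h⟩
    rwa [← Finset.coe_injective h]
  · exact fun h => ⟨e, h, rfl⟩

theorem card_of_mem_edgeFinsets {G : Hypergraph (Fin n)} (hG : IsUniform k G) {e : Finset (Fin n)}
    (he : e ∈ edgeFinsets G) : e.card = k := by
  have := hG _ he
  rw [Set.encard_coe_eq_coe_finsetCard] at this
  exact_mod_cast this

theorem isUniform_ofFinsets {H : Set (Finset (Fin n))} (hU : ∀ e ∈ H, e.card = k) :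
    IsUniform k (ofFinsets H) := by
  rintro e ⟨e', he', rfl⟩
  rw [Set.encard_coe_eq_coe_finsetCard, hU e' he']

theorem codegree_eq (G : Hypergraph (Fin n)) (S : Finset (Fin n)) :
    codegree G S = (nbr (edgeFinsets G) S).card := by
  rw [codegree, ← Set.ncard_coe_finset]
  congr 1
  ext v
  simp [mem_nbr, edgeFinsets]

theorem minCodegree_le {G : Hypergraph (Fin n)} (hG : G.vertexSet = Set.univ)
    {S : Finset (Fin n)} (hS : S.card + 1 = k) :
    minCodegree k G ≤ (nbr (edgeFinsets G) S).card := by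
  refine Nat.sInf_le ⟨S, by simp [hG], ?_, codegree_eq G S⟩
  rw [Set.encard_coe_eq_coe_finsetCard]
  exact_mod_cast hS

theorem le_minCodegree {G : Hypergraph (Fin n)} (hk : 0 < k) (hkn : k ≤ n)
    (hG : G.vertexSet = Set.univ) {d : ℕ}
    (h : ∀ S : Finset (Fin n), S.card + 1 = k → d ≤ (nbr (edgeFinsets G) S).card) :
    d ≤ minCodegree k G := by
  refine le_csInf ?_ ?_
  · obtain ⟨S, -, hS⟩ := Finset.exists_subset_card_eq
      (show k - 1 ≤ (Finset.univ : Finset (Fin n)).card by simp; omega)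
    refine ⟨_, S, by simp [hG], ?_, rfl⟩
    rw [Set.encard_coe_eq_coe_finsetCard, hS]
    exact_mod_cast (by omega : k - 1 + 1 = k)
  · rintro _ ⟨S, -, hS, rfl⟩
    obtain ⟨T, rfl⟩ := S.toFinite.exists_finset_coe
    rw [codegree_eq]
    rw [Set.encard_coe_eq_coe_finsetCard] at hS
    exact h T (by exact_mod_cast hS)

theorem containsCopy_iff {G : Hypergraph (Fin n)} (hG : G.vertexSet = Set.univ) :
    ContainsCopy (tightCycle k ℓ) G ↔
      ∃ φ : ZMod ℓ → Fin n, Function.Injective φ ∧ IsClosedTightWalk (edgeFinsets G) k ℓ φ := by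
  have key : ∀ (φ : ZMod ℓ → Fin n) (i : ZMod ℓ),
      φ '' ((fun j : ℕ => i + (j : ZMod ℓ)) '' {j | j < k})
        = (((Finset.range k).image (fun j : ℕ => φ (i + (j : ZMod ℓ))) : Finset (Fin n)) :
          Set (Fin n)) := by
    intro φ i
    ext v
    simp
  constructor
  · rintro ⟨φ, hφ, -, he⟩
    refine ⟨φ, Set.injOn_univ.1 hφ, fun i => ?_⟩
    have := he _ ⟨i, rfl⟩
    rwa [key] at this
  · rintro ⟨φ, hφ, he⟩
    refine ⟨φ, hφ.injOn, fun _ _ => by rw [hG]; trivial, ?_⟩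
    rintro _ ⟨i, rfl⟩
    rw [key]
    exact he i

theorem bddAbove_minCodegree {α : Type*} (k n : ℕ) (F : Hypergraph α) :
    BddAbove {d | ∃ G : Hypergraph (Fin n), G.vertexSet = Set.univ ∧ IsUniform k G ∧
      ¬ ContainsCopy F G ∧ minCodegree k G = d} := by
  refine ⟨n, ?_⟩
  rintro _ ⟨G, -, -, -, rfl⟩
  exact minCodegree_le_card G

/-- The codegree Turán number of the tight cycle is attained. -/
theorem exists_extremal (k ℓ n : ℕ) :
    ∃ H : Set (Finset (Fin n)), (∀ e ∈ H, e.card = k) ∧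
      (¬ ∃ φ : ZMod ℓ → Fin n, Function.Injective φ ∧ IsClosedTightWalk H k ℓ φ) ∧
      ∀ S : Finset (Fin n), S.card + 1 = k →
        codegreeTuranNumber k n (tightCycle k ℓ) ≤ (nbr H S).card := by
  have hne : {d | ∃ G : Hypergraph (Fin n), G.vertexSet = Set.univ ∧ IsUniform k G ∧
      ¬ ContainsCopy (tightCycle k ℓ) G ∧ minCodegree k G = d}.Nonempty := by
    refine ⟨_, ofFinsets ∅, rfl, isUniform_ofFinsets (by simp), ?_, rfl⟩
    rw [containsCopy_iff rfl, edgeFinsets_ofFinsets]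
    rintro ⟨φ, -, h⟩
    exact h 0
  obtain ⟨G, hV, hU, hF, hd⟩ := Nat.sSup_mem hne (bddAbove_minCodegree k n _)
  refine ⟨edgeFinsets G, fun e he => card_of_mem_edgeFinsets hU he, ?_, fun S hS => ?_⟩
  · rwa [containsCopy_iff hV] at hF
  · rw [codegreeTuranNumber, ← hd]
    exact minCodegree_le hV hS

theorem le_codegreeTuranNumber (hk : 0 < k) (hkn : k ≤ n) {H : Set (Finset (Fin n))}
    (hU : ∀ e ∈ H, e.card = k)
    (hF : ¬ ∃ φ : ZMod ℓ → Fin n, Function.Injective φ ∧ IsClosedTightWalk H k ℓ φ) {d : ℕ}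
    (hd : ∀ S : Finset (Fin n), S.card + 1 = k → d ≤ (nbr H S).card) :
    d ≤ codegreeTuranNumber k n (tightCycle k ℓ) := by
  have hle : d ≤ minCodegree k (ofFinsets H) :=
    le_minCodegree hk hkn rfl (by rwa [edgeFinsets_ofFinsets])
  refine hle.trans (le_csSup (bddAbove_minCodegree k n _)
    ⟨ofFinsets H, rfl, isUniform_ofFinsets hU, ?_, rfl⟩)
  rwa [containsCopy_iff rfl, edgeFinsets_ofFinsets]

theorem codegreeTuranNumber_le (k ℓ n : ℕ) :
    codegreeTuranNumber k n (tightCycle k ℓ) ≤ n := by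
  refine csSup_le' ?_
  rintro _ ⟨G, -, -, -, rfl⟩
  exact minCodegree_le_card G

theorem ratio_nonneg (k ℓ n : ℕ) :
    0 ≤ (codegreeTuranNumber k n (tightCycle k ℓ) : ℝ) / n := by positivity

theorem ratio_le_one (k ℓ n : ℕ) :
    (codegreeTuranNumber k n (tightCycle k ℓ) : ℝ) / n ≤ 1 :=
  div_le_one_of_le₀ (by exact_mod_cast codegreeTuranNumber_le k ℓ n) (Nat.cast_nonneg n)

end Transfer

/-! ### Existence of the limit and upper bounds for the density. -/

section Limit

/-- A bounded sequence converges if its late terms do not much exceed its earlier ones. -/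
theorem exists_tendsto_of_almost_antitone {a : ℕ → ℝ} (h0 : ∀ n, 0 ≤ a n) (h1 : ∀ n, a n ≤ 1)
    (h : ∀ ε : ℝ, 0 < ε → ε ≤ 1 → ∃ m₀, ∀ m, m₀ ≤ m → ∃ n₀, ∀ n, n₀ ≤ n → a n ≤ a m + ε) :
    ∃ L, Tendsto a atTop (𝓝 L) := by
  have hbu : IsBoundedUnder (· ≤ ·) atTop a := isBoundedUnder_of ⟨1, h1⟩
  have hbl : IsBoundedUnder (· ≥ ·) atTop a := isBoundedUnder_of ⟨0, h0⟩
  refine ⟨limsup a atTop, tendsto_of_le_liminf_of_limsup_le ?_ le_rfl hbu hbl⟩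
  refine le_of_forall_pos_le_add fun ε hε => ?_
  obtain ⟨m₀, hm₀⟩ := h (min ε 1) (by positivity) (min_le_right _ _)
  rw [← sub_le_iff_le_add]
  refine le_liminf_of_le hbu.isCoboundedUnder_ge ?_
  filter_upwards [eventually_ge_atTop m₀] with m hm
  obtain ⟨n₀, hn₀⟩ := hm₀ m hm
  have : limsup a atTop ≤ a m + min ε 1 := by
    refine limsup_le_of_le hbl.isCoboundedUnder_le ?_
    filter_upwards [eventually_ge_atTop n₀] with n hn using hn₀ n hn
  linarith [min_le_left ε 1]

/-- Pull an extremal family on `n` vertices back along a good injective `m`-tuple. The result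
contains no copy of the cycle and has codegrees at least `(d / n - ε) * m`. -/
theorem exists_tendsto_ratio {k : ℕ} (hk : 0 < k) (ℓ : ℕ) :
    ∃ L, Tendsto (fun n : ℕ => (codegreeTuranNumber k n (tightCycle k ℓ) : ℝ) / n) atTop (𝓝 L) := by
  refine exists_tendsto_of_almost_antitone (ratio_nonneg k ℓ) (ratio_le_one k ℓ) ?_
  intro ε hε hε1
  obtain ⟨j, rfl⟩ := Nat.exists_eq_succ_of_ne_zero hk.ne'
  obtain ⟨m₀, hm₀⟩ := card_goodTuples_ge j hε hε1
  refine ⟨max m₀ (j + 1), fun m hm => ?_⟩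
  obtain ⟨n₀, hn₀⟩ := hm₀ m ((le_max_left _ _).trans hm)
  have hjm : j + 1 ≤ m := (le_max_right _ _).trans hm
  have hm0 : (0 : ℝ) < m := by exact_mod_cast (by omega : 0 < m)
  refine ⟨max n₀ 1, fun n hn => ?_⟩
  have hn1 : 1 ≤ n := (le_max_right _ _).trans hn
  have hn0 : (0 : ℝ) < n := by exact_mod_cast hn1
  obtain ⟨H, hU, hF, hd⟩ := exists_extremal (j + 1) ℓ n
  set d := codegreeTuranNumber (j + 1) n (tightCycle (j + 1) ℓ)
  by_cases hβ : (d : ℝ) / n - ε < 0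
  · have := ratio_nonneg (j + 1) ℓ m
    simp only [Nat.succ_eq_add_one] at *
    linarith
  · push Not at hβ
    have hgood := hn₀ (Fin n) (by simpa using (le_max_left _ _).trans hn) H hU ((d : ℝ) / n - ε) hβ
      (by linarith [ratio_le_one (j + 1) ℓ n]) (fun S hS => by
        rw [sub_add_cancel, Fintype.card_fin, div_mul_cancel₀ _ hn0.ne']
        exact_mod_cast hd S hS)
    obtain ⟨x, hx⟩ : (goodTuples H (j + 1) m (((d : ℝ) / n - ε) * m)).Nonempty := by
      rw [← Finset.card_pos]
      have : (0 : ℝ) < (goodTuples H (j + 1) m (((d : ℝ) / n - ε) * m)).card := by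
        refine lt_of_lt_of_le ?_ hgood
        rw [Fintype.card_fin]
        positivity
      exact_mod_cast this
    obtain ⟨-, hxi, hxd⟩ := Finset.mem_filter.1 hx
    have hle : ⌈((d : ℝ) / n - ε) * m⌉₊ ≤ codegreeTuranNumber (j + 1) m (tightCycle (j + 1) ℓ) := by
      refine le_codegreeTuranNumber (H := pull H (j + 1) x) (by omega) hjm (fun e he => he.1) ?_ ?_
      · rintro ⟨φ, hφ, hw⟩
        refine hF ⟨x ∘ φ, hxi.comp hφ, fun i => ?_⟩
        have := (hw i).2
        rwa [Finset.image_image] at this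
      · intro S hS
        exact Nat.ceil_le.2 (hxd S hS)
    have h2 : ((d : ℝ) / n - ε) * m ≤ codegreeTuranNumber (j + 1) m (tightCycle (j + 1) ℓ) :=
      (Nat.le_ceil _).trans (by exact_mod_cast hle)
    rw [← le_div_iff₀ hm0] at h2
    simp only [Nat.succ_eq_add_one]
    linarith

theorem tendsto_ratio {k : ℕ} (hk : 0 < k) (ℓ : ℕ) :
    Tendsto (fun n : ℕ => (codegreeTuranNumber k n (tightCycle k ℓ) : ℝ) / n) atTop
      (𝓝 (codegreeTuranDensity k (tightCycle k ℓ))) := by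
  obtain ⟨L, hL⟩ := exists_tendsto_ratio hk ℓ
  rwa [codegreeTuranDensity, hL.limUnder_eq]

/-- A family of closed tight walks that fill a box of vertices contains an injective one. -/
theorem exists_injective_walk_of_box {V : Type*} [DecidableEq V] {H : Set (Finset V)} {k ℓ m : ℕ}
    [NeZero ℓ] {ψ : ZMod ℓ → Fin m} {b : Fin m → Fin (ℓ + 1) → V}
    (hb : ∀ i, Function.Injective (b i))
    (h : ∀ y : Fin m → Fin (ℓ + 1), IsClosedTightWalk (pull H k fun i => b i (y i)) k ℓ ψ) :
    ∃ φ : ZMod ℓ → V, Function.Injective φ ∧ IsClosedTightWalk H k ℓ φ := by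
  classical
  -- Hall's theorem: each of the `ℓ` positions has `ℓ + 1` candidates, so distinct representatives
  -- exist.
  obtain ⟨φ, hφ, hφb⟩ := (Finset.all_card_le_biUnion_card_iff_exists_injective
    (fun j : ZMod ℓ => Finset.univ.image (b (ψ j)))).1 (by
      intro s
      rcases s.eq_empty_or_nonempty with rfl | ⟨j, hj⟩
      · simp
      · have h1 : (Finset.univ.image (b (ψ j))).card = ℓ + 1 := by
          rw [Finset.card_image_of_injective _ (hb _)]; simp
        have h2 := Finset.card_le_card
          (Finset.subset_biUnion_of_mem (fun j : ZMod ℓ => Finset.univ.image (b (ψ j))) hj)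
        have h3 : s.card ≤ ℓ := by simpa [ZMod.card] using Finset.card_le_univ s
        omega)
  simp only [Finset.mem_image, Finset.mem_univ, true_and] at hφb
  choose y hy using hφb
  refine ⟨φ, hφ, fun i => ?_⟩
  have hinj : Set.InjOn (fun a : ℕ => ψ (i + (a : ZMod ℓ))) (Finset.range k) := by
    rw [← Finset.card_image_iff, Finset.card_range]
    exact (h (fun _ => 0) i).1
  -- Within one window `ψ` is injective, so the representatives chosen there come from a single
  -- point of the box; sides not visited get the default 0.
  let Y : Fin m → Fin (ℓ + 1) := fun q =>
    if hq : ∃ a : ℕ, a ∈ Finset.range k ∧ ψ (i + (a : ZMod ℓ)) = q then y (i + (hq.choose : ZMod ℓ))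
    else 0
  have hY : ∀ a ∈ Finset.range k, b (ψ (i + (a : ZMod ℓ))) (Y (ψ (i + (a : ZMod ℓ))))
      = φ (i + (a : ZMod ℓ)) := by
    intro a ha
    have hq : ∃ a' : ℕ, a' ∈ Finset.range k ∧ ψ (i + (a' : ZMod ℓ)) = ψ (i + (a : ZMod ℓ)) :=
      ⟨a, ha, rfl⟩
    have hca : hq.choose = a := hinj hq.choose_spec.1 ha hq.choose_spec.2
    have : Y (ψ (i + (a : ZMod ℓ))) = y (i + (a : ZMod ℓ)) := by
      simp only [Y, dif_pos hq, hca]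
    rw [this, hy]
  have := (h Y i).2
  rw [Finset.image_image] at this
  rwa [Finset.image_congr (f := (fun i => b i (Y i)) ∘ fun j : ℕ => ψ (i + (j : ZMod ℓ)))
    (g := fun a : ℕ => φ (i + (a : ZMod ℓ))) (fun a ha => hY a ha)] at this

/-- If codegrees above `θ` times the order force closed tight walks, then `θ` bounds the codegree
Turán density of the tight cycle. -/
theorem codegreeTuranDensity_le {k ℓ : ℕ} (hk : 0 < k) (hℓ : 0 < ℓ) {θ : ℝ} (hθ0 : 0 ≤ θ)
    (hθ : θ ≤ 1 / 2) (n₁ : ℕ)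
    (h : ∀ m : ℕ, n₁ ≤ m → ∀ H : Set (Finset (Fin m)), (∀ e ∈ H, e.card = k) →
      (∀ S : Finset (Fin m), S.card + 1 = k → θ * m < (nbr H S).card) →
      ∃ φ : ZMod ℓ → Fin m, IsClosedTightWalk H k ℓ φ) :
    codegreeTuranDensity k (tightCycle k ℓ) ≤ θ := by
  classical
  have : NeZero ℓ := ⟨hℓ.ne'⟩
  refine le_of_forall_pos_le_add fun ε' hε' => ?_
  obtain ⟨ε, hε, hεε, hε1⟩ : ∃ ε : ℝ, 0 < ε ∧ 2 * ε ≤ ε' ∧ ε ≤ 1 / 2 :=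
    ⟨min (ε' / 2) (1 / 2), by positivity, by linarith [min_le_left (ε' / 2) (1 / 2)],
      min_le_right _ _⟩
  refine le_trans ?_ (show θ + 2 * ε ≤ θ + ε' by linarith)
  refine le_of_tendsto (tendsto_ratio hk ℓ) ?_
  obtain ⟨j, rfl⟩ := Nat.exists_eq_succ_of_ne_zero hk.ne'
  obtain ⟨m₀, hm₀⟩ := card_goodTuples_ge j hε (by linarith)
  set m := max m₀ (max n₁ 1) with hm
  have hm1 : n₁ ≤ m := (le_max_left _ _).trans (le_max_right _ _)
  have hm2 : 1 ≤ m := (le_max_right _ _).trans (le_max_right _ _)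
  have hm0 : (0 : ℝ) < m := by exact_mod_cast hm2
  obtain ⟨n₀, hn₀⟩ := hm₀ m (le_max_left _ _)
  -- At least half of all `m`-tuples are good and there are `m ^ ℓ` candidate walks, so some walk is
  -- carried by this proportion of tuples.
  obtain ⟨n₂, hn₂⟩ := exists_box ℓ m (1 / (2 * (m : ℝ) ^ ℓ)) (by positivity)
  filter_upwards [eventually_ge_atTop (max n₀ (max n₂ 1))] with n hn
  have hnn₀ : n₀ ≤ n := (le_max_left _ _).trans hn
  have hnn₂ : n₂ ≤ n := ((le_max_left _ _).trans (le_max_right _ _)).trans hn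
  have hn0 : (0 : ℝ) < n := by
    exact_mod_cast ((le_max_right _ _).trans (le_max_right _ _)).trans hn
  obtain ⟨H, hU, hF, hd⟩ := exists_extremal (j + 1) ℓ n
  by_contra hcon
  push Not at hcon
  have hgood := hn₀ (Fin n) (by simpa using hnn₀) H hU (θ + ε) (by linarith) (by linarith)
    (fun S hS => by
      have h1 : (codegreeTuranNumber (j + 1) n (tightCycle (j + 1) ℓ) : ℝ) ≤ (nbr H S).card := by
        exact_mod_cast hd S hS
      rw [lt_div_iff₀ hn0] at hcon
      rw [Fintype.card_fin]
      refine le_trans ?_ h1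
      have : θ + ε + ε = θ + 2 * ε := by ring
      rw [this]
      exact hcon.le)
  let A : (ZMod ℓ → Fin m) → Finset (Fin m → Fin n) := fun ψ =>
    Finset.univ.filter fun x => IsClosedTightWalk (pull H (j + 1) x) (j + 1) ℓ ψ
  have hsub : goodTuples H (j + 1) m ((θ + ε) * m) ⊆ Finset.univ.biUnion A := by
    intro x hx
    obtain ⟨-, -, hxd⟩ := Finset.mem_filter.1 hx
    obtain ⟨ψ, hψ⟩ := h m hm1 (pull H (j + 1) x) (fun e he => he.1) (fun S hS => by
      refine lt_of_lt_of_le ?_ (hxd S hS)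
      nlinarith)
    exact Finset.mem_biUnion.2 ⟨ψ, Finset.mem_univ _, Finset.mem_filter.2 ⟨Finset.mem_univ _, hψ⟩⟩
  have hsum : (n : ℝ) ^ m / 2 ≤ ∑ ψ, ((A ψ).card : ℝ) := by
    rw [Fintype.card_fin] at hgood
    refine hgood.trans ?_
    exact_mod_cast (Finset.card_le_card hsub).trans Finset.card_biUnion_le
  obtain ⟨ψ, hψ⟩ : ∃ ψ, 1 / (2 * (m : ℝ) ^ ℓ) * (n : ℝ) ^ m ≤ (A ψ).card := by
    by_contra hno
    push Not at hno
    have hne : (Finset.univ : Finset (ZMod ℓ → Fin m)).Nonempty :=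
      ⟨fun _ => ⟨0, hm2⟩, Finset.mem_univ _⟩
    have hlt := Finset.sum_lt_sum_of_nonempty hne fun ψ _ => hno ψ
    rw [Finset.sum_const, Finset.card_univ, Fintype.card_fun, ZMod.card, Fintype.card_fin, nsmul_eq_mul] at hlt
    have : ((m ^ ℓ : ℕ) : ℝ) * (1 / (2 * (m : ℝ) ^ ℓ) * (n : ℝ) ^ m) = (n : ℝ) ^ m / 2 := by
      push_cast
      field_simp
    linarith
  obtain ⟨b, hb, hbA⟩ := hn₂ (Fin n) (by simpa using hnn₂) (A ψ) (by simpa using hψ)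
  exact hF (exists_injective_walk_of_box hb fun y => (Finset.mem_filter.1 (hbA y)).2)

theorem codegreeTuranDensity_le_half {k ℓ : ℕ} (hk : 0 < k) (hℓ : 17 * k * k ≤ ℓ) :
    codegreeTuranDensity k (tightCycle k ℓ) ≤ 1 / 2 := by
  have hℓ0 : 0 < ℓ := lt_of_lt_of_le (by positivity) hℓ
  refine codegreeTuranDensity_le hk hℓ0 (by norm_num) le_rfl k fun m hm H hU hd => ?_
  refine exists_closedTightWalk_of_half hk hU (by simpa using hm) (fun S hS => ?_) hℓ
  have := hd S hS
  rw [Fintype.card_fin]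
  have h2 : (m : ℝ) < 2 * (nbr H S).card := by linarith
  exact_mod_cast h2

theorem codegreeTuranDensity_le_third {k ℓ : ℕ} (hk : 3 ≤ k) (hℓ : 17 * k * k ≤ ℓ)
    (hodd : Odd (k / Nat.gcd k ℓ)) : codegreeTuranDensity k (tightCycle k ℓ) ≤ 1 / 3 := by
  have hℓ0 : 0 < ℓ := lt_of_lt_of_le (by positivity) hℓ
  refine codegreeTuranDensity_le (by omega) hℓ0 (by norm_num) (by norm_num) (6 * k)
    fun m hm H hU hd => ?_
  refine exists_closedTightWalk_of_third hk hU (by simpa using hm) (fun S hS => ?_) hℓ hodd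
  have := hd S hS
  rw [Fintype.card_fin]
  have h2 : (m : ℝ) < 3 * (nbr H S).card := by linarith
  exact_mod_cast h2

end Limit

/-! ### Lower bounds from colour patterns. -/

section LowerBound

/-- Densities are bounded below by linear lower bounds for the codegree Turán numbers. -/
theorem le_codegreeTuranDensity {k ℓ q : ℕ} (hk : 0 < k) (hq : 0 < q) (C n₀ : ℕ)
    (h : ∀ n, n₀ ≤ n → n / q ≤ codegreeTuranNumber k n (tightCycle k ℓ) + C) :
    1 / (q : ℝ) ≤ codegreeTuranDensity k (tightCycle k ℓ) := by
  have h1 : Tendsto (fun n : ℕ => 1 / (q : ℝ) - (C + 1 : ℝ) / n) atTop (𝓝 (1 / (q : ℝ) - 0)) :=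
    tendsto_const_nhds.sub (tendsto_const_div_atTop_nhds_zero_nat _)
  rw [sub_zero] at h1
  refine le_of_tendsto_of_tendsto h1 (tendsto_ratio hk ℓ) ?_
  filter_upwards [eventually_ge_atTop (max n₀ 1)] with n hn
  have hn0 : (0 : ℝ) < n := by exact_mod_cast (le_max_right _ _).trans hn
  have hq0 : (0 : ℝ) < q := by exact_mod_cast hq
  have h2 := h n ((le_max_left _ _).trans hn)
  have h3 : n ≤ q * (codegreeTuranNumber k n (tightCycle k ℓ) + C + 1) := by
    have := Nat.lt_mul_div_succ n hq
    exact this.le.trans (Nat.mul_le_mul_left _ (by omega))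
  have h4 : (n : ℝ) ≤ q * (codegreeTuranNumber k n (tightCycle k ℓ) + C + 1) := by exact_mod_cast h3
  rw [le_div_iff₀ hn0, sub_mul, div_mul_cancel₀ _ hn0.ne', one_div, sub_le_iff_le_add,
    inv_mul_le_iff₀ hq0]
  linarith

/-- The increment of a vector in one coordinate. -/
def bump {q : ℕ} (y : ZMod q → ℕ) (c : ZMod q) : ZMod q → ℕ := Function.update y c (y c + 1)

theorem bump_apply {q : ℕ} (y : ZMod q → ℕ) (c a : ZMod q) :
    bump y c a = y a + if c = a then 1 else 0 := by
  by_cases h : c = a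
  · subst h; simp [bump]
  · simp [bump, h, Function.update_of_ne (Ne.symm h)]

theorem div_le_card_filter_natCast (n q : ℕ) [NeZero q] (c : ZMod q) :
    n / q ≤ (Finset.univ.filter fun v : Fin n => ((v : ℕ) : ZMod q) = c).card := by
  have hq : 0 < q := Nat.pos_of_ne_zero (NeZero.ne q)
  have hc := ZMod.val_lt c
  have hlt : ∀ t ∈ Finset.range (n / q), c.val + q * t < n := by
    intro t ht
    have ht := Finset.mem_range.1 ht
    have h1 : q * (t + 1) ≤ q * (n / q) := Nat.mul_le_mul_left _ ht
    have h2 := Nat.mul_div_le n q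
    rw [mul_add] at h1
    omega
  have h := Finset.card_le_card_of_injOn (s := (Finset.range (n / q)).attach)
    (t := Finset.univ.filter fun v : Fin n => ((v : ℕ) : ZMod q) = c)
    (fun t => (⟨c.val + q * t.1, hlt t.1 t.2⟩ : Fin n)) (by intro t _; simp) (by
      intro a _ b _ hab
      have : c.val + q * a.1 = c.val + q * b.1 := congrArg Fin.val hab
      exact Subtype.ext (Nat.eq_of_mul_eq_mul_left hq (by omega)))
  simpa using h

/-- The number of positions of colour `c` in the window of length `k` starting at `i`. -/
def windowCount {q ℓ : ℕ} (k : ℕ) (g : ZMod ℓ → ZMod q) (i : ZMod ℓ) (c : ZMod q) : ℕ :=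
  ((Finset.range k).filter fun j : ℕ => g (i + (j : ZMod ℓ)) = c).card

/-- A family of colour patterns that extends every pattern of size `k - 1`, but that does not
contain all the window patterns of any cyclic colouring, gives a lower bound for the density. -/
theorem one_div_le_codegreeTuranDensity {k ℓ q : ℕ} [NeZero q] (hk : 0 < k)
    (P : (ZMod q → ℕ) → Prop) (hext : ∀ y : ZMod q → ℕ, ∑ c, y c + 1 = k → ∃ c, P (bump y c))
    (hfree : ∀ g : ZMod ℓ → ZMod q, ∃ i, ¬ P (windowCount k g i)) :
    1 / (q : ℝ) ≤ codegreeTuranDensity k (tightCycle k ℓ) := by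
  have hq : 0 < q := Nat.pos_of_ne_zero (NeZero.ne q)
  refine le_codegreeTuranDensity hk hq k k fun n hn => ?_
  -- Residue classes have at least `n / q` vertices; a set `S` is extended by all vertices of a
  -- suitable colour outside `S`, which loses at most `k`.
  let κ : Fin n → ZMod q := fun v => ((v : ℕ) : ZMod q)
  let τ : Finset (Fin n) → ZMod q → ℕ := fun e c => (e.filter fun v => κ v = c).card
  let H : Set (Finset (Fin n)) := {e | e.card = k ∧ P (τ e)}
  have hle : n / q - k ≤ codegreeTuranNumber k n (tightCycle k ℓ) := by
    refine le_codegreeTuranNumber (H := H) hk hn (fun e he => he.1) ?_ fun S hS => ?_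
    · rintro ⟨φ, hφ, hw⟩
      obtain ⟨i, hi⟩ := hfree (κ ∘ φ)
      refine hi ?_
      have hinj : Set.InjOn (fun j : ℕ => φ (i + (j : ZMod ℓ))) (Finset.range k) := by
        rw [← Finset.card_image_iff, Finset.card_range]
        exact (hw i).1
      convert (hw i).2 using 1
      funext c
      simp only [windowCount, τ]
      rw [Finset.filter_image, Finset.card_image_of_injOn (hinj.mono (by
        intro a ha; exact Finset.mem_of_mem_filter _ ha))]
      rfl
    · have hsum : ∑ c, τ S c + 1 = k := by
        rw [← hS, Finset.card_eq_sum_card_fiberwise (f := κ) (t := Finset.univ)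
          (fun _ _ => Finset.mem_univ _)]
      obtain ⟨c, hc⟩ := hext (τ S) hsum
      have hsub : (Finset.univ.filter fun v : Fin n => κ v = c) \ S ⊆ nbr H S := by
        intro v hv
        obtain ⟨hv1, hvS⟩ := Finset.mem_sdiff.1 hv
        have hvc := (Finset.mem_filter.1 hv1).2
        rw [mem_nbr]
        refine ⟨by rw [Finset.card_insert_of_notMem hvS, hS], ?_⟩
        convert hc using 1
        funext a
        rw [bump_apply]
        simp only [τ, Finset.filter_insert, hvc]
        split_ifs with h
        · rw [Finset.card_insert_of_notMem fun h => hvS (Finset.mem_of_mem_filter _ h)]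
        · rfl
      have h1 := div_le_card_filter_natCast n q c
      have h2 := Finset.le_card_sdiff S (Finset.univ.filter fun v : Fin n => κ v = c)
      have h3 := Finset.card_le_card hsub
      have h4 : n / q ≤ (Finset.univ.filter fun v : Fin n => κ v = c).card := h1
      omega
  omega

theorem periodic_gcd {α : Type*} {k ℓ : ℕ} {g : ZMod ℓ → α} (h : Function.Periodic g (k : ZMod ℓ)) :
    Function.Periodic g ((Nat.gcd k ℓ : ℕ) : ZMod ℓ) := by
  have h1 : ((Nat.gcd k ℓ : ℕ) : ZMod ℓ) = (Nat.gcdA k ℓ) • (k : ZMod ℓ) := by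
    have := congrArg (Int.cast : ℤ → ZMod ℓ) (Nat.gcd_eq_gcd_ab k ℓ)
    push_cast at this
    rw [this, zsmul_eq_mul]
    simp [mul_comm]
  rw [h1]
  exact h.zsmul _

theorem sum_range_mul_of_periodic {ℓ d : ℕ} {f : ZMod ℓ → ℕ}
    (h : Function.Periodic f (d : ZMod ℓ)) (i : ZMod ℓ) (m : ℕ) :
    ∑ j ∈ Finset.range (d * m), f (i + (j : ZMod ℓ))
      = m * ∑ j ∈ Finset.range d, f (i + (j : ZMod ℓ)) := by
  induction m with
  | zero => simp
  | succ m ih =>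
    rw [Nat.mul_succ, Finset.sum_range_add, ih, add_mul, one_mul]
    congr 1
    refine Finset.sum_congr rfl fun j _ => ?_
    have := (h.nat_mul m) (i + (j : ZMod ℓ))
    rw [← this]
    congr 1
    push_cast
    ring

theorem windowCount_eq_sum {q ℓ : ℕ} (k : ℕ) (g : ZMod ℓ → ZMod q) (i : ZMod ℓ) (c : ZMod q) :
    windowCount k g i c
      = ∑ j ∈ Finset.range k, (if g (i + (j : ZMod ℓ)) = c then 1 else 0) := by
  rw [windowCount, Finset.card_filter]

/-- A labelled family of colour patterns in which the label of a pattern is a colour whose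
multiplicity does not change, and is not divisible by `k / gcd (k, ℓ)`, along the moves within the
family. -/
theorem one_div_le_of_labelled {k ℓ q : ℕ} [NeZero q] [NeZero ℓ] (hk : 0 < k)
    (Q : ZMod q → (ZMod q → ℕ) → Prop)
    (hext : ∀ y : ZMod q → ℕ, ∑ c, y c + 1 = k → ∃ c a, Q a (bump y c))
    (hdiv : ∀ a x, Q a x → ¬ k / Nat.gcd k ℓ ∣ x a)
    (hmove : ∀ y b c a a', b ≠ c → Q a (bump y b) → Q a' (bump y c) →
      a ≠ b ∧ a ≠ c ∧ Q a (bump y c)) :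
    1 / (q : ℝ) ≤ codegreeTuranDensity k (tightCycle k ℓ) := by
  refine one_div_le_codegreeTuranDensity hk (fun x => ∃ a, Q a x)
    (fun y hy => hext y hy) fun g => ?_
  by_contra hcon
  push Not at hcon
  obtain ⟨k, rfl⟩ := Nat.exists_eq_succ_of_ne_zero hk.ne'
  have hshift : ∀ (i : ZMod ℓ) (j : ℕ), i + ((j + 1 : ℕ) : ZMod ℓ) = i + 1 + (j : ZMod ℓ) := by
    intro i j
    push_cast
    ring
  -- Consecutive windows share all but one position each, so they are two bumps of one pattern and
  -- `hmove` applies.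
  have hhead : ∀ i, windowCount (k + 1) g i = bump (windowCount k g (i + 1)) (g i) := by
    intro i
    funext c
    rw [bump_apply, windowCount_eq_sum, windowCount_eq_sum, Finset.sum_range_succ']
    simp only [hshift, Nat.cast_zero, add_zero]
  have htail : ∀ i, windowCount (k + 1) g (i + 1)
      = bump (windowCount k g (i + 1)) (g (i + (k + 1 : ℕ))) := by
    intro i
    funext c
    rw [bump_apply, windowCount_eq_sum, windowCount_eq_sum, Finset.sum_range_succ, hshift]
  obtain ⟨a, ha⟩ := hcon 0
  have hstep : ∀ i, Q a (windowCount (k + 1) g i) →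
      Q a (windowCount (k + 1) g (i + 1)) ∧ (g (i + (k + 1 : ℕ)) = a ↔ g i = a) := by
    intro i hi
    by_cases heq : g i = g (i + (k + 1 : ℕ))
    · rw [htail, ← heq, ← hhead]
      exact ⟨hi, Iff.rfl⟩
    · obtain ⟨a', ha'⟩ := hcon (i + 1)
      rw [hhead] at hi
      rw [htail] at ha' ⊢
      obtain ⟨h1, h2, h3⟩ := hmove _ _ _ _ _ heq hi ha'
      exact ⟨h3, iff_of_false h2.symm h1.symm⟩
  have hall : ∀ t : ℕ, Q a (windowCount (k + 1) g (t : ZMod ℓ)) := by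
    intro t
    induction t with
    | zero => simpa using ha
    | succ t ih => simpa using (hstep _ ih).1
  have hall' : ∀ i : ZMod ℓ, Q a (windowCount (k + 1) g i) := fun i => by
    simpa using hall i.val
  -- The label `a` persists, and a colour entering a window is `a` exactly when the colour leaving
  -- it is `a`. So the positions of `a` are periodic, and `k / gcd` divides their number in a
  -- window.
  have hper : Function.Periodic (fun i => if g i = a then 1 else 0) ((k + 1 : ℕ) : ZMod ℓ) := by
    intro i
    simp only [(hstep i (hall' i)).2]
  have hs := sum_range_mul_of_periodic (periodic_gcd hper) 0 ((k + 1) / Nat.gcd (k + 1) ℓ)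
  rw [Nat.mul_div_cancel' (Nat.gcd_dvd_left _ _), ← windowCount_eq_sum] at hs
  refine hdiv a _ (hall' 0) ?_
  show _ ∣ windowCount (k + 1) g 0 a
  rw [hs]
  exact Dvd.intro _ rfl

/-- The density is at least `1 / p` for every prime factor `p` of `k / gcd (k, ℓ)`. -/
theorem one_div_prime_le {k ℓ p : ℕ} (hk : 0 < k) (hℓ : 0 < ℓ) (hp : p.Prime)
    (hpd : p ∣ k / Nat.gcd k ℓ) : 1 / (p : ℝ) ≤ codegreeTuranDensity k (tightCycle k ℓ) := by
  have : Fact p.Prime := ⟨hp⟩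
  have : NeZero ℓ := ⟨hℓ.ne'⟩
  have hb : ∀ (y : ZMod p → ℕ) (b : ZMod p),
      ∑ c, (bump y b c : ZMod p) * c = ∑ c, (y c : ZMod p) * c + b := by
    intro y b
    simp [bump_apply, add_mul, Finset.sum_add_distrib]
  -- The weighted sum determines the colour to be added, so no move changes a pattern. If `k / gcd`,
  -- hence `p`, divided all multiplicities, the weighted sum would be 0 rather than 1.
  refine one_div_le_of_labelled hk
    (fun a x => ∑ c, (x c : ZMod p) * c = 1 ∧ ¬ k / Nat.gcd k ℓ ∣ x a) ?_ (fun a x h => h.2) ?_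
  · intro y hy
    refine ⟨1 - ∑ c, (y c : ZMod p) * c, ?_⟩
    by_contra hcon
    push Not at hcon
    have h1 : ∑ c, (bump y (1 - ∑ c, (y c : ZMod p) * c) c : ZMod p) * c = 1 := by
      rw [hb]; ring
    have h2 : ∑ c, (bump y (1 - ∑ c, (y c : ZMod p) * c) c : ZMod p) * c = 0 := by
      refine Finset.sum_eq_zero fun c _ => ?_
      rw [(ZMod.natCast_eq_zero_iff _ _).2 (hpd.trans (hcon c h1)), zero_mul]
    rw [h1] at h2
    exact one_ne_zero h2
  · rintro y b c a a' hbc ⟨h1, -⟩ ⟨h2, -⟩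
    rw [hb] at h1 h2
    exact absurd (add_left_cancel (h1.trans h2.symm)) hbc

end LowerBound

/-! ### Families in three colours that give `1/3`. -/

section ThreeColours

/-- The patterns of a labelled family in three colours: the special ones, and the ones with property
`T` in which some multiplicity does not satisfy `Z`. -/
def InFamily (S₀ S₁ S₂ T : ℕ → ℕ → ℕ → Prop) (Z : ℕ → Prop) (a b c : ℕ) : Prop :=
  S₀ a b c ∨ S₁ a b c ∨ S₂ a b c ∨ (T a b c ∧ (¬ Z a ∨ ¬ Z b ∨ ¬ Z c))

/-- A family of patterns in three colours in which moves are possible only between special patterns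
that are labelled by the third colour. -/
theorem one_third_le_of_inFamily {k ℓ : ℕ} (hk : 0 < k) (hℓ : 0 < ℓ)
    (S₀ S₁ S₂ T : ℕ → ℕ → ℕ → Prop) (Z : ℕ → Prop)
    (hZ : ∀ v, ¬ Z v → ¬ k / Nat.gcd k ℓ ∣ v)
    (h₀ : ∀ a b c, S₀ a b c → ¬ Z a ∧ ¬ S₁ a b c ∧ ¬ S₂ a b c)
    (h₁ : ∀ a b c, S₁ a b c → ¬ Z b ∧ ¬ S₂ a b c)
    (h₂ : ∀ a b c, S₂ a b c → ¬ Z c)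
    (hext : ∀ a b c, a + b + c + 1 = k → InFamily S₀ S₁ S₂ T Z (a + 1) b c ∨
      InFamily S₀ S₁ S₂ T Z a (b + 1) c ∨ InFamily S₀ S₁ S₂ T Z a b (c + 1))
    (h₀₁ : ∀ a b c, InFamily S₀ S₁ S₂ T Z (a + 1) b c → InFamily S₀ S₁ S₂ T Z a (b + 1) c →
      S₂ (a + 1) b c ∧ S₂ a (b + 1) c)
    (h₀₂ : ∀ a b c, InFamily S₀ S₁ S₂ T Z (a + 1) b c → InFamily S₀ S₁ S₂ T Z a b (c + 1) →
      S₁ (a + 1) b c ∧ S₁ a b (c + 1))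
    (h₁₂ : ∀ a b c, InFamily S₀ S₁ S₂ T Z a (b + 1) c → InFamily S₀ S₁ S₂ T Z a b (c + 1) →
      S₀ a (b + 1) c ∧ S₀ a b (c + 1)) :
    1 / 3 ≤ codegreeTuranDensity k (tightCycle k ℓ) := by
  have : NeZero ℓ := ⟨hℓ.ne'⟩
  have h3 : ∀ a : ZMod 3, a = 0 ∨ a = 1 ∨ a = 2 := by decide
  have d1 : (0 : ZMod 3) ≠ 1 := by decide
  have d2 : (0 : ZMod 3) ≠ 2 := by decide
  have d3 : (1 : ZMod 3) ≠ 2 := by decide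
  let N : ℕ → ℕ → ℕ → Prop := fun a b c => T a b c ∧ ¬ (S₀ a b c ∨ S₁ a b c ∨ S₂ a b c)
  let R : ZMod 3 → ℕ → ℕ → ℕ → Prop := fun t a b c =>
    (t = 0 ∧ (S₀ a b c ∨ (N a b c ∧ ¬ Z a))) ∨ (t = 1 ∧ (S₁ a b c ∨ (N a b c ∧ ¬ Z b))) ∨
      (t = 2 ∧ (S₂ a b c ∨ (N a b c ∧ ¬ Z c)))
  have hRF : ∀ t a b c, R t a b c → InFamily S₀ S₁ S₂ T Z a b c := by
    intro t a b c h
    simp only [R, N, InFamily] at h ⊢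
    tauto
  have hFR : ∀ a b c, InFamily S₀ S₁ S₂ T Z a b c → ∃ t, R t a b c := by
    intro a b c h
    by_cases s0 : S₀ a b c
    · exact ⟨0, Or.inl ⟨rfl, Or.inl s0⟩⟩
    by_cases s1 : S₁ a b c
    · exact ⟨1, Or.inr (Or.inl ⟨rfl, Or.inl s1⟩)⟩
    by_cases s2 : S₂ a b c
    · exact ⟨2, Or.inr (Or.inr ⟨rfl, Or.inl s2⟩)⟩
    obtain ⟨hT, hz⟩ : T a b c ∧ (¬ Z a ∨ ¬ Z b ∨ ¬ Z c) := by
      simp only [InFamily] at h; tauto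
    have hN : N a b c := ⟨hT, by tauto⟩
    rcases hz with hz | hz | hz
    · exact ⟨0, Or.inl ⟨rfl, Or.inr ⟨hN, hz⟩⟩⟩
    · exact ⟨1, Or.inr (Or.inl ⟨rfl, Or.inr ⟨hN, hz⟩⟩)⟩
    · exact ⟨2, Or.inr (Or.inr ⟨rfl, Or.inr ⟨hN, hz⟩⟩)⟩
  have l0 : ∀ t a b c, S₀ a b c → (R t a b c ↔ t = 0) := by
    intro t a b c h
    have := h₀ a b c h
    simp only [R, N]
    tauto
  have l1 : ∀ t a b c, S₁ a b c → (R t a b c ↔ t = 1) := by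
    intro t a b c h
    have := h₁ a b c h
    have := h₀ a b c
    simp only [R, N]
    tauto
  have l2 : ∀ t a b c, S₂ a b c → (R t a b c ↔ t = 2) := by
    intro t a b c h
    have := h₂ a b c h
    have := h₁ a b c
    have := h₀ a b c
    simp only [R, N]
    tauto
  have key := one_div_le_of_labelled (q := 3) (ℓ := ℓ) hk (fun t x => R t (x 0) (x 1) (x 2))
    ?_ ?_ ?_
  · simpa using key
  · intro y hy
    have hsum : y 0 + y 1 + y 2 + 1 = k := by
      rw [← hy]
      congr 1
      exact (Fin.sum_univ_three (f := y)).symm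
    rcases hext _ _ _ hsum with h | h | h
    · obtain ⟨t, ht⟩ := hFR _ _ _ h
      exact ⟨0, t, by simpa [bump_apply, d1, d2] using ht⟩
    · obtain ⟨t, ht⟩ := hFR _ _ _ h
      exact ⟨1, t, by simpa [bump_apply, d1.symm, d3] using ht⟩
    · obtain ⟨t, ht⟩ := hFR _ _ _ h
      exact ⟨2, t, by simpa [bump_apply, d2.symm, d3.symm] using ht⟩
  · rintro t x h
    have a0 := h₀ (x 0) (x 1) (x 2)
    have a1 := h₁ (x 0) (x 1) (x 2)
    have a2 := h₂ (x 0) (x 1) (x 2)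
    refine hZ _ ?_
    rcases h with ⟨rfl, h⟩ | ⟨rfl, h⟩ | ⟨rfl, h⟩ <;> tauto
  · intro y b c t t' hbc hb hc
    have main : ∀ (u : ZMod 3) (S : ℕ → ℕ → ℕ → Prop) (a b c a' b' c' : ℕ),
        (∀ t a b c, S a b c → (R t a b c ↔ t = u)) → S a b c ∧ S a' b' c' → R t a b c →
        t = u ∧ R t a' b' c' := by
      intro u S a b c a' b' c' hS hs hR
      have := (hS t a b c hs.1).1 hR
      exact ⟨this, (hS t a' b' c' hs.2).2 this⟩
    rcases h3 b with rfl | rfl | rfl <;> rcases h3 c with rfl | rfl | rfl <;>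
      first
      | exact absurd rfl hbc
      | skip
    all_goals
      simp only [bump_apply, d1, d2, d3, d1.symm, d2.symm, d3.symm, if_true, if_false,
        add_zero] at hb hc ⊢
    · obtain ⟨rfl, h⟩ := main 2 S₂ _ _ _ _ _ _ l2 (h₀₁ _ _ _ (hRF _ _ _ _ hb) (hRF _ _ _ _ hc)) hb
      exact ⟨d2.symm, d3.symm, h⟩
    · obtain ⟨rfl, h⟩ := main 1 S₁ _ _ _ _ _ _ l1 (h₀₂ _ _ _ (hRF _ _ _ _ hb) (hRF _ _ _ _ hc)) hb
      exact ⟨d1.symm, d3, h⟩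
    · obtain ⟨rfl, h⟩ := main 2 S₂ _ _ _ _ _ _ l2
        (h₀₁ _ _ _ (hRF _ _ _ _ hc) (hRF _ _ _ _ hb)).symm hb
      exact ⟨d3.symm, d2.symm, h⟩
    · obtain ⟨rfl, h⟩ := main 0 S₀ _ _ _ _ _ _ l0 (h₁₂ _ _ _ (hRF _ _ _ _ hb) (hRF _ _ _ _ hc)) hb
      exact ⟨d1, d2, h⟩
    · obtain ⟨rfl, h⟩ := main 1 S₁ _ _ _ _ _ _ l1
        (h₀₂ _ _ _ (hRF _ _ _ _ hc) (hRF _ _ _ _ hb)).symm hb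
      exact ⟨d3, d1.symm, h⟩
    · obtain ⟨rfl, h⟩ := main 0 S₀ _ _ _ _ _ _ l0
        (h₁₂ _ _ _ (hRF _ _ _ _ hc) (hRF _ _ _ _ hb)).symm hb
      exact ⟨d2, d1, h⟩

theorem not_dvd_of_lt {m d v : ℕ} (hv : v < d * m) (h : ∀ t < d, v ≠ t * m) : ¬ m ∣ v := by
  rintro ⟨t, rfl⟩
  refine h t ?_ (mul_comm _ _)
  rw [mul_comm d m] at hv
  exact Nat.lt_of_mul_lt_mul_left hv

/-- Start from the patterns with `b + 2 * c ≡ 0` modulo 3. As `3 ∤ k`, only `(k, 0, 0)` has no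
admissible label. It is dropped, and `(k-1, 0, 0)` is extended by `(k-1, 1, 0)` instead. The only
move this creates leads to `(k-2, 1, 1)` and keeps the middle count, so both patterns get the middle
label. -/
theorem one_third_le_of_gcd_eq_one {k ℓ : ℕ} (hk : 5 ≤ k) (hk3 : ¬ 3 ∣ k) (hℓ : 0 < ℓ)
    (hd : Nat.gcd k ℓ = 1) : 1 / 3 ≤ codegreeTuranDensity k (tightCycle k ℓ) := by
  have hk3 : k % 3 = 1 ∨ k % 3 = 2 := by omega
  refine one_third_le_of_inFamily (by omega) hℓ (fun _ _ _ => False)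
    (fun a b c => (a + 1 = k ∧ b = 1 ∧ c = 0) ∨ (a + 2 = k ∧ b = 1 ∧ c = 1)) (fun _ _ _ => False)
    (fun a b c => a + b + c = k ∧ (b + 2 * c) % 3 = 0) (fun v => v = 0 ∨ k ≤ v)
    ?_ ?_ ?_ ?_ ?_ ?_ ?_ ?_
  · intro v hv
    rw [hd, Nat.div_one]
    exact fun h => by have := Nat.le_of_dvd (by omega) h; omega
  · intro a b c h; exact h.elim
  · intro a b c h; beta_reduce at *; exact ⟨by omega, id⟩
  · intro a b c h; exact h.elim
  · intro a b c h
    simp only [InFamily, false_or]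
    by_cases e : b = 0 ∧ c = 0
    · exact Or.inr (Or.inl (Or.inl (by omega)))
    obtain hc | hc | hc : (b + 2 * c) % 3 = 0 ∨ (b + 2 * c) % 3 = 1 ∨ (b + 2 * c) % 3 = 2 := by omega
    · exact Or.inl (Or.inr ⟨by omega, by omega⟩)
    · exact Or.inr (Or.inr (Or.inr ⟨by omega, by omega⟩))
    · exact Or.inr (Or.inl (Or.inr ⟨by omega, by omega⟩))
  · intro a b c h h'; simp only [InFamily, false_or, false_and] at *; omega
  · intro a b c h h'; simp only [InFamily, false_or] at *; omega
  · intro a b c h h'; simp only [InFamily, false_or, false_and] at *; omega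

/-- Now the patterns without admissible label are `(2m, 0, 0)` and `(0, m, m)`. The sub-patterns
`(0, m, m-1)` and `(0, m-1, m)` of the latter are extended by repeating their colour of multiplicity
`m`; the resulting count `m + 1` is the label, shared with the one pattern reachable by a move. -/
theorem one_third_le_of_gcd_eq_two {m ℓ : ℕ} (hm : 5 ≤ m) (hm3 : ¬ 3 ∣ m) (hℓ : 0 < ℓ)
    (hd : Nat.gcd (2 * m) ℓ = 2) : 1 / 3 ≤ codegreeTuranDensity (2 * m) (tightCycle (2 * m) ℓ) := by
  have hm3 : m % 3 = 1 ∨ m % 3 = 2 := by omega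
  refine one_third_le_of_inFamily (by omega) hℓ (fun _ _ _ => False)
    (fun a b c => (a + 1 = 2 * m ∧ b = 1 ∧ c = 0) ∨ (a + 2 = 2 * m ∧ b = 1 ∧ c = 1) ∨
      (a = 0 ∧ b = m + 1 ∧ c + 1 = m) ∨ (a = 1 ∧ b = m + 1 ∧ c + 2 = m))
    (fun a b c => (a = 0 ∧ b + 1 = m ∧ c = m + 1) ∨ (a = 1 ∧ b + 2 = m ∧ c = m + 1))
    (fun a b c => a + b + c = 2 * m ∧ (b + 2 * c) % 3 = 0) (fun v => v = 0 ∨ v = m ∨ 2 * m ≤ v)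
    ?_ ?_ ?_ ?_ ?_ ?_ ?_ ?_
  · intro v hv
    rw [hd, Nat.mul_div_cancel_left m two_pos]
    exact not_dvd_of_lt (d := 2) (by omega) (fun t ht => by interval_cases t <;> omega)
  · intro a b c h; exact h.elim
  · intro a b c h; beta_reduce at *; omega
  · intro a b c h; beta_reduce at *; omega
  · intro a b c h
    simp only [InFamily, false_or]
    by_cases e : b = 0 ∧ c = 0
    · exact Or.inr (Or.inl (Or.inl (Or.inl (by omega))))
    by_cases e₁ : a = 0 ∧ b = m
    · exact Or.inr (Or.inl (Or.inl (Or.inr (Or.inr (Or.inl (by omega))))))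
    by_cases e₂ : a = 0 ∧ c = m
    · exact Or.inr (Or.inr (Or.inr (Or.inl (Or.inl (by omega)))))
    obtain hc | hc | hc : (b + 2 * c) % 3 = 0 ∨ (b + 2 * c) % 3 = 1 ∨ (b + 2 * c) % 3 = 2 := by omega
    · exact Or.inl (Or.inr (Or.inr ⟨by omega, by omega⟩))
    · exact Or.inr (Or.inr (Or.inr (Or.inr ⟨by omega, by omega⟩)))
    · exact Or.inr (Or.inl (Or.inr (Or.inr ⟨by omega, by omega⟩)))
  · intro a b c h h'
    simp only [InFamily, false_or] at *
    rcases h with (h | h | h | h) | (h | h) | h <;>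
      rcases h' with (h' | h' | h' | h') | (h' | h') | h' <;> omega
  · intro a b c h h'
    simp only [InFamily, false_or] at *
    rcases h with (h | h | h | h) | (h | h) | h <;>
      rcases h' with (h' | h' | h' | h') | (h' | h') | h' <;> omega
  · intro a b c h h'
    simp only [InFamily, false_or, false_and] at *
    rcases h with (h | h | h | h) | (h | h) | h <;>
      rcases h' with (h' | h' | h' | h') | (h' | h') | h' <;> omega

-- The residue is `m` instead of 0, which excludes `(m, m, m)` and the three monochromatic patterns.
-- Only `(2m, m, 0)`, `(0, 2m, m)` and `(m, 0, 2m)` lack a label. Each has two sub-patterns to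
-- repair, which gives the six special pairs, cyclically symmetric in the colours.
set_option maxHeartbeats 1000000 in
theorem one_third_le_of_gcd_eq_three {m ℓ : ℕ} (hm : 5 ≤ m) (hm3 : ¬ 3 ∣ m) (hℓ : 0 < ℓ)
    (hd : Nat.gcd (3 * m) ℓ = 3) : 1 / 3 ≤ codegreeTuranDensity (3 * m) (tightCycle (3 * m) ℓ) := by
  have hm3 : m % 3 = 1 ∨ m % 3 = 2 := by omega
  refine one_third_le_of_inFamily (by omega) hℓ
    (fun a b c => (a = 2 * m + 1 ∧ b + c + 1 = m ∧ c ≤ 1) ∨ (a = m + 1 ∧ b + c + 1 = 2 * m ∧ b ≤ 1))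
    (fun a b c => (b = m + 1 ∧ a + c + 1 = 2 * m ∧ c ≤ 1) ∨ (b = 2 * m + 1 ∧ a + c + 1 = m ∧ a ≤ 1))
    (fun a b c => (c = m + 1 ∧ a + b + 1 = 2 * m ∧ a ≤ 1) ∨ (c = 2 * m + 1 ∧ a + b + 1 = m ∧ b ≤ 1))
    (fun a b c => a + b + c = 3 * m ∧ (b + 2 * c) % 3 = m % 3)
    (fun v => v = 0 ∨ v = m ∨ v = 2 * m ∨ 3 * m ≤ v)
    ?_ ?_ ?_ ?_ ?_ ?_ ?_ ?_
  · intro v hv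
    rw [hd, Nat.mul_div_cancel_left m three_pos]
    exact not_dvd_of_lt (d := 3) (by omega) (fun t ht => by interval_cases t <;> omega)
  · intro a b c h; beta_reduce at *; omega
  · intro a b c h; beta_reduce at *; omega
  · intro a b c h; beta_reduce at *; omega
  · intro a b c h
    simp only [InFamily]
    by_cases e₁ : c = 0 ∧ b = m
    · exact Or.inr (Or.inl (Or.inr (Or.inl (Or.inl (by omega)))))
    by_cases e₂ : c = 0 ∧ a = 2 * m
    · exact Or.inl (Or.inl (Or.inl (by omega)))
    by_cases e₃ : a = 0 ∧ c = m
    · exact Or.inr (Or.inr (Or.inr (Or.inr (Or.inl (Or.inl (by omega))))))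
    by_cases e₄ : a = 0 ∧ b = 2 * m
    · exact Or.inr (Or.inl (Or.inr (Or.inl (Or.inr (by omega)))))
    by_cases e₅ : b = 0 ∧ a = m
    · exact Or.inl (Or.inl (Or.inr (by omega)))
    by_cases e₆ : b = 0 ∧ c = 2 * m
    · exact Or.inr (Or.inr (Or.inr (Or.inr (Or.inl (Or.inr (by omega))))))
    obtain hc | hc | hc : (b + 2 * c) % 3 = m % 3 ∨ (b + 2 * c + 2) % 3 = m % 3 ∨
      (b + 2 * c + 1) % 3 = m % 3 := by omega
    · exact Or.inl (Or.inr (Or.inr (Or.inr ⟨by omega, by omega⟩)))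
    · exact Or.inr (Or.inr (Or.inr (Or.inr (Or.inr ⟨by omega, by omega⟩))))
    · exact Or.inr (Or.inl (Or.inr (Or.inr (Or.inr ⟨by omega, by omega⟩))))
  · intro a b c h h'
    simp only [InFamily] at *
    rcases h with (h | h) | (h | h) | (h | h) | h <;>
      rcases h' with (h' | h') | (h' | h') | (h' | h') | h' <;> omega
  · intro a b c h h'
    simp only [InFamily] at *
    rcases h with (h | h) | (h | h) | (h | h) | h <;>
      rcases h' with (h' | h') | (h' | h') | (h' | h') | h' <;> omega
  · intro a b c h h'
    simp only [InFamily] at *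
    rcases h with (h | h) | (h | h) | (h | h) | h <;>
      rcases h' with (h' | h') | (h' | h') | (h' | h') | h' <;> omega

end ThreeColours

/-! ### Congruence conditions and conclusion. -/

/-- Write `k = i * m`. The congruence says `m ≡ 1` modulo 6, so `m` is coprime to 6, and `m ≠ 1`
because `k ∤ ℓ`; hence `m ≥ 7`. -/
theorem one_third_le_of_mod {k ℓ i : ℕ} (hk3 : 3 ≤ k) (hℓ : 0 < ℓ) (hdvd : ¬ k ∣ ℓ) (hi1 : 1 ≤ i)
    (hi3 : i ≤ 3) (hmod : k ≡ i [MOD 6 * i]) (hgcd : Nat.gcd k ℓ = i) :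
    3 < (k / Nat.gcd k ℓ).minFac ∧ 1 / 3 ≤ codegreeTuranDensity k (tightCycle k ℓ) := by
  obtain ⟨m, rfl⟩ : i ∣ k := hgcd ▸ Nat.gcd_dvd_left k ℓ
  have hm6 : m % 6 = 1 := by
    have h : i * m ≡ i * 1 [MOD i * 6] := by simpa [mul_comm] using hmod
    exact Nat.ModEq.mul_left_cancel' (by omega) h
  have hm1 : m ≠ 1 := by
    rintro rfl
    rw [mul_one] at hgcd hdvd
    exact hdvd (Nat.gcd_eq_left_iff_dvd.1 hgcd)
  refine ⟨?_, ?_⟩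
  · rw [hgcd, Nat.mul_div_cancel_left m (by omega)]
    have hp := Nat.minFac_prime hm1
    have hd := Nat.minFac_dvd m
    by_contra h
    have h2 := hp.two_le
    obtain h | h : m.minFac = 2 ∨ m.minFac = 3 := by omega
    all_goals rw [h] at hd; omega
  · obtain rfl | rfl | rfl : i = 1 ∨ i = 2 ∨ i = 3 := by omega
    · rw [one_mul] at hgcd ⊢
      exact one_third_le_of_gcd_eq_one (by omega) (by omega) hℓ hgcd
    · exact one_third_le_of_gcd_eq_two (by omega) (by omega) hℓ hgcd
    · exact one_third_le_of_gcd_eq_three (by omega) (by omega) hℓ hgcd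

theorem one_div_lt_of_one_third_le {p : ℕ} {x : ℝ} (hp : 3 < p) (h : 1 / 3 ≤ x) :
    1 / (p : ℝ) < x := by
  refine lt_of_lt_of_le (one_div_lt_one_div_of_lt (by norm_num) ?_) h
  exact_mod_cast hp

end CodegreeTuran

open CodegreeTuran in
theorem corollary1p5 :
    (∀ k ℓ p : ℕ, 3 ≤ k → k < ℓ → ¬ k ∣ ℓ → 20 * k ^ 2 ≤ ℓ →
      p = (k / Nat.gcd k ℓ).minFac →
      Filter.Tendsto
        (fun n : ℕ => (CodegreeTuran.codegreeTuranNumber k n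
          (CodegreeTuran.tightCycle k ℓ) : ℝ) / (n : ℝ))
        Filter.atTop
        (nhds (CodegreeTuran.codegreeTuranDensity k (CodegreeTuran.tightCycle k ℓ))) ∧
      1 / (p : ℝ) ≤ CodegreeTuran.codegreeTuranDensity k (CodegreeTuran.tightCycle k ℓ) ∧
      (p = 2 →
        CodegreeTuran.codegreeTuranDensity k (CodegreeTuran.tightCycle k ℓ) = 1 / 2) ∧
      (p = 3 →
        CodegreeTuran.codegreeTuranDensity k (CodegreeTuran.tightCycle k ℓ) = 1 / 3) ∧
      (∀ i : ℕ, 1 ≤ i → i ≤ 3 → k ≡ i [MOD 6 * i] → Nat.gcd k ℓ = i →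
        3 < p ∧
        1 / (p : ℝ) < CodegreeTuran.codegreeTuranDensity k (CodegreeTuran.tightCycle k ℓ))) ∧
    (∀ p : ℕ, p.Prime → 3 < p →
      {x : ℕ × ℕ | 3 ≤ x.1 ∧ x.1 < x.2 ∧ ¬ x.1 ∣ x.2 ∧ 20 * x.1 ^ 2 ≤ x.2 ∧
        p = (x.1 / Nat.gcd x.1 x.2).minFac ∧
        1 / (p : ℝ) < CodegreeTuran.codegreeTuranDensity x.1
          (CodegreeTuran.tightCycle x.1 x.2)}.Infinite ∧
      {x : ℕ × ℕ | 3 ≤ x.1 ∧ x.1 < x.2 ∧ ¬ x.1 ∣ x.2 ∧ 20 * x.1 ^ 2 ≤ x.2 ∧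
        p = (x.1 / Nat.gcd x.1 x.2).minFac ∧ Nat.gcd x.1 x.2 ≠ 1 ∧
        1 / (p : ℝ) < CodegreeTuran.codegreeTuranDensity x.1
          (CodegreeTuran.tightCycle x.1 x.2)}.Infinite) := by
  refine ⟨?_, ?_⟩
  · rintro k ℓ p hk hkℓ hdvd hℓ rfl
    have hne : k / Nat.gcd k ℓ ≠ 1 := by
      intro h
      have := Nat.div_mul_cancel (Nat.gcd_dvd_left k ℓ)
      rw [h, one_mul] at this
      exact hdvd (Nat.gcd_eq_left_iff_dvd.1 this)
    have hℓ17 : 17 * k * k ≤ ℓ := by nlinarith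
    have hp := Nat.minFac_prime hne
    have hlow := one_div_prime_le (k := k) (ℓ := ℓ) (by omega) (by omega) hp (Nat.minFac_dvd _)
    refine ⟨tendsto_ratio (by omega) ℓ, hlow, fun h => ?_, fun h => ?_, ?_⟩
    · refine le_antisymm (codegreeTuranDensity_le_half (by omega) hℓ17) ?_
      rw [h] at hlow
      exact_mod_cast hlow
    · refine le_antisymm (codegreeTuranDensity_le_third hk hℓ17 ?_) ?_
      · rw [← Nat.not_even_iff_odd, even_iff_two_dvd, ← Nat.minFac_eq_two_iff, h]
        decide
      · rw [h] at hlow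
        exact_mod_cast hlow
    · intro i h1 h3 hmod hgcd
      obtain ⟨h, h'⟩ := one_third_le_of_mod hk (by omega) hdvd h1 h3 hmod hgcd
      exact ⟨h, one_div_lt_of_one_third_le h h'⟩
  · intro p hp hp3
    have hp3' : ¬ 3 ∣ p := fun h => by
      have := (Nat.prime_dvd_prime_iff_eq Nat.prime_three hp).1 h; omega
    have hp4 : p ≠ 4 := by rintro rfl; revert hp; decide
    have hgcd : ∀ s : ℕ, Nat.gcd p (p * s + 1) = 1 := fun s => by simp
    have hbig : ∀ t : ℕ, p * 20 * p ≤ p * (20 * p + t) := fun t => by nlinarith [Nat.zero_le (p * t)]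
    have hndvd : ∀ s : ℕ, ¬ p ∣ p * s + 1 := fun s h => by
      have := Nat.gcd_eq_left h
      rw [hgcd] at this
      omega
    have hinj : ∀ s t : ℕ, p * (20 * p + s) = p * (20 * p + t) → s = t := fun s t h => by
      have := Nat.eq_of_mul_eq_mul_left (by omega) h
      omega
    constructor
    -- The pairs `k = p`, `ℓ ≡ 1` modulo `p` are coprime; the summand `20 * p` makes `ℓ` large
    -- enough.
    · refine Set.infinite_of_injective_forall_mem
        (f := fun t : ℕ => (p, p * (20 * p + t) + 1)) (fun s t h => ?_) (fun t => ?_)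
      · simp only [Prod.mk.injEq] at h
        exact hinj s t (by omega)
      · have := hbig t
        refine ⟨by omega, ?_, hndvd _, ?_, ?_, ?_⟩
        · show p < _
          nlinarith
        · show 20 * p ^ 2 ≤ _
          nlinarith
        · show p = (p / Nat.gcd p _).minFac
          rw [hgcd, Nat.div_one, hp.minFac_eq]
        · exact one_div_lt_of_one_third_le hp3
            (one_third_le_of_gcd_eq_one (by omega) hp3' (by omega) (hgcd _))
    · have hgcd2 : ∀ s : ℕ, Nat.gcd (2 * p) (2 * (p * s + 1)) = 2 := fun s => by
        rw [Nat.gcd_mul_left, hgcd]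
      -- Doubling such a pair makes the greatest common divisor 2 and keeps the quotient `p`; the
      -- larger summand accounts for `k = 2 * p`.
      refine Set.infinite_of_injective_forall_mem
        (f := fun t : ℕ => (2 * p, 2 * (p * (20 * (2 * p) + t) + 1))) (fun s t h => ?_) (fun t => ?_)
      · simp only [Prod.mk.injEq] at h
        have h' : p * (20 * (2 * p) + s) = p * (20 * (2 * p) + t) := by omega
        have := Nat.eq_of_mul_eq_mul_left (by omega) h'
        omega
      · have hb : 40 * (p * p) ≤ p * (20 * (2 * p) + t) := by nlinarith [Nat.zero_le (p * t)]
        refine ⟨?_, ?_, ?_, ?_, ?_, ?_, ?_⟩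
        · show 3 ≤ 2 * p
          omega
        · show 2 * p < _
          nlinarith
        · exact fun h => hndvd _ (Nat.dvd_of_mul_dvd_mul_left two_pos h)
        · show 20 * (2 * p) ^ 2 ≤ _
          nlinarith
        · show p = (2 * p / Nat.gcd (2 * p) _).minFac
          rw [hgcd2, Nat.mul_div_cancel_left p two_pos, hp.minFac_eq]
        · show Nat.gcd (2 * p) _ ≠ 1
          rw [hgcd2]
          decide
        · exact one_div_lt_of_one_third_le hp3
            (one_third_le_of_gcd_eq_two (by omega) hp3' (by omega) (hgcd2 _))
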